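/- Let $d\ge 0$ and let $H=H(p,x):\mathbb R^d\times\mathbb R^d\to\mathbb R$ be continuous, convex in $p$ for every $x$, and such that $\underline\nu(|p|)\le H(p,x)\le\overline\nu(|p|)$ for all $(p,x)$, where $\underline\nu,\overline\nu:[0,\infty)\to\mathbb R$ are convex and increasing ($\underline\nu$ strictly). For a continuous path $\zeta:[0,\infty)\to\mathbb R$ consider $$u_t=H(Du,x)\,\dot\zeta\ \text{ in }\mathbb R^d\times(0,\infty),\qquad u(\cdot,0)=u_0 .\tag{1}$$ For piecewise $C^1$ paths, a solution of (1) is a continuous function on $\mathbb R^d\times[0,\infty)$ that is a viscosity solution on $\mathbb R^d\times I$ for every open interval $I$ of $(0,\infty)$ on which $\zeta$ is $C^1$, attains the initial data, and satisfies $|u(x,t)|\le C_T(1+|x|)$ on $\mathbb R^d\times[0,T]$ for every $T$. Write $a_-=\max(-a,0)$. Spaces of continuous functions carry the topology of locally uniform convergence. (a) Let $\zeta^1,\zeta^2$ be piecewise $C^1$, let $u_0^1,u_0^2$ be Lipschitz with constant $L\ge 0$, and let $u^1,u^2$ be the corresponding solutions. Then $\|Du^j(\cdot,t)\|_\infty\le\underline\nu^{-1}(\overline\nu(L))$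 for all $t\ge0$ and $j=1,2$. If moreover $\zeta^1(0)=\zeta^2(0)$, then, for every $T\ge0$, with $M_T=\max_{[0,T]}|\zeta^1-\zeta^2|$, and for all $(x,t)\in\mathbb R^d\times[0,T]$, $$u^1(x,t)-u^2(x,t)\le \sup_{\mathbb R^d}|u_0^1-u_0^2|+\overline\nu(L)\,M_T+\underline\nu(0)_-\bigl(M_T-(\zeta^1(t)-\zeta^2(t))\bigr),$$ and consequently $$|u^1(x,t)-u^2(x,t)|\le \sup_{\mathbb R^d}|u_0^1-u_0^2|+\overline\nu(L)\,M_T+\underline\nu(0)_-\bigl(M_T+|\zeta^1(t)-\zeta^2(t)|\bigr).$$ (b) For every uniformly continuous $u_0$, there is a unique continuous map $S_{u_0}:C([0,\infty))\to C(\mathbb R^d\times[0,\infty))$ such that $S_{u_0}(\zeta)$ is a solution of (1) for every $\zeta\in C^1([0,\infty))$; moreover, for every piecewise $C^1$ path $\zeta$, $S_{u_0}(\zeta)$ is the unique solution of (1). (c) If $u_0$ is Lipschitz with constant $L$, then $\|D_xS_{u_0}(\zeta)(\cdot,t)\|_\infty\le\underline\nu^{-1}(\overline\nu(L))$ for all continuous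 $\zeta$ and all $t\ge0$, and, for all continuous $\zeta_1,\zeta_2$ and all $T\ge0$, $$\sup_{\mathbb R^d\times[0,T]}|S_{u_0}(\zeta_1)-S_{u_0}(\zeta_2)|\le 2\bigl(\overline\nu(L)+2\,\underline\nu(0)_-\bigr)\max_{[0,T]}|\zeta_1-\zeta_2| .$$ -/

import Mathlib

open scoped NNReal

/-- Euclidean space `ℝ^d`. -/
abbrev Space (d : ℕ) : Type := EuclideanSpace ℝ (Fin d)

/-- `H(p, x)` is continuous, convex in `p`, and lies between `νl(|p|)` and `νu(|p|)`, where `νl` and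
`νu` are convex and increasing on `[0, ∞)`. The lower function is strictly increasing, so that it
has an inverse; for the upper one monotonicity suffices. -/
structure IsConvexCoerciveHamiltonian {d : ℕ} (H : Space d → Space d → ℝ) (νl νu : ℝ → ℝ) :
    Prop where
  continuous_uncurry : Continuous fun q : Space d × Space d => H q.1 q.2
  convex : ∀ x, ConvexOn ℝ Set.univ fun p => H p x
  lower_convex : ConvexOn ℝ (Set.Ici 0) νl
  lower_strictMono : StrictMonoOn νl (Set.Ici 0)
  upper_convex : ConvexOn ℝ (Set.Ici 0) νu
  upper_mono : MonotoneOn νu (Set.Ici 0)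
  lower_le : ∀ p x, νl ‖p‖ ≤ H p x
  le_upper : ∀ p x, H p x ≤ νu ‖p‖

/-- A path on `[0, ∞)`, extended to `ℝ` by its initial value on `(-∞, 0)`. Only its behaviour on
`[0, ∞)` is ever used. -/
def pathExt (ζ : C(ℝ≥0, ℝ)) (t : ℝ) : ℝ := ζ t.toNNReal

/-- `ζ ∈ C¹([0, ∞))`, with a one-sided derivative at `0`. -/
def IsC1Path (ζ : C(ℝ≥0, ℝ)) : Prop := ContDiffOn ℝ 1 (pathExt ζ) (Set.Ici 0)

/-- `ζ` is continuous and piecewise `C¹` on `[0, ∞)`: every `t ≥ 0` has a right neighbourhood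
`[t, t + ε]` and, if `t > 0`, a left neighbourhood `[t - ε, t]` on which `ζ` is `C¹` up to the end
points. By compactness this says that every `[0, T]` splits into finitely many intervals on each of
which `ζ` is `C¹` up to the end points. -/
def IsPiecewiseC1Path (ζ : C(ℝ≥0, ℝ)) : Prop :=
  ∀ t : ℝ, 0 ≤ t → ∃ ε > 0, ContDiffOn ℝ 1 (pathExt ζ) (Set.Icc t (t + ε)) ∧
    (0 < t → ContDiffOn ℝ 1 (pathExt ζ) (Set.Icc (t - ε) t))

/-- Viscosity sub-solution of `u_t = H(Du, x) ζ'(t)` in `ℝ^d × (0, ∞)`. The equation is tested at the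
times near which `ζ` is `C¹`: all positive times for a `C¹` path, all positive times off the break
points for a piecewise `C¹` path. -/
def IsViscositySubsolution {d : ℕ} (H : Space d → Space d → ℝ) (ζ : C(ℝ≥0, ℝ))
    (u : C(Space d × ℝ≥0, ℝ)) : Prop :=
  ∀ φ : Space d × ℝ → ℝ, ContDiff ℝ 1 φ → ∀ (x : Space d) (t : ℝ), 0 < t →
    ContDiffAt ℝ 1 (pathExt ζ) t →
    IsLocalMax (fun q : Space d × ℝ => u (q.1, q.2.toNNReal) - φ q) (x, t) →
    deriv (fun s => φ (x, s)) t ≤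
      H (gradient (fun y => φ (y, t)) x) x * deriv (pathExt ζ) t

/-- Viscosity super-solution of `u_t = H(Du, x) ζ'(t)` in `ℝ^d × (0, ∞)`. -/
def IsViscositySupersolution {d : ℕ} (H : Space d → Space d → ℝ) (ζ : C(ℝ≥0, ℝ))
    (u : C(Space d × ℝ≥0, ℝ)) : Prop :=
  ∀ φ : Space d × ℝ → ℝ, ContDiff ℝ 1 φ → ∀ (x : Space d) (t : ℝ), 0 < t →
    ContDiffAt ℝ 1 (pathExt ζ) t →
    IsLocalMin (fun q : Space d × ℝ => u (q.1, q.2.toNNReal) - φ q) (x, t) →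
    H (gradient (fun y => φ (y, t)) x) x * deriv (pathExt ζ) t ≤
      deriv (fun s => φ (x, s)) t

/-- `u` is a (continuous) viscosity solution of `u_t = H(Du, x) ζ'` in `ℝ^d × (0, ∞)` with
`u(·, 0) = u₀`, in the usual class of functions of at most linear growth in space, locally uniformly
in time (every function that is uniformly continuous on each `ℝ^d × [0, T]` belongs to it). -/
structure IsViscositySolution {d : ℕ} (H : Space d → Space d → ℝ) (ζ : C(ℝ≥0, ℝ))
    (u₀ : Space d → ℝ) (u : C(Space d × ℝ≥0, ℝ)) : Prop where
  subsolution : IsViscositySubsolution H ζ u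
  supersolution : IsViscositySupersolution H ζ u
  initial : ∀ x, u (x, 0) = u₀ x
  linear_growth : ∀ T : ℝ≥0, ∃ C : ℝ, ∀ x, ∀ t ≤ T, |u (x, t)| ≤ C * (1 + ‖x‖)

/-- `S : C([0, ∞)) → C(ℝ^d × [0, ∞))` is a continuous extension (both spaces carry the topology of
locally uniform convergence) of the solution operator of `u_t = H(Du, x) ζ'`, `u(·, 0) = u₀`, from
`C¹` paths to continuous paths. -/
def IsSolutionOperator {d : ℕ} (H : Space d → Space d → ℝ) (u₀ : Space d → ℝ)
    (S : C(ℝ≥0, ℝ) → C(Space d × ℝ≥0, ℝ)) : Prop :=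
  Continuous S ∧ ∀ ζ, IsC1Path ζ → IsViscositySolution H ζ u₀ (S ζ)

/-- `max_{t ∈ [0, T]} |ζ¹(t) - ζ²(t)|`. -/
noncomputable def pathDist (T : ℝ≥0) (ζ₁ ζ₂ : C(ℝ≥0, ℝ)) : ℝ :=
  sSup ((fun t => |ζ₁ t - ζ₂ t|) '' Set.Icc 0 T)

/-! ### Chains of admissible straight moves and the associated semigroups -/

/-! Convexity makes `H` a supremum of affine functions `⟪q, p⟫ - b`, so `u_t = H(Du, x)` is a
control problem: move with velocity `q` at running cost `b`. Instead of an action on curves, the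
proof uses finite chains of straight moves, each with an affine function lying below `H(·, z)` along
its whole segment (`Reach`). They define the semigroups `sp` for `+H` and `sm` for `-H`, without
minimisers or any regularity of `H` in `x` beyond continuity. By `exists_locally_admissible` such
affine functions still recover `H` at every point.

The invariant is `CostDominated H c u`, the integrated form of `H(Du, x) ≤ c`. Both semigroups
preserve it. An `L`-Lipschitz function has it with `c = νu L`, and `c = νl K` in turn forces the
Lipschitz constant `K`; this is the gradient bound, whatever the path.

Dependence on the path rests on `sp t ∘ sm t ≤ id ≤ sm t ∘ sp t`. It implies (`sp_flowStep_le`,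
`discreteFlow_le`) that if `a ≤ b + M`, then following `a` and lifting by the current gap `M - (a -
b)` stays below lifting by `M` first and following `b`. A lift by `M` raises `u` by at most `c * M`,
and a lift by the gap lowers it by at most `(νl 0)⁻` times the gap: these are the two terms of the
estimate. Since only the uniform distance of the paths enters, flows along dyadic samples of a
continuous path converge (`pathFlow`).

It remains to identify the flow with the viscosity solution. `pathFlow_subsolution` gives one half,
and the symmetry `(H(p, x), ζ, u) ↦ (H(-p, x), -ζ, -u)` the other. Uniqueness comes from doubling
variables against a function that is Lipschitz in space, such as the flow of Lipschitz data
(`comparison_on_smooth_interval`). Uniformly continuous data are uniform limits of Lipschitz ones,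
and density of `C¹` paths makes the continuous extension unique. -/

/-- The Hamiltonian `H(-p, x)`. -/
def flipHam {d : ℕ} (H : Space d → Space d → ℝ) : Space d → Space d → ℝ := fun p => H (-p)

@[simp] lemma flipHam_flipHam {d : ℕ} (H : Space d → Space d → ℝ) : flipHam (flipHam H) = H := by
  funext p; simp [flipHam]

lemma IsConvexCoerciveHamiltonian.flip {d : ℕ} {H : Space d → Space d → ℝ} {νl νu : ℝ → ℝ}
    (hH : IsConvexCoerciveHamiltonian H νl νu) : IsConvexCoerciveHamiltonian (flipHam H) νl νu where
  continuous_uncurry :=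
    hH.continuous_uncurry.comp ((continuous_neg.comp continuous_fst).prodMk continuous_snd)
  convex x := by
    have h := (hH.convex x).comp_linearMap (-LinearMap.id : Space d →ₗ[ℝ] Space d)
    simpa [flipHam, Function.comp_def] using h
  lower_convex := hH.lower_convex
  lower_strictMono := hH.lower_strictMono
  upper_convex := hH.upper_convex
  upper_mono := hH.upper_mono
  lower_le p x := by simpa [flipHam] using hH.lower_le (-p) x
  le_upper p x := by simpa [flipHam] using hH.le_upper (-p) x

/-- The affine function `p ↦ ⟪q, p⟫ - b` lies below `H(·, z)` for all `z` in the segment. -/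
def Admissible {d : ℕ} (H : Space d → Space d → ℝ) (q : Space d) (b : ℝ) (x y : Space d) : Prop :=
  ∀ z ∈ segment ℝ x y, ∀ p, inner ℝ q p - b ≤ H p z

/-- `y` can be reached from `x` in time `t` at cost `κ` by admissible straight moves. -/
inductive Reach {d : ℕ} (H : Space d → Space d → ℝ) : ℝ → Space d → Space d → ℝ → Prop
  | refl (x : Space d) : Reach H 0 x x 0
  | step {t x y κ} (h : Reach H t x y κ) (s : ℝ) (q : Space d) (b : ℝ) (hs : 0 ≤ s)
      (ha : Admissible H q b y (y + s • q)) : Reach H (t + s) x (y + s • q) (κ + s * b)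

section Chains

variable {d : ℕ} {H : Space d → Space d → ℝ} {νl νu : ℝ → ℝ}

lemma Reach.nonneg {t κ : ℝ} {x y : Space d} (h : Reach H t x y κ) : 0 ≤ t := by
  induction h with
  | refl => exact le_rfl
  | step _ _ _ _ hs _ ih => exact add_nonneg ih hs

lemma Reach.congr {t t' κ κ' : ℝ} {x y y' : Space d} (h : Reach H t x y κ) (ht : t = t')
    (hy : y = y') (hκ : κ = κ') : Reach H t' x y' κ' := by
  subst ht hy hκ; exact h

lemma Reach.single {x q : Space d} {s b : ℝ} (hs : 0 ≤ s) (ha : Admissible H q b x (x + s • q)) :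
    Reach H s x (x + s • q) (s * b) :=
  (Reach.step (Reach.refl x) s q b hs ha).congr (zero_add _) rfl (zero_add _)

lemma Reach.trans {t s κ κ' : ℝ} {x y z : Space d} (h : Reach H t x y κ) (h' : Reach H s y z κ') :
    Reach H (t + s) x z (κ + κ') := by
  induction h' with
  | refl => exact h.congr (add_zero _).symm rfl (add_zero _).symm
  | step _ s q b hs ha ih =>
    exact (Reach.step (ih h) s q b hs ha).congr (by ring) rfl (by ring)

lemma Admissible.mono {q : Space d} {b : ℝ} {x y x' y' : Space d} (h : Admissible H q b x y)
    (hs : segment ℝ x' y' ⊆ segment ℝ x y) : Admissible H q b x' y' :=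
  fun z hz p => h z (hs hz) p

lemma add_smul_mem_segment {x q : Space d} {r s : ℝ} (hr : 0 ≤ r) (hrs : r ≤ s) :
    x + r • q ∈ segment ℝ x (x + s • q) := by
  rcases eq_or_lt_of_le (hr.trans hrs) with h | h
  · have : r = 0 := le_antisymm (h ▸ hrs) hr
    subst this; simpa using left_mem_segment ℝ x _
  · rw [segment_eq_image']
    refine ⟨r / s, ⟨by positivity, (div_le_one h).2 hrs⟩, ?_⟩
    simp only [add_sub_cancel_left, smul_smul]
    rw [div_mul_cancel₀ _ h.ne']

/-- A move can be cut at any time because admissibility passes to subsegments. The semigroup law and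
the invariance of `CostDominated` both rest on this. -/
lemma Reach.split {t κ : ℝ} {x z : Space d} (h : Reach H t x z κ) :
    ∀ r, 0 ≤ r → r ≤ t →
      ∃ y κ₁ κ₂, Reach H r x y κ₁ ∧ Reach H (t - r) y z κ₂ ∧ κ = κ₁ + κ₂ := by
  induction h with
  | refl x =>
    intro r h0 h1
    obtain rfl : r = 0 := le_antisymm h1 h0
    exact ⟨x, 0, 0, .refl x, (Reach.refl x).congr (by ring) rfl rfl, by ring⟩
  | @step t x y κ h s q b hs ha ih =>
    intro r h0 h1
    rcases le_or_gt r t with hr | hr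
    · obtain ⟨w, κ₁, κ₂, h₁, h₂, rfl⟩ := ih r h0 hr
      exact ⟨w, κ₁, κ₂ + s * b, h₁, (Reach.step h₂ s q b hs ha).congr (by ring) rfl rfl, by ring⟩
    · have e : y + (r - t) • q + (s - (r - t)) • q = y + s • q := by
        rw [add_assoc, ← add_smul]; congr 2; ring
      have hm : y + (r - t) • q ∈ segment ℝ y (y + s • q) :=
        add_smul_mem_segment (by linarith) (by linarith)
      have a₁ : Admissible H q b y (y + (r - t) • q) :=
        ha.mono ((convex_segment _ _).segment_subset (left_mem_segment _ _ _) hm)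
      have a₂ : Admissible H q b (y + (r - t) • q) (y + (r - t) • q + (s - (r - t)) • q) := by
        rw [e]
        exact ha.mono ((convex_segment _ _).segment_subset hm (right_mem_segment _ _ _))
      refine ⟨y + (r - t) • q, κ + (r - t) * b, (s - (r - t)) * b,
        (Reach.step h _ q b (by linarith) a₁).congr (by ring) rfl rfl,
        (Reach.single (by linarith) a₂).congr (by ring) e rfl, by ring⟩

lemma Admissible.flip {q : Space d} {b : ℝ} {x y : Space d} (h : Admissible H q b x y) :
    Admissible (flipHam H) (-q) b y x := by
  intro z hz p
  rw [segment_symm] at hz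
  simpa [flipHam] using h z hz (-p)

/-- Running a chain backwards reverses its velocities, which amounts to changing the sign of `p`.
Through this symmetry facts about `sm` and supersolutions follow from those about `sp` and
subsolutions. -/
lemma Reach.flip {t κ : ℝ} {x y : Space d} (h : Reach H t x y κ) :
    Reach (flipHam H) t y x κ := by
  induction h with
  | refl x => exact .refl x
  | @step t x y κ h s q b hs ha ih =>
    have e : y + s • q + s • (-q) = y := by simp
    have a : Admissible (flipHam H) (-q) b (y + s • q) (y + s • q + s • (-q)) := by
      rw [e]; exact ha.flip
    exact (((Reach.single hs a).congr rfl e rfl).trans ih).congr (by ring) rfl (by ring)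

lemma reach_flip_iff {t κ : ℝ} {x y : Space d} :
    Reach (flipHam H) t y x κ ↔ Reach H t x y κ :=
  ⟨fun h => by simpa using h.flip, fun h => h.flip⟩

lemma Reach.eq_of_time_eq_zero {t κ : ℝ} {x y : Space d} (h : Reach H t x y κ) (ht : t = 0) :
    y = x ∧ κ = 0 := by
  induction h with
  | refl x => exact ⟨rfl, rfl⟩
  | @step t x y κ h s q b hs ha ih =>
    have h0 := h.nonneg
    obtain rfl : s = 0 := by linarith
    obtain ⟨rfl, rfl⟩ := ih (by linarith)
    simp

lemma IsConvexCoerciveHamiltonian.neg_negPart_le (hH : IsConvexCoerciveHamiltonian H νl νu)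
    (p x : Space d) : -(νl 0)⁻ ≤ H p x := by
  have h1 : νl 0 ≤ νl ‖p‖ :=
    hH.lower_strictMono.monotoneOn Set.self_mem_Ici (norm_nonneg p) (norm_nonneg p)
  have h2 : -(νl 0)⁻ ≤ νl 0 := by
    have := posPart_sub_negPart (νl 0)
    have := posPart_nonneg (νl 0)
    linarith
  exact h2.trans (h1.trans (hH.lower_le p x))

/-- Waiting is admissible at rate `(νl 0)⁻` since `H ≥ -(νl 0)⁻`. This is the origin of `(νl 0)⁻` in
the estimates, and it makes the set under the supremum in `sp` nonempty. -/
lemma IsConvexCoerciveHamiltonian.reach_self (hH : IsConvexCoerciveHamiltonian H νl νu) {t : ℝ}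
    (ht : 0 ≤ t) (x : Space d) : Reach H t x x ((νl 0)⁻ * t) := by
  have a : Admissible H (0 : Space d) (νl 0)⁻ x (x + t • (0 : Space d)) := fun z _ p => by
    simpa using hH.neg_negPart_le p z
  exact (Reach.single ht a).congr rfl (by simp) (mul_comm _ _)

/-- `u` grows at most by the cost plus `c` times the duration along every chain; equivalently
`H(Du, x) ≤ c` in the viscosity sense. -/
def CostDominated (H : Space d → Space d → ℝ) (c : ℝ) (u : Space d → ℝ) : Prop :=
  ∀ ⦃t x y κ⦄, Reach H t x y κ → u y - u x ≤ κ + c * t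

lemma CostDominated.flip {c : ℝ} {u : Space d → ℝ} (hu : CostDominated H c u) :
    CostDominated (flipHam H) c (-u) := by
  intro t x y κ h
  have := hu (reach_flip_iff.1 h)
  simp only [Pi.neg_apply]; linarith

lemma CostDominated.add_const {c : ℝ} {u : Space d → ℝ} (hu : CostDominated H c u) (D : ℝ) :
    CostDominated H c (fun x => u x + D) := by
  intro t x y κ h
  have := hu h
  simp only; linarith

lemma CostDominated.weaken {c c' : ℝ} {u : Space d → ℝ} (hu : CostDominated H c u) (h : c ≤ c') :
    CostDominated H c' u := by
  intro t x y κ hr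
  have := hu hr
  nlinarith [mul_le_mul_of_nonneg_right h hr.nonneg]

/-- The forward semigroup, which solves `u_t = H(Du, x)`. -/
noncomputable def sp (H : Space d → Space d → ℝ) (t : ℝ) (u : Space d → ℝ) : Space d → ℝ :=
  fun x => sSup {r | ∃ y κ, Reach H t x y κ ∧ r = u y - κ}

/-- The backward semigroup, which solves `u_t = -H(Du, x)`. -/
noncomputable def sm (H : Space d → Space d → ℝ) (t : ℝ) (u : Space d → ℝ) : Space d → ℝ :=
  -sp (flipHam H) t (-u)

/-- Domination bounds the set from above; without such a bound `sSup` would be the default value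
`0`. -/
lemma CostDominated.le_sp {c t κ : ℝ} {u : Space d → ℝ} (hu : CostDominated H c u)
    {x y : Space d} (h : Reach H t x y κ) : u y - κ ≤ sp H t u x := by
  refine le_csSup ⟨u x + c * t, ?_⟩ ⟨y, κ, h, rfl⟩
  rintro _ ⟨y, κ, h, rfl⟩
  linarith [hu h]

lemma IsConvexCoerciveHamiltonian.sp_le (hH : IsConvexCoerciveHamiltonian H νl νu) {t B : ℝ}
    (ht : 0 ≤ t) {u : Space d → ℝ} {x : Space d}
    (h : ∀ y κ, Reach H t x y κ → u y - κ ≤ B) : sp H t u x ≤ B := by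
  refine csSup_le ⟨_, x, _, hH.reach_self ht x, rfl⟩ ?_
  rintro _ ⟨y, κ, hr, rfl⟩
  exact h y κ hr

lemma IsConvexCoerciveHamiltonian.exists_lt_of_lt_sp (hH : IsConvexCoerciveHamiltonian H νl νu)
    {t B : ℝ} (ht : 0 ≤ t) {u : Space d → ℝ} {x : Space d} (h : B < sp H t u x) :
    ∃ y κ, Reach H t x y κ ∧ B < u y - κ := by
  by_contra! hc
  exact absurd (hH.sp_le ht hc) (not_le.2 h)

lemma CostDominated.sm_le {c t κ : ℝ} {u : Space d → ℝ} (hu : CostDominated H c u)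
    {x y : Space d} (h : Reach H t x y κ) : sm H t u y ≤ u x + κ := by
  have := hu.flip.le_sp h.flip
  simp only [sm, Pi.neg_apply] at this ⊢; linarith

lemma IsConvexCoerciveHamiltonian.le_sm (hH : IsConvexCoerciveHamiltonian H νl νu) {t B : ℝ}
    (ht : 0 ≤ t) {u : Space d → ℝ} {y : Space d}
    (h : ∀ x κ, Reach H t x y κ → B ≤ u x + κ) : B ≤ sm H t u y := by
  have := hH.flip.sp_le ht (u := -u) (x := y) (B := -B) fun x κ hr => by
    have := h x κ (reach_flip_iff.1 hr)
    simp only [Pi.neg_apply]; linarith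
  simp only [sm, Pi.neg_apply]; linarith

variable {c : ℝ} {u v : Space d → ℝ}

/-- A chain of duration `s` followed by one of duration `t` is cut anew at time `t`: its first part
competes in the supremum at `x`, and domination of `u` pays for the second. -/
lemma CostDominated.sp (hH : IsConvexCoerciveHamiltonian H νl νu)
    (hu : CostDominated H c u) {t : ℝ} (ht : 0 ≤ t) :
    CostDominated H c (sp H t u) := by
  intro s x y κ h
  rw [sub_le_iff_le_add]
  refine hH.sp_le ht fun z κ' h' => ?_
  obtain ⟨w, κ₁, κ₂, h₁, h₂, e⟩ := (h.trans h').split t ht (by linarith [h.nonneg])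
  have e₂ := hu h₂
  have e₁ := hu.le_sp h₁
  have : c * (s + t - t) = c * s := by ring
  linarith

lemma CostDominated.sm (hH : IsConvexCoerciveHamiltonian H νl νu)
    (hu : CostDominated H c u) {t : ℝ} (ht : 0 ≤ t) :
    CostDominated H c (sm H t u) := by
  simpa [_root_.sm] using (hu.flip.sp hH.flip ht).flip

lemma CostDominated.sp_zero (hH : IsConvexCoerciveHamiltonian H νl νu)
    (hu : CostDominated H c u) : _root_.sp H 0 u = u := by
  funext x
  refine le_antisymm (hH.sp_le le_rfl fun y κ h => ?_) ?_
  · obtain ⟨rfl, rfl⟩ := h.eq_of_time_eq_zero rfl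
    simp
  · simpa using hu.le_sp (Reach.refl x)

lemma CostDominated.sp_add (hH : IsConvexCoerciveHamiltonian H νl νu)
    (hu : CostDominated H c u) {s t : ℝ} (hs : 0 ≤ s) (ht : 0 ≤ t) :
    _root_.sp H (s + t) u = _root_.sp H s (_root_.sp H t u) := by
  funext x
  refine le_antisymm (hH.sp_le (add_nonneg hs ht) fun y κ h => ?_)
    (hH.sp_le hs fun y κ h => ?_)
  · obtain ⟨w, κ₁, κ₂, h₁, h₂, rfl⟩ := h.split s hs (by linarith)
    have e₂ := hu.le_sp (h₂.congr (add_sub_cancel_left s t) rfl rfl)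
    have e₁ := (hu.sp hH ht).le_sp h₁
    linarith
  · rw [sub_le_iff_le_add]
    refine hH.sp_le ht fun z κ' h' => ?_
    linarith [hu.le_sp (h.trans h')]

lemma CostDominated.sm_add (hH : IsConvexCoerciveHamiltonian H νl νu)
    (hu : CostDominated H c u) {s t : ℝ} (hs : 0 ≤ s) (ht : 0 ≤ t) :
    _root_.sm H (s + t) u = _root_.sm H s (_root_.sm H t u) := by
  simp [_root_.sm, hu.flip.sp_add hH.flip hs ht]

lemma CostDominated.sp_le_sp_add (hH : IsConvexCoerciveHamiltonian H νl νu)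
    (hv : CostDominated H c v) {D t : ℝ} (ht : 0 ≤ t)
    (h : ∀ x, u x ≤ v x + D) (x : Space d) :
    _root_.sp H t u x ≤ _root_.sp H t v x + D := by
  refine hH.sp_le ht fun y κ hr => ?_
  linarith [hv.le_sp hr, h y]

lemma CostDominated.sm_le_sm_add (hH : IsConvexCoerciveHamiltonian H νl νu)
    (hu : CostDominated H c u) {D t : ℝ} (ht : 0 ≤ t)
    (h : ∀ x, u x ≤ v x + D) (x : Space d) :
    _root_.sm H t u x ≤ _root_.sm H t v x + D := by
  have := hu.flip.sp_le_sp_add hH.flip (u := -v) (D := D) ht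
    (fun x => by simp only [Pi.neg_apply]; linarith [h x]) x
  simp only [_root_.sm, Pi.neg_apply]; linarith

lemma CostDominated.sp_le_add (hH : IsConvexCoerciveHamiltonian H νl νu)
    (hu : CostDominated H c u) {t : ℝ} (ht : 0 ≤ t) (x : Space d) :
    _root_.sp H t u x ≤ u x + c * t :=
  hH.sp_le ht fun y κ hr => by linarith [hu hr]

lemma CostDominated.le_sp_add (hH : IsConvexCoerciveHamiltonian H νl νu)
    (hu : CostDominated H c u) {t : ℝ} (ht : 0 ≤ t) (x : Space d) :
    u x ≤ _root_.sp H t u x + (νl 0)⁻ * t := by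
  linarith [hu.le_sp (hH.reach_self ht x)]

/-- Going along a chain and back along the same chain cancels its cost. Only an inequality survives;
with `le_sm_sp` it makes paths that move in opposite directions comparable. -/
lemma CostDominated.sp_sm_le (hH : IsConvexCoerciveHamiltonian H νl νu)
    (hu : CostDominated H c u) {t : ℝ} (ht : 0 ≤ t) (x : Space d) :
    _root_.sp H t (_root_.sm H t u) x ≤ u x :=
  hH.sp_le ht fun y κ hr => by linarith [hu.sm_le hr]

lemma CostDominated.le_sm_sp (hH : IsConvexCoerciveHamiltonian H νl νu)
    (hu : CostDominated H c u) {t : ℝ} (ht : 0 ≤ t) (x : Space d) :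
    u x ≤ _root_.sm H t (_root_.sp H t u) x :=
  hH.le_sm ht fun y κ hr => by linarith [hu.le_sp hr]

lemma LipschitzWith.inner_bound {L : ℝ≥0} (hu : LipschitzWith L u) (x y : Space d) :
    u y - u x ≤ L * ‖y - x‖ := by
  have := hu.dist_le_mul y x
  rw [Real.dist_eq, dist_eq_norm] at this
  exact (le_abs_self _).trans this

/-- An admissible pair costs at least `R|q| - νu(R)`. -/
lemma IsConvexCoerciveHamiltonian.mul_norm_le (hH : IsConvexCoerciveHamiltonian H νl νu)
    {q z y : Space d} {b : ℝ} {R : ℝ} (hR : 0 ≤ R)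
    (ha : Admissible H q b z y) : R * ‖q‖ ≤ b + νu R := by
  rcases eq_or_ne q 0 with rfl | hq
  · have h1 := ha z (left_mem_segment _ _ _) 0
    have h2 := hH.le_upper 0 z
    have h3 := hH.upper_mono Set.self_mem_Ici hR hR
    simp at h1 h2 ⊢; linarith
  · have hq' : ‖q‖ ≠ 0 := norm_ne_zero_iff.2 hq
    have h1 := ha z (left_mem_segment _ _ _) ((R / ‖q‖) • q)
    have h2 := hH.le_upper ((R / ‖q‖) • q) z
    have h3 : ‖(R / ‖q‖) • q‖ = R := by
      rw [norm_smul, Real.norm_eq_abs, abs_of_nonneg (by positivity), div_mul_cancel₀ _ hq']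
    rw [inner_smul_right, real_inner_self_eq_norm_sq] at h1
    have h4 : R / ‖q‖ * ‖q‖ ^ 2 = R * ‖q‖ := by field_simp
    rw [h3] at h2; linarith

/-- On a move of duration `s` the function gains at most `L * s * ‖q‖`, which `mul_norm_le` with `R
= L` bounds by `s * (b + νu L)`. -/
lemma IsConvexCoerciveHamiltonian.costDominated_of_lipschitz
    (hH : IsConvexCoerciveHamiltonian H νl νu) {L : ℝ≥0} (hu : LipschitzWith L u) :
    CostDominated H (νu L) u := by
  intro t x y κ h
  induction h with
  | refl x => simp
  | @step t x y κ h s q b hs ha ih =>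
    have h1 := hu.inner_bound y (y + s • q)
    rw [add_sub_cancel_left, norm_smul, Real.norm_eq_abs, abs_of_nonneg hs] at h1
    have h2 := mul_le_mul_of_nonneg_left (hH.mul_norm_le L.2 ha) hs
    simp only [NNReal.val_eq_coe] at h2
    linarith

end Chains

/-! ### Consequences of convexity and coercivity -/

section Coercivity

variable {d : ℕ} {H : Space d → Space d → ℝ} {νl νu : ℝ → ℝ}

/-- The slope is the left derivative at `K`. It is at least the slope of the chord from `0` to `K`,
which is positive by strict monotonicity. Coercivity is used below in this form of linear growth. -/
lemma exists_pos_support_line {ν : ℝ → ℝ} (hc : ConvexOn ℝ (Set.Ici 0) ν)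
    (hm : StrictMonoOn ν (Set.Ici 0)) {K : ℝ} (hK : 0 < K) :
    ∃ σ > 0, ∀ r, 0 ≤ r → ν K + σ * (r - K) ≤ ν r := by
  have hKi : K ∈ interior (Set.Ici (0 : ℝ)) := by simpa using hK
  have hleft : ∀ r, 0 ≤ r → r < K → slope ν r K ≤ derivWithin ν (Set.Iio K) K :=
    fun r hr h => hc.slope_le_leftDeriv_of_mem_interior hr hKi h
  refine ⟨derivWithin ν (Set.Iio K) K, ?_, fun r hr => ?_⟩
  · refine lt_of_lt_of_le ?_ (hleft 0 le_rfl hK)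
    rw [slope_def_field]
    have := hm Set.self_mem_Ici hK.le hK
    exact div_pos (by linarith) (by linarith)
  · rcases lt_trichotomy r K with h | rfl | h
    · have := hleft r hr h
      rw [slope_def_field, div_le_iff₀ (by linarith)] at this
      linarith
    · simp
    · have h1 := (hc.leftDeriv_le_rightDeriv_of_mem_interior hKi).trans
        (hc.rightDeriv_le_slope_of_mem_interior hKi (y := r) hr h)
      rw [slope_def_field, le_div_iff₀ (by linarith)] at h1
      linarith

/-- Convexity alone allows a jump at the end point `0`; monotonicity from below and the chord over
`[0, 1]` from above exclude it. -/
lemma ConvexOn.continuousOn_Ici_of_monotoneOn {ν : ℝ → ℝ} (hc : ConvexOn ℝ (Set.Ici 0) ν)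
    (hm : MonotoneOn ν (Set.Ici 0)) : ContinuousOn ν (Set.Ici 0) := by
  intro r hr
  rcases eq_or_lt_of_le (Set.mem_Ici.1 hr) with rfl | h
  · have h1 : Filter.Tendsto (fun r : ℝ => ν 0 + r * (ν 1 - ν 0)) (nhdsWithin 0 (Set.Ici 0))
        (nhds (ν 0)) := by
      have : Continuous fun r : ℝ => ν 0 + r * (ν 1 - ν 0) := by fun_prop
      simpa using (this.tendsto 0).mono_left nhdsWithin_le_nhds
    refine tendsto_of_tendsto_of_tendsto_of_le_of_le' tendsto_const_nhds h1 ?_ ?_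
    · filter_upwards [self_mem_nhdsWithin] with s hs
      exact hm Set.self_mem_Ici hs hs
    · have h2 : Set.Iic (1 : ℝ) ∈ nhdsWithin (0 : ℝ) (Set.Ici 0) :=
        nhdsWithin_le_nhds (Iic_mem_nhds one_pos)
      filter_upwards [self_mem_nhdsWithin, h2] with s hs hs1
      have := hc.2 (x := 0) (y := 1) Set.self_mem_Ici (by simp) (sub_nonneg.2 hs1) hs
        (sub_add_cancel _ _)
      simp only [smul_eq_mul, mul_zero, mul_one, zero_add] at this
      linarith
  · have := hc.continuousOn_interior
    rw [interior_Ici] at this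
    exact (this.continuousAt (Ioi_mem_nhds h)).continuousWithinAt

lemma IsConvexCoerciveHamiltonian.lower_zero_le (hH : IsConvexCoerciveHamiltonian H νl νu)
    {L : ℝ} (hL : 0 ≤ L) : νl 0 ≤ νu L := by
  have h1 := hH.lower_le 0 0
  have h2 := hH.le_upper 0 0
  rw [norm_zero] at h1 h2
  exact (h1.trans h2).trans (hH.upper_mono Set.self_mem_Ici hL hL)

lemma IsConvexCoerciveHamiltonian.exists_lower_eq (hH : IsConvexCoerciveHamiltonian H νl νu)
    (L : ℝ≥0) : ∃ K : ℝ≥0, νl K = νu L := by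
  obtain ⟨σ, hσ, hs⟩ := exists_pos_support_line hH.lower_convex hH.lower_strictMono one_pos
  -- At this `R` the support line of `νl` at `1` has already reached `νu L`.
  set R : ℝ := 1 + |νu L - νl 1| / σ with hR
  have hR0 : 0 ≤ R := by positivity
  have h1 : νu L ≤ νl R := by
    have h := hs R hR0
    have e : σ * (R - 1) = |νu L - νl 1| := by rw [hR]; field_simp; ring
    linarith [le_abs_self (νu L - νl 1)]
  have hcont := (hH.lower_convex.continuousOn_Ici_of_monotoneOn
    hH.lower_strictMono.monotoneOn).mono (Set.Icc_subset_Ici_self : Set.Icc 0 R ⊆ _)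
  obtain ⟨K, hK, e⟩ := intermediate_value_Icc hR0 hcont ⟨hH.lower_zero_le L.2, h1⟩
  exact ⟨⟨K, hK.1⟩, e⟩

/-- For `R > K`, the support line of `νl` at `R` with slope `σ` makes every velocity of length `σ`
admissible at cost `σ * R - νl R`, everywhere in space. Moving straight from `x` to `y` then gives
the slope `R`, and `R` decreases to `K`. Working with `R > K` also covers `K = 0`, where no support
line is at hand. -/
lemma IsConvexCoerciveHamiltonian.lipschitz_of_costDominated
    (hH : IsConvexCoerciveHamiltonian H νl νu) {u : Space d → ℝ} {K : ℝ≥0}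
    (hu : CostDominated H (νl K) u) : LipschitzWith K u := by
  have key : ∀ R : ℝ, (K : ℝ) < R → ∀ x y, u y - u x ≤ R * ‖y - x‖ := by
    intro R hR x y
    have hR0 : 0 < R := K.2.trans_lt hR
    obtain ⟨σ, hσ, hs⟩ := exists_pos_support_line hH.lower_convex hH.lower_strictMono hR0
    rcases eq_or_ne (y - x) 0 with h0 | h0
    · rw [sub_eq_zero] at h0; subst h0; simp
    set n := ‖y - x‖ with hn
    have hnpos : 0 < n := norm_pos_iff.2 h0
    set q : Space d := (σ / n) • (y - x) with hq
    have hqn : ‖q‖ = σ := by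
      rw [hq, norm_smul, Real.norm_eq_abs, abs_of_pos (by positivity), ← hn]; field_simp
    have ha : Admissible H q (σ * R - νl R) x (x + (n / σ) • q) := by
      intro z _ p
      have h1 := hs ‖p‖ (norm_nonneg p)
      have h2 := real_inner_le_norm q p
      rw [hqn] at h2
      have h3 := hH.lower_le p z
      linarith
    have e : x + (n / σ) • q = y := by
      rw [hq, smul_smul]
      have : n / σ * (σ / n) = 1 := by field_simp
      rw [this]; simp
    have h := hu ((Reach.single (by positivity) ha).congr rfl e rfl)
    have hle : νl K ≤ νl R := hH.lower_strictMono.monotoneOn K.2 hR0.le hR.le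
    have h4 : νl K * (n / σ) ≤ νl R * (n / σ) := mul_le_mul_of_nonneg_right hle (by positivity)
    have h5 : n / σ * (σ * R - νl R) + νl R * (n / σ) = R * n := by field_simp; ring
    linarith
  have key' : ∀ x y, u y - u x ≤ K * ‖y - x‖ := by
    intro x y
    have ht : Filter.Tendsto (fun R : ℝ => R * ‖y - x‖) (nhdsWithin (K : ℝ) (Set.Ioi K))
        (nhds (K * ‖y - x‖)) :=
      ((continuous_mul_const _).tendsto _).mono_left nhdsWithin_le_nhds
    refine ge_of_tendsto ht ?_
    filter_upwards [self_mem_nhdsWithin] with R hR using key R hR x y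
  refine LipschitzWith.of_dist_le_mul fun x y => ?_
  rw [Real.dist_eq, dist_eq_norm, abs_sub_le_iff]
  exact ⟨key' y x, by rw [norm_sub_rev]; exact key' x y⟩

/-- `H(p₀, x₀)` is nearly attained by affine functions of `p` that lie below `H(·, z)` for all
`z` near `x₀`. -/
lemma IsConvexCoerciveHamiltonian.exists_locally_admissible
    (hH : IsConvexCoerciveHamiltonian H νl νu) (p₀ x₀ : Space d) {ε : ℝ}
    (hε : 0 < ε) :
    ∃ (q : Space d) (b : ℝ), H p₀ x₀ - ε ≤ inner ℝ q p₀ - b ∧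
      ∀ᶠ z in nhds x₀, ∀ p, inner ℝ q p - b ≤ H p z := by
  have hcx : Continuous fun p => H p x₀ := hH.continuous_uncurry.comp (Continuous.prodMk_left x₀)
  obtain ⟨l, c₀, hl, hle⟩ := ConvexOn.exists_affine_le_of_lt (𝕜 := ℝ) (s := Set.univ)
    (φ := fun p => H p x₀) (x := p₀) (a := H p₀ x₀ - ε / 4) (Set.mem_univ _) (by simp; linarith)
    isClosed_univ (hcx.lowerSemicontinuous.lowerSemicontinuousOn _) (hH.convex x₀)
  obtain ⟨q₀, rfl⟩ := (InnerProductSpace.toDual ℝ (Space d)).surjective l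
  have hl' : ∀ p, inner ℝ q₀ p + c₀ ≤ H p x₀ := fun p => by
    simpa using hl ⟨p, Set.mem_univ p⟩
  have hle' : inner ℝ q₀ p₀ + c₀ = H p₀ x₀ - ε / 4 := by simpa using hle
  obtain ⟨σ, hσ, hs⟩ := exists_pos_support_line hH.lower_convex hH.lower_strictMono one_pos
  -- A small weight `θ` of the coercive minorant `σ * ‖p‖ - C` is mixed into the affine minorant of
  -- `H(·, x₀)`. The gap below `H(·, x₀)` then grows like `θ * σ * ‖p‖`, and `θ` is so small that
  -- the mixing loses at most `ε / 4` at `p₀`.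
  set C : ℝ := σ - νl 1 with hC
  set B : ℝ := |H p₀ x₀ - ε / 4| + |C| + 1 with hB
  have hBpos : 0 < B := by positivity
  set θ : ℝ := min (1 / 2) (ε / 4 / B) with hθ
  have hθ0 : 0 < θ := lt_min (by norm_num) (by positivity)
  have hθ1 : θ ≤ 1 / 2 := min_le_left _ _
  have hθB : θ * B ≤ ε / 4 := by
    have := mul_le_mul_of_nonneg_right (min_le_right (1 / 2) (ε / 4 / B)) hBpos.le
    rwa [div_mul_cancel₀ _ hBpos.ne'] at this
  set b : ℝ := -((1 - θ) * c₀) + θ * C + ε / 2 with hb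
  have hgap : ∀ p, θ * σ * ‖p‖ + (inner ℝ ((1 - θ) • q₀) p - b) + ε / 2 ≤ H p x₀ := by
    intro p
    have h1 := mul_le_mul_of_nonneg_left (hl' p) (by linarith : 0 ≤ 1 - θ)
    have h2 := mul_le_mul_of_nonneg_left ((hs ‖p‖ (norm_nonneg p)).trans (hH.lower_le p x₀)) hθ0.le
    rw [real_inner_smul_left, hb, hC]
    nlinarith
  set C₀ : ℝ := max (νu 0 + b) 0 with hC₀
  have hC₀0 : 0 ≤ C₀ := le_max_right _ _
  set R : ℝ := (C₀ + 1) / (θ * σ) with hR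
  have hRpos : 0 < R := by positivity
  have hRe : θ * σ * R = C₀ + 1 := by rw [hR]; field_simp
  refine ⟨(1 - θ) • q₀, b, ?_, ?_⟩
  · have h1 : θ * |H p₀ x₀ - ε / 4| + θ * |C| ≤ ε / 4 := by nlinarith
    have h2 := mul_le_mul_of_nonneg_left (le_abs_self (H p₀ x₀ - ε / 4)) hθ0.le
    have h3 := mul_le_mul_of_nonneg_left (le_abs_self C) hθ0.le
    have h4 : (1 - θ) * inner ℝ q₀ p₀ + (1 - θ) * c₀ = (1 - θ) * (H p₀ x₀ - ε / 4) := by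
      rw [← mul_add, hle']
    rw [real_inner_smul_left, hb]
    nlinarith
  · have hev : ∀ᶠ z in nhds x₀, ∀ p ∈ Metric.closedBall (0 : Space d) R,
        H p x₀ - ε / 2 < H p z := by
      refine (isCompact_closedBall _ _).eventually_forall_of_forall_eventually fun p _ => ?_
      have c1 : Continuous fun w : Space d × Space d => H w.2 x₀ - ε / 2 :=
        (hcx.comp continuous_snd).sub continuous_const
      have c2 : Continuous fun w : Space d × Space d => H w.2 w.1 :=
        hH.continuous_uncurry.comp continuous_swap
      exact (c1.tendsto (x₀, p)).eventually_lt (c2.tendsto (x₀, p)) (by simp; linarith)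
    filter_upwards [hev] with z hz p
    rcases le_or_gt ‖p‖ R with hp | hp
    · have h1 := hz p (by simpa using hp)
      have h2 := hgap p
      have : 0 ≤ θ * σ * ‖p‖ := by positivity
      linarith
    -- Outside the ball, convexity along the ray from `0` carries a violation at `p` to the point `μ
    -- • p` of norm `R`. There the gap `C₀ + 1` exceeds the contribution of `H(0, z) ≤ νu 0`.
    · by_contra! hlt
      have hpp : 0 < ‖p‖ := hRpos.trans hp
      set μ := R / ‖p‖ with hμ
      have hμ0 : 0 < μ := by positivity
      have hμ1 : μ ≤ 1 := (div_le_one hpp).2 hp.le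
      have hn : ‖μ • p‖ = R := by
        rw [norm_smul, Real.norm_eq_abs, abs_of_pos hμ0, hμ, div_mul_cancel₀ _ hpp.ne']
      have h1 := hz (μ • p) (by simp [hn])
      have h2 := hgap (μ • p)
      rw [hn, hRe, inner_smul_right] at h2
      have h3 := (hH.convex z).2 (Set.mem_univ 0) (Set.mem_univ p) (sub_nonneg.2 hμ1) hμ0.le
        (sub_add_cancel _ _)
      simp only [smul_zero, zero_add, smul_eq_mul] at h3
      have h4 := hH.le_upper 0 z
      rw [norm_zero] at h4
      have h5 := mul_lt_mul_of_pos_left hlt hμ0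
      have h6 := mul_le_mul_of_nonneg_left
        ((add_le_add_left h4 b).trans (le_max_left (νu 0 + b) 0)) (sub_nonneg.2 hμ1)
      have h7 := mul_nonneg hμ0.le hC₀0
      nlinarith

lemma exists_gradient_eq_sub {f : Space d → ℝ} (hf : Differentiable ℝ f) (y q : Space d) {s : ℝ}
    (hs : 0 < s) :
    ∃ z ∈ segment ℝ y (y + s • q), f (y + s • q) - f y = s * inner ℝ q (gradient f z) := by
  have hd : ∀ τ : ℝ, HasDerivAt (fun τ : ℝ => f (y + τ • q))
      (inner ℝ q (gradient f (y + τ • q))) τ := by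
    intro τ
    have h1 := (hf (y + τ • q)).hasGradientAt.hasFDerivAt
    have h2 : HasDerivAt (fun τ : ℝ => y + τ • q) q τ := by
      simpa using ((hasDerivAt_id τ).smul_const q).const_add y
    have h3 := h1.comp_hasDerivAt τ h2
    rw [InnerProductSpace.toDual_apply_apply, real_inner_comm] at h3
    exact h3
  obtain ⟨τ, hτ, e⟩ := exists_hasDerivAt_eq_slope (fun τ : ℝ => f (y + τ • q)) _ hs
    (fun τ _ => (hd τ).continuousAt.continuousWithinAt) (fun τ _ => hd τ)
  refine ⟨y + τ • q, add_smul_mem_segment hτ.1.le hτ.2.le, ?_⟩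
  rw [e]; simp; field_simp

/-- A chain either stays in a given ball, where a smooth function grows at most by the cost plus the
supremum of the Hamiltonian times the duration, or it is expensive. -/
lemma Reach.stays_or_expensive (hH : IsConvexCoerciveHamiltonian H νl νu)
    {f : Space d → ℝ} (hf : Differentiable ℝ f) {r h K t κ : ℝ}
    (hr : 0 < r) (hK : 0 ≤ K) {x y : Space d}
    (hh : ∀ z, ‖z - x‖ < r → H (gradient f z) z ≤ h) (hxy : Reach H t x y κ) :
    (K + 1) * ‖y - x‖ ≤ κ + νu (K + 1) * t ∧
      ((f y - f x ≤ κ + h * t ∧ ‖y - x‖ < r) ∨ r + K * ‖y - x‖ ≤ κ + νu (K + 1) * t) := by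
  induction hxy with
  | refl x => simp [hr]
  | @step t x y κ _ s q b hs ha ih =>
    obtain ⟨h0, hor⟩ := ih hh
    -- The slope `K + 1` leaves a spare unit: a chain that has travelled the distance `r` pays `r`
    -- beyond `K` times its displacement, up to the term proportional to time.
    have h1 := mul_le_mul_of_nonneg_left
      (hH.mul_norm_le (by linarith : 0 ≤ K + 1) ha) hs
    have hsn : ‖s • q‖ = s * ‖q‖ := by rw [norm_smul, Real.norm_eq_abs, abs_of_nonneg hs]
    have hsq : 0 ≤ s * ‖q‖ := by positivity
    have hn : ‖y + s • q - x‖ ≤ ‖y - x‖ + s * ‖q‖ := by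
      rw [← hsn, add_sub_right_comm]; exact norm_add_le _ _
    have hn' := mul_le_mul_of_nonneg_left hn hK
    refine ⟨by nlinarith, ?_⟩
    rcases hor with ⟨hfy, hyr⟩ | hexp
    · rcases lt_or_ge (‖y - x‖ + s * ‖q‖) r with hlt | hge
      · refine Or.inl ⟨?_, hn.trans_lt hlt⟩
        rcases eq_or_lt_of_le hs with rfl | hspos
        · simpa using hfy
        obtain ⟨z, hz, e⟩ := exists_gradient_eq_sub hf y q hspos
        have hzx : ‖z - x‖ < r := by
          have : ‖z - y‖ ≤ ‖s • q‖ := by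
            simpa using norm_sub_le_of_mem_segment hz
          calc ‖z - x‖ = ‖(y - x) + (z - y)‖ := by congr 1; abel
            _ ≤ ‖y - x‖ + ‖z - y‖ := norm_add_le _ _
            _ < r := by linarith
        have h3 := mul_le_mul_of_nonneg_left ((ha z hz (gradient f z)).trans (hh z hzx)) hs
        nlinarith
      · right; nlinarith
    · right; nlinarith

end Coercivity

/-! ### The flow along discrete paths -/

section DiscreteFlow

variable {d : ℕ} {H : Space d → Space d → ℝ} {νl νu : ℝ → ℝ}

/-- The effect of an increment `a` of the driving path. -/
noncomputable def flowStep (H : Space d → Space d → ℝ) (a : ℝ) (u : Space d → ℝ) : Space d → ℝ :=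
  if 0 ≤ a then sp H a u else sm H (-a) u

/-- The flow along the path with successive values `a 0, a 1, …`. -/
noncomputable def discreteFlow (H : Space d → Space d → ℝ) (a : ℕ → ℝ) :
    ℕ → (Space d → ℝ) → Space d → ℝ
  | 0, u => u
  | n + 1, u => flowStep H (a (n + 1) - a n) (discreteFlow H a n u)

lemma flowStep_of_nonneg {a : ℝ} (ha : 0 ≤ a) (u : Space d → ℝ) : flowStep H a u = sp H a u :=
  if_pos ha

variable {c : ℝ} {u v : Space d → ℝ}

lemma CostDominated.flowStep_zero (hH : IsConvexCoerciveHamiltonian H νl νu)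
    (hu : CostDominated H c u) : flowStep H 0 u = u := by
  rw [flowStep_of_nonneg le_rfl, hu.sp_zero hH]

lemma CostDominated.flowStep_of_nonpos (hH : IsConvexCoerciveHamiltonian H νl νu)
    (hu : CostDominated H c u) {a : ℝ} (ha : a ≤ 0) :
    flowStep H a u = _root_.sm H (-a) u := by
  rcases eq_or_lt_of_le ha with rfl | h
  · rw [hu.flowStep_zero hH]
    simp [_root_.sm, hu.flip.sp_zero hH.flip]
  · exact if_neg (not_le.2 h)

lemma CostDominated.flowStep_flip (hH : IsConvexCoerciveHamiltonian H νl νu)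
    (hu : CostDominated H c u) (a : ℝ) :
    flowStep (flipHam H) (-a) (-u) = -flowStep H a u := by
  rcases le_total 0 a with h | h
  · rw [hu.flip.flowStep_of_nonpos hH.flip (by linarith), flowStep_of_nonneg h]
    simp [_root_.sm]
  · rw [hu.flowStep_of_nonpos hH h, flowStep_of_nonneg (by linarith)]
    simp [_root_.sm]

lemma CostDominated.flowStep (hH : IsConvexCoerciveHamiltonian H νl νu)
    (hu : CostDominated H c u) (a : ℝ) :
    CostDominated H c (flowStep H a u) := by
  rcases le_total 0 a with h | h
  · rw [flowStep_of_nonneg h]; exact hu.sp hH h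
  · rw [hu.flowStep_of_nonpos hH h]; exact hu.sm hH (by linarith)

lemma CostDominated.flowStep_le_add (hH : IsConvexCoerciveHamiltonian H νl νu)
    (hu : CostDominated H c u) (hv : CostDominated H c v) {D : ℝ}
    (h : ∀ x, u x ≤ v x + D) (a : ℝ) (x : Space d) :
    _root_.flowStep H a u x ≤ _root_.flowStep H a v x + D := by
  rcases le_total 0 a with ha | ha
  · rw [flowStep_of_nonneg ha, flowStep_of_nonneg ha]
    exact hv.sp_le_sp_add hH ha h x
  · rw [hu.flowStep_of_nonpos hH ha, hv.flowStep_of_nonpos hH ha]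
    exact hu.sm_le_sm_add hH (by linarith) h x

lemma CostDominated.flowStep_mono (hH : IsConvexCoerciveHamiltonian H νl νu)
    (hu : CostDominated H c u) (hv : CostDominated H c v)
    (h : ∀ x, u x ≤ v x) (a : ℝ) (x : Space d) :
    _root_.flowStep H a u x ≤ _root_.flowStep H a v x := by
  simpa using hu.flowStep_le_add hH hv (D := 0) (by simpa using h) a x

lemma CostDominated.abs_flowStep_sub_le (hH : IsConvexCoerciveHamiltonian H νl νu)
    (hu : CostDominated H c u) (hv : CostDominated H c v)
    {D : ℝ} (h : ∀ x, |u x - v x| ≤ D) (a : ℝ) (x : Space d) :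
    |_root_.flowStep H a u x - _root_.flowStep H a v x| ≤ D := by
  rw [abs_sub_le_iff, sub_le_iff_le_add', sub_le_iff_le_add']
  exact ⟨hu.flowStep_le_add hH hv (fun x => by linarith [(abs_sub_le_iff.1 (h x)).1]) a x,
    hv.flowStep_le_add hH hu (fun x => by linarith [(abs_sub_le_iff.1 (h x)).2]) a x⟩

lemma CostDominated.flowStep_add (hH : IsConvexCoerciveHamiltonian H νl νu)
    (hu : CostDominated H c u) {a b : ℝ}
    (hab : 0 ≤ a ∧ 0 ≤ b ∨ a ≤ 0 ∧ b ≤ 0) :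
    _root_.flowStep H (a + b) u = _root_.flowStep H a (_root_.flowStep H b u) := by
  rcases hab with ⟨ha, hb⟩ | ⟨ha, hb⟩
  · rw [flowStep_of_nonneg ha, flowStep_of_nonneg hb, flowStep_of_nonneg (add_nonneg ha hb),
      hu.sp_add hH ha hb]
  · rw [(hu.flowStep hH b).flowStep_of_nonpos hH ha, hu.flowStep_of_nonpos hH hb,
      hu.flowStep_of_nonpos hH (add_nonpos ha hb), neg_add,
      hu.sm_add hH (by linarith) (by linarith)]

lemma CostDominated.neg_negPart_le (hH : IsConvexCoerciveHamiltonian H νl νu)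
    (hu : CostDominated H c u) : -(νl 0)⁻ ≤ c := by
  have := hu (hH.reach_self zero_le_one (0 : Space d))
  linarith

/-- One direction changes by at most `c * |a|`, the other by at most `(νl 0)⁻ * |a|`. The constant
dominates both because `c`, though possibly negative, is at least `-(νl 0)⁻`. -/
lemma CostDominated.abs_flowStep_sub_self_le (hH : IsConvexCoerciveHamiltonian H νl νu)
    (hu : CostDominated H c u) (a : ℝ) (x : Space d) :
    |_root_.flowStep H a u x - u x| ≤ (c + 2 * (νl 0)⁻) * |a| := by
  have hm : 0 ≤ (νl 0)⁻ := negPart_nonneg _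
  have aux : ∀ (H : Space d → Space d → ℝ) (_ : IsConvexCoerciveHamiltonian H νl νu)
      (u : Space d → ℝ) (_ : CostDominated H c u) (a : ℝ), 0 ≤ a →
      |_root_.flowStep H a u x - u x| ≤ (c + 2 * (νl 0)⁻) * |a| := by
    intro H hH u hu a ha
    rw [flowStep_of_nonneg ha, abs_of_nonneg ha, abs_sub_le_iff]
    have h1 := hu.sp_le_add hH ha x
    have h2 := hu.le_sp_add hH ha x
    have h3 := mul_nonneg hm ha
    have h4 := mul_le_mul_of_nonneg_right (hu.neg_negPart_le hH) ha
    constructor <;> nlinarith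
  rcases le_total 0 a with ha | ha
  · exact aux H hH u hu a ha
  · have := aux _ hH.flip _ hu.flip (-a) (by linarith)
    rw [hu.flowStep_flip hH, abs_neg, Pi.neg_apply, Pi.neg_apply, ← abs_neg] at this
    convert this using 2; ring

/-- Moving two paths one after the other. -/
lemma CostDominated.sp_flowStep_le (hH : IsConvexCoerciveHamiltonian H νl νu)
    (hu : CostDominated H c u) {g δ η : ℝ} (hg : 0 ≤ g)
    (hg' : 0 ≤ g + η - δ) (x : Space d) :
    _root_.sp H (g + η - δ) (_root_.flowStep H δ u) x
      ≤ _root_.flowStep H η (_root_.sp H g u) x := by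
  -- Here `g` is the gap between two paths, `δ` the increment of the lower one and `η` that of the
  -- upper one. This is the case `δ = 0`.
  have up : 0 ≤ g + η → ∀ x, _root_.sp H (g + η) u x
      ≤ _root_.flowStep H η (_root_.sp H g u) x := by
    intro h x
    rcases le_total 0 η with hη | hη
    · rw [flowStep_of_nonneg hη, add_comm, hu.sp_add hH hη hg]
    · rw [(hu.sp hH hg).flowStep_of_nonpos hH hη]
      have e : _root_.sp H g u = _root_.sp H (-η) (_root_.sp H (g + η) u) := by
        rw [← hu.sp_add hH (by linarith) h]; congr 1; ring
      rw [e]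
      exact (hu.sp hH h).le_sm_sp hH (by linarith) x
  rcases le_total 0 δ with hδ | hδ
  · rw [flowStep_of_nonneg hδ, ← hu.sp_add hH hg' hδ, sub_add_cancel]
    exact up (by linarith) x
  · rw [hu.flowStep_of_nonpos hH hδ]
    rcases le_total 0 (g + η) with h | h
    · refine le_trans ?_ (up h x)
      rw [sub_eq_add_neg, (hu.sm hH (by linarith)).sp_add hH h (by linarith)]
      have := hu.sp_le_sp_add hH (D := 0) h (u := _root_.sp H (-δ) (_root_.sm H (-δ) u))
        (fun y => by simpa using hu.sp_sm_le hH (by linarith) y) x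
      simpa using this
    · have hη : η ≤ 0 := by linarith
      -- The outer factor of this splitting is undone by `sp H (g + η - δ)`. On the other side, the
      -- factor `sm H g` split off in `e2` undoes `sp H g`.
      have e1 : _root_.sm H (-δ) u
          = _root_.sm H (g + η - δ) (_root_.sm H (-(g + η)) u) := by
        rw [← hu.sm_add hH hg' (by linarith)]; congr 1; ring
      have e2 : _root_.flowStep H η (_root_.sp H g u)
          = _root_.sm H (-(g + η)) (_root_.sm H g (_root_.sp H g u)) := by
        rw [(hu.sp hH hg).flowStep_of_nonpos hH hη,
          ← (hu.sp hH hg).sm_add hH (by linarith) hg]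
        congr 1; ring
      rw [e1, e2]
      refine ((hu.sm hH (by linarith)).sp_sm_le hH hg' x).trans ?_
      have := hu.sm_le_sm_add hH (D := 0) (by linarith : 0 ≤ -(g + η))
        (v := _root_.sm H g (_root_.sp H g u))
        (fun y => by simpa using hu.le_sm_sp hH hg y) x
      simpa using this

lemma CostDominated.discreteFlow (hH : IsConvexCoerciveHamiltonian H νl νu)
    (hu : CostDominated H c u) (a : ℕ → ℝ) (n : ℕ) :
    CostDominated H c (discreteFlow H a n u) := by
  induction n with
  | zero => exact hu
  | succ n ih => exact ih.flowStep hH _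

lemma CostDominated.discreteFlow_le_add (hH : IsConvexCoerciveHamiltonian H νl νu)
    (hu : CostDominated H c u) (hv : CostDominated H c v)
    {D : ℝ} (h : ∀ x, u x ≤ v x + D) (a : ℕ → ℝ) (n : ℕ) (x : Space d) :
    _root_.discreteFlow H a n u x ≤ _root_.discreteFlow H a n v x + D := by
  induction n generalizing x with
  | zero => exact h x
  | succ n ih => exact (hu.discreteFlow hH a n).flowStep_le_add hH (hv.discreteFlow hH a n) ih _ x

lemma CostDominated.discreteFlow_flip (hH : IsConvexCoerciveHamiltonian H νl νu)
    (hu : CostDominated H c u) (a : ℕ → ℝ) (n : ℕ) :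
    _root_.discreteFlow (flipHam H) (-a) n (-u) = -_root_.discreteFlow H a n u := by
  induction n with
  | zero => rfl
  | succ n ih =>
    simp only [_root_.discreteFlow]
    rw [ih, ← (hu.discreteFlow hH a n).flowStep_flip hH]
    congr 1; simp only [Pi.neg_apply]; ring

lemma CostDominated.discreteFlow_of_monotone_tail (hH : IsConvexCoerciveHamiltonian H νl νu)
    (hu : CostDominated H c u) {a : ℕ → ℝ} {m n : ℕ}
    (hmn : m ≤ n) (ha : MonotoneOn a (Set.Ici m) ∨ AntitoneOn a (Set.Ici m)) :
    _root_.discreteFlow H a n u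
      = _root_.flowStep H (a n - a m) (_root_.discreteFlow H a m u) := by
  induction n, hmn using Nat.le_induction with
  | base => rw [sub_self, (hu.discreteFlow hH a m).flowStep_zero hH]
  | succ n hmn ih =>
    simp only [_root_.discreteFlow]
    have hm1 : m ∈ Set.Ici m := Set.self_mem_Ici
    have hn1 : n + 1 ∈ Set.Ici m := Set.mem_Ici.2 (hmn.trans n.le_succ)
    rw [ih, ← (hu.discreteFlow hH a m).flowStep_add hH]
    · congr 1; ring
    · rcases ha with ha | ha
      · exact Or.inl ⟨sub_nonneg.2 (ha (Set.mem_Ici.2 hmn) hn1 n.le_succ),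
          sub_nonneg.2 (ha hm1 (Set.mem_Ici.2 hmn) hmn)⟩
      · exact Or.inr ⟨sub_nonpos.2 (ha (Set.mem_Ici.2 hmn) hn1 n.le_succ),
          sub_nonpos.2 (ha hm1 (Set.mem_Ici.2 hmn) hmn)⟩

lemma CostDominated.discreteFlow_of_const_tail (hH : IsConvexCoerciveHamiltonian H νl νu)
    (hu : CostDominated H c u) {a : ℕ → ℝ} {m n : ℕ}
    (hmn : m ≤ n) (ha : ∀ k, m ≤ k → a k = a m) :
    _root_.discreteFlow H a n u = _root_.discreteFlow H a m u := by
  rw [hu.discreteFlow_of_monotone_tail hH hmn, ha n hmn, sub_self,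
    (hu.discreteFlow hH a m).flowStep_zero hH]
  exact Or.inl fun i hi j hj _ => by rw [ha i hi, ha j hj]

/-- Repeated values are zero increments, which act trivially. This puts samples on a grid and on a
refinement of it over one index set. -/
lemma CostDominated.discreteFlow_repeat (hH : IsConvexCoerciveHamiltonian H νl νu)
    (hu : CostDominated H c u) (a : ℕ → ℝ) {j : ℕ}
    (hj : 0 < j) (n : ℕ) :
    _root_.discreteFlow H (fun k => a (k / j)) (n * j) u = _root_.discreteFlow H a n u := by
  have aux : ∀ n i, i < j → _root_.discreteFlow H (fun k => a (k / j)) (n * j + i) u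
      = _root_.discreteFlow H (fun k => a (k / j)) (n * j) u := by
    intro n i
    induction i with
    | zero => intro _; rfl
    | succ i ih =>
      intro hi
      have e : ∀ i < j, (n * j + i) / j = n := fun i hi => by
        rw [mul_comm, Nat.mul_add_div hj, Nat.div_eq_of_lt hi, add_zero]
      rw [← add_assoc]
      simp only [_root_.discreteFlow]
      rw [add_assoc, e _ hi, e i (by lia), sub_self,
        (hu.discreteFlow hH _ _).flowStep_zero hH, ih (by lia)]
  induction n with
  | zero => simp [_root_.discreteFlow]
  | succ n ih =>
    have e : (n + 1) * j = n * j + (j - 1) + 1 := by rw [add_mul]; lia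
    rw [e]
    simp only [_root_.discreteFlow]
    rw [aux n (j - 1) (by lia), ih, ← e, Nat.mul_div_cancel _ hj]
    have e2 : (n * j + (j - 1)) / j = n := by
      rw [mul_comm, Nat.mul_add_div hj, Nat.div_eq_of_lt (by lia), add_zero]
    rw [e2]

/-- The flow is monotone in the path up to the cost of lifting one path above the other. -/
lemma CostDominated.discreteFlow_le (hH : IsConvexCoerciveHamiltonian H νl νu)
    (hu : CostDominated H c u) {a b : ℕ → ℝ} {n : ℕ} {M : ℝ}
    (h0 : a 0 = b 0) (hM : ∀ i ≤ n, a i - b i ≤ M) (x : Space d) :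
    _root_.discreteFlow H a n u x ≤ _root_.discreteFlow H b n u x + c * M
      + (νl 0)⁻ * (M - (a n - b n)) := by
  have hM0 : 0 ≤ M := by have := hM 0 n.zero_le; linarith
  -- Invariant: the flow along `a`, lifted by the current gap, stays below the flow along `b` of the
  -- data lifted by `M`. The lifts are removed only after the last step, so errors do not
  -- accumulate.
  have key : ∀ i ≤ n, ∀ x, _root_.sp H (M - (a i - b i)) (_root_.discreteFlow H a i u) x
      ≤ _root_.discreteFlow H b i (_root_.sp H M u) x := by
    intro i
    induction i with
    | zero => intro _ x; simp [_root_.discreteFlow, h0]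
    | succ i ih =>
      intro hi x
      have h1 : 0 ≤ M - (a i - b i) := by linarith [hM i (by lia)]
      have h2 : 0 ≤ M - (a (i + 1) - b (i + 1)) := by linarith [hM (i + 1) hi]
      have h3 := (hu.discreteFlow hH a i).sp_flowStep_le hH (δ := a (i + 1) - a i)
        (η := b (i + 1) - b i) h1 (by linarith) x
      have e : M - (a i - b i) + (b (i + 1) - b i) - (a (i + 1) - a i)
          = M - (a (i + 1) - b (i + 1)) := by ring
      rw [e] at h3
      exact h3.trans (((hu.discreteFlow hH a i).sp hH h1).flowStep_mono hH
        ((hu.sp hH hM0).discreteFlow hH b i) (ih (by lia)) _ x)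
  have h1 := key n le_rfl x
  have h2 := (hu.discreteFlow hH a n).le_sp_add hH (by linarith [hM n le_rfl] :
    0 ≤ M - (a n - b n)) x
  have h3 := (hu.sp hH hM0).discreteFlow_le_add hH hu (hu.sp_le_add hH hM0) b n x
  linarith

lemma CostDominated.abs_discreteFlow_sub_le (hH : IsConvexCoerciveHamiltonian H νl νu)
    (hu : CostDominated H c u) {a b : ℕ → ℝ} {n : ℕ}
    {M : ℝ} (h0 : a 0 = b 0) (hM : ∀ i ≤ n, |a i - b i| ≤ M) (x : Space d) :
    |_root_.discreteFlow H a n u x - _root_.discreteFlow H b n u x|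
      ≤ (c + 2 * (νl 0)⁻) * M := by
  have hm : 0 ≤ (νl 0)⁻ := negPart_nonneg _
  have h1 := hu.discreteFlow_le hH h0 (fun i hi => (abs_sub_le_iff.1 (hM i hi)).1) x
  have h2 := hu.discreteFlow_le hH h0.symm (fun i hi => (abs_sub_le_iff.1 (hM i hi)).2) x
  obtain ⟨h3, h4⟩ := abs_sub_le_iff.1 (hM n le_rfl)
  have h5 := mul_le_mul_of_nonneg_left h3 hm
  have h6 := mul_le_mul_of_nonneg_left h4 hm
  rw [abs_sub_le_iff]
  constructor <;> nlinarith

end DiscreteFlow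

/-! ### The flow along continuous paths -/

section PathFlow

open Filter Topology

variable {d : ℕ} {H : Space d → Space d → ℝ} {νl νu : ℝ → ℝ}

/-- The values of `ζ`, stopped at time `t`, on the grid of mesh `2⁻ⁿ`. -/
noncomputable def sample (ζ : C(ℝ≥0, ℝ)) (n : ℕ) (t : ℝ≥0) (k : ℕ) : ℝ :=
  ζ (min ((k : ℝ≥0) / 2 ^ n) t)

/-- The flow along the samples of `ζ` up to time `t`. -/
noncomputable def gridFlow (H : Space d → Space d → ℝ) (ζ : C(ℝ≥0, ℝ)) (u : Space d → ℝ) (n : ℕ)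
    (t : ℝ≥0) : Space d → ℝ :=
  discreteFlow H (sample ζ n t) (⌈t⌉₊ * 2 ^ n) u

/-- The flow along a continuous path. -/
noncomputable def pathFlow (H : Space d → Space d → ℝ) (ζ : C(ℝ≥0, ℝ)) (u : Space d → ℝ)
    (t : ℝ≥0) (x : Space d) : ℝ :=
  limUnder atTop fun n => gridFlow H ζ u n t x

lemma sample_zero (ζ : C(ℝ≥0, ℝ)) (n : ℕ) (t : ℝ≥0) : sample ζ n t 0 = ζ 0 := by
  simp [sample]

lemma sample_of_le (ζ : C(ℝ≥0, ℝ)) {n : ℕ} {t : ℝ≥0} {k : ℕ} (h : t * 2 ^ n ≤ k) :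
    sample ζ n t k = ζ t := by
  rw [sample, min_eq_right]
  rwa [le_div_iff₀ (by positivity)]

lemma mul_le_ceil_mul (t : ℝ≥0) (n : ℕ) : t * 2 ^ n ≤ ((⌈t⌉₊ * 2 ^ n : ℕ) : ℝ≥0) := by
  push_cast
  gcongr
  exact Nat.le_ceil t

lemma exists_mesh (ζ : C(ℝ≥0, ℝ)) (T : ℝ≥0) {ω : ℝ} (hω : 0 < ω) :
    ∀ᶠ n : ℕ in atTop, ∀ r ≤ T, ∀ s ≤ T, dist r s ≤ (1 / 2) ^ n → |ζ r - ζ s| ≤ ω := by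
  have huc := (isCompact_Icc (a := (0 : ℝ≥0)) (b := T)).uniformContinuousOn_of_continuous
    ζ.continuous.continuousOn
  obtain ⟨δ, hδ, h⟩ := Metric.uniformContinuousOn_iff.1 huc ω hω
  have ht : Tendsto (fun n : ℕ => (1 / 2 : ℝ) ^ n) atTop (𝓝 0) :=
    tendsto_pow_atTop_nhds_zero_of_lt_one (by norm_num) (by norm_num)
  filter_upwards [ht.eventually_lt_const hδ] with n hn r hr s hs hrs
  have := h r ⟨zero_le, hr⟩ s ⟨zero_le, hs⟩ (hrs.trans_lt hn)
  rw [Real.dist_eq] at this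
  exact this.le

lemma abs_min_sub_min_le (a b t : ℝ≥0) : dist (min a t) (min b t) ≤ dist a b := by
  rw [NNReal.dist_eq, NNReal.dist_eq, NNReal.coe_min, NNReal.coe_min]
  exact abs_min_sub_min_le_max _ _ _ _ |>.trans (by simp)

variable {c : ℝ} {u v : Space d → ℝ}

/-- Samples are constant after time `t`, so extra steps change nothing; flows up to different times
can thus be compared with equally many steps. -/
lemma CostDominated.discreteFlow_sample (hH : IsConvexCoerciveHamiltonian H νl νu)
    (hu : CostDominated H c u) (ζ : C(ℝ≥0, ℝ)) {n : ℕ}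
    {t : ℝ≥0} {N : ℕ} (hN : t * 2 ^ n ≤ N) :
    _root_.discreteFlow H (sample ζ n t) N u = gridFlow H ζ u n t := by
  have aux : ∀ N M : ℕ, t * 2 ^ n ≤ N → N ≤ M →
      _root_.discreteFlow H (sample ζ n t) M u = _root_.discreteFlow H (sample ζ n t) N u := by
    intro N M hN hNM
    refine hu.discreteFlow_of_const_tail hH hNM fun k hk => ?_
    rw [sample_of_le ζ hN, sample_of_le ζ (hN.trans (by exact_mod_cast hk))]
  rcases le_total N (⌈t⌉₊ * 2 ^ n) with h | h
  · exact (aux _ _ hN h).symm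
  · exact aux _ _ (mul_le_ceil_mul t n) h

/-- With its values repeated, the coarse sample lives on the fine grid and differs from the fine one
by an oscillation of `ζ` over length at most `2⁻ⁿ`. Stability in the path gives the bound. -/
lemma CostDominated.abs_gridFlow_sub_le (hH : IsConvexCoerciveHamiltonian H νl νu)
    (hu : CostDominated H c u) (ζ : C(ℝ≥0, ℝ)) {t : ℝ≥0}
    {n m : ℕ} (hnm : n ≤ m) {ω : ℝ}
    (hω : ∀ r ≤ t, ∀ s ≤ t, dist r s ≤ (1 / 2) ^ n → |ζ r - ζ s| ≤ ω) (x : Space d) :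
    |gridFlow H ζ u n t x - gridFlow H ζ u m t x| ≤ (c + 2 * (νl 0)⁻) * ω := by
  obtain ⟨j, rfl⟩ := Nat.exists_eq_add_of_le hnm
  have e : gridFlow H ζ u n t
      = _root_.discreteFlow H (fun k => sample ζ n t (k / 2 ^ j)) (⌈t⌉₊ * 2 ^ (n + j)) u := by
    rw [pow_add, ← mul_assoc, hu.discreteFlow_repeat hH _ (by positivity)]; rfl
  rw [e, gridFlow]
  refine hu.abs_discreteFlow_sub_le hH (by simp [sample_zero]) (fun i _ => ?_) x
  refine hω _ (min_le_right _ _) _ (min_le_right _ _) ((abs_min_sub_min_le _ _ _).trans ?_)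
  rw [NNReal.dist_eq]
  push_cast
  have h2 : (0 : ℝ) < 2 ^ n := by positivity
  have h3 : (0 : ℝ) < 2 ^ j := by positivity
  have e1 : ((i / 2 ^ j : ℕ) : ℝ) / 2 ^ n - (i : ℝ) / 2 ^ (n + j)
      = -((i : ℝ) / 2 ^ j - ((i / 2 ^ j : ℕ) : ℝ)) / 2 ^ n := by
    rw [pow_add]; field_simp; ring
  have h4 : ((i / 2 ^ j : ℕ) : ℝ) ≤ (i : ℝ) / 2 ^ j := by
    have := @Nat.cast_div_le ℝ _ _ _ i (2 ^ j)
    push_cast at this; exact this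
  have h5 : (i : ℝ) / 2 ^ j ≤ ((i / 2 ^ j : ℕ) : ℝ) + 1 := by
    rw [div_le_iff₀ h3]
    have : i < (i / 2 ^ j + 1) * 2 ^ j := by
      rw [mul_comm]; exact Nat.lt_mul_div_succ i (by positivity)
    exact_mod_cast this.le
  rw [e1, abs_div, abs_neg, abs_of_nonneg (by linarith : (0 : ℝ) ≤ i / 2 ^ j - (i / 2 ^ j : ℕ)),
    abs_of_pos h2, one_div, inv_pow, div_eq_mul_inv]
  have : (0 : ℝ) < (2 ^ n)⁻¹ := by positivity
  nlinarith

lemma CostDominated.nonneg_bound (hH : IsConvexCoerciveHamiltonian H νl νu)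
    (hu : CostDominated H c u) : 0 ≤ c + 2 * (νl 0)⁻ := by
  have h1 := hu.neg_negPart_le hH
  have hm : 0 ≤ (νl 0)⁻ := negPart_nonneg _
  linarith

lemma CostDominated.tendsto_gridFlow (hH : IsConvexCoerciveHamiltonian H νl νu)
    (hu : CostDominated H c u) (ζ : C(ℝ≥0, ℝ)) (t : ℝ≥0)
    (x : Space d) : Tendsto (fun n => gridFlow H ζ u n t x) atTop (𝓝 (pathFlow H ζ u t x)) := by
  have hc : CauchySeq fun n => gridFlow H ζ u n t x := by
    have hC := hu.nonneg_bound hH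
    rw [Metric.cauchySeq_iff']
    intro ε hε
    set ω : ℝ := ε / (c + 2 * (νl 0)⁻ + 1) with hω
    have hωpos : 0 < ω := by positivity
    obtain ⟨n, hn⟩ := (exists_mesh ζ t hωpos).exists
    refine ⟨n, fun m hm => ?_⟩
    rw [dist_comm, Real.dist_eq]
    refine (hu.abs_gridFlow_sub_le hH ζ hm hn x).trans_lt ?_
    have : ω * (c + 2 * (νl 0)⁻ + 1) = ε := by rw [hω]; field_simp
    nlinarith
  exact hc.tendsto_limUnder

lemma CostDominated.abs_gridFlow_sub_pathFlow_le (hH : IsConvexCoerciveHamiltonian H νl νu)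
    (hu : CostDominated H c u) (ζ : C(ℝ≥0, ℝ))
    {t : ℝ≥0} {n : ℕ} {ω : ℝ}
    (hω : ∀ r ≤ t, ∀ s ≤ t, dist r s ≤ (1 / 2) ^ n → |ζ r - ζ s| ≤ ω) (x : Space d) :
    |gridFlow H ζ u n t x - pathFlow H ζ u t x| ≤ (c + 2 * (νl 0)⁻) * ω := by
  have := ((hu.tendsto_gridFlow hH ζ t x).const_sub (gridFlow H ζ u n t x)).abs
  refine le_of_tendsto this ?_
  filter_upwards [eventually_ge_atTop n] with m hm
  exact hu.abs_gridFlow_sub_le hH ζ hm hω x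

lemma CostDominated.pathFlow (hH : IsConvexCoerciveHamiltonian H νl νu)
    (hu : CostDominated H c u) (ζ : C(ℝ≥0, ℝ)) (t : ℝ≥0) :
    CostDominated H c (pathFlow H ζ u t) := fun _ x y _ h =>
  le_of_tendsto' ((hu.tendsto_gridFlow hH ζ t y).sub (hu.tendsto_gridFlow hH ζ t x))
    fun n => (hu.discreteFlow hH (sample ζ n t) _) h

lemma CostDominated.pathFlow_zero (hH : IsConvexCoerciveHamiltonian H νl νu)
    (hu : CostDominated H c u) (ζ : C(ℝ≥0, ℝ)) (x : Space d) :
    _root_.pathFlow H ζ u 0 x = u x := by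
  refine tendsto_nhds_unique (hu.tendsto_gridFlow hH ζ 0 x) ?_
  simp [gridFlow, _root_.discreteFlow]

lemma CostDominated.pathFlow_le_add (hH : IsConvexCoerciveHamiltonian H νl νu)
    (hu : CostDominated H c u) (hv : CostDominated H c v)
    {D : ℝ} (h : ∀ x, u x ≤ v x + D) (ζ : C(ℝ≥0, ℝ)) (t : ℝ≥0) (x : Space d) :
    _root_.pathFlow H ζ u t x ≤ _root_.pathFlow H ζ v t x + D :=
  le_of_tendsto_of_tendsto' (hu.tendsto_gridFlow hH ζ t x)
    ((hv.tendsto_gridFlow hH ζ t x).add_const D)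
    fun n => hu.discreteFlow_le_add hH hv h (sample ζ n t) _ x

lemma CostDominated.pathFlow_flip (hH : IsConvexCoerciveHamiltonian H νl νu)
    (hu : CostDominated H c u) (ζ : C(ℝ≥0, ℝ)) (t : ℝ≥0)
    (x : Space d) : _root_.pathFlow (flipHam H) (-ζ) (-u) t x = -_root_.pathFlow H ζ u t x := by
  refine tendsto_nhds_unique (hu.flip.tendsto_gridFlow hH.flip (-ζ) t x) ?_
  refine (hu.tendsto_gridFlow hH ζ t x).neg.congr fun n => ?_
  exact (congrFun (hu.discreteFlow_flip hH (sample ζ n t) _) x).symm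

lemma CostDominated.pathFlow_le (hH : IsConvexCoerciveHamiltonian H νl νu)
    (hu : CostDominated H c u) {ζ₁ ζ₂ : C(ℝ≥0, ℝ)}
    (h0 : ζ₁ 0 = ζ₂ 0) {t : ℝ≥0} {M : ℝ} (hM : ∀ s ≤ t, ζ₁ s - ζ₂ s ≤ M) (x : Space d) :
    _root_.pathFlow H ζ₁ u t x ≤ _root_.pathFlow H ζ₂ u t x + c * M
      + (νl 0)⁻ * (M - (ζ₁ t - ζ₂ t)) := by
  refine le_of_tendsto_of_tendsto' (hu.tendsto_gridFlow hH ζ₁ t x)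
    (((hu.tendsto_gridFlow hH ζ₂ t x).add_const (c * M)).add_const _) fun n => ?_
  have := hu.discreteFlow_le hH (a := sample ζ₁ n t) (b := sample ζ₂ n t) (n := ⌈t⌉₊ * 2 ^ n)
    (M := M) (by simp [sample_zero, h0]) (fun i _ => hM _ (min_le_right _ _)) x
  rwa [sample_of_le ζ₁ (mul_le_ceil_mul t n), sample_of_le ζ₂ (mul_le_ceil_mul t n)] at this

/-- The state at time `s` is the flow along `ζ` stopped at `s`, so regularity in time is again
stability in the path. -/
lemma CostDominated.abs_pathFlow_sub_le (hH : IsConvexCoerciveHamiltonian H νl νu)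
    (hu : CostDominated H c u) {ζ : C(ℝ≥0, ℝ)}
    {s t : ℝ≥0} (hst : s ≤ t) {M : ℝ} (hM : ∀ r, s ≤ r → r ≤ t → |ζ r - ζ s| ≤ M)
    (x : Space d) :
    |_root_.pathFlow H ζ u t x - _root_.pathFlow H ζ u s x| ≤ (c + 2 * (νl 0)⁻) * M := by
  refine le_of_tendsto' ((hu.tendsto_gridFlow hH ζ t x).sub (hu.tendsto_gridFlow hH ζ s x)).abs
    fun n => ?_
  have hN : s * 2 ^ n ≤ ((⌈t⌉₊ * 2 ^ n : ℕ) : ℝ≥0) :=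
    (mul_le_mul_left hst _).trans (mul_le_ceil_mul t n)
  rw [← hu.discreteFlow_sample hH ζ hN, gridFlow]
  refine hu.abs_discreteFlow_sub_le hH (by simp [sample_zero]) (fun i _ => ?_) x
  have hM0 : 0 ≤ M := (abs_nonneg _).trans (hM s le_rfl hst)
  simp only [sample]
  rcases le_total ((i : ℝ≥0) / 2 ^ n) s with h | h
  · rw [min_eq_left h, min_eq_left (h.trans hst)]; simpa using hM0
  · rw [min_eq_right h]
    exact hM _ (le_min h hst) (min_le_right _ _)

/-- From the first grid point after `s` on, the samples are monotone and their steps merge into one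
by the semigroup law. Shifting the starting time to the grid costs only the oscillation of `ζ` over
one mesh. -/
lemma CostDominated.pathFlow_of_monotone (hH : IsConvexCoerciveHamiltonian H νl νu)
    (hu : CostDominated H c u) {ζ : C(ℝ≥0, ℝ)}
    {s t : ℝ≥0} (hst : s ≤ t)
    (hζ : MonotoneOn ζ (Set.Icc s t) ∨ AntitoneOn ζ (Set.Icc s t)) :
    _root_.pathFlow H ζ u t = _root_.flowStep H (ζ t - ζ s) (_root_.pathFlow H ζ u s) := by
  funext x
  have hC := hu.nonneg_bound hH
  refine eq_of_abs_sub_le_all fun ε hε => ?_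
  set C := c + 2 * (νl 0)⁻ with hCdef
  -- Four errors of size `C * ω` are collected: `b1`, `b2`, `b3` before the common step and `b6`
  -- after it.
  set ω : ℝ := ε / (4 * C + 1) with hω
  have hωpos : 0 < ω := by positivity
  obtain ⟨n, hn⟩ := (exists_mesh ζ t hωpos).exists
  have hns : ∀ r ≤ s, ∀ r' ≤ s, dist r r' ≤ (1 / 2) ^ n → |ζ r - ζ r'| ≤ ω :=
    fun r hr r' hr' => hn r (hr.trans hst) r' (hr'.trans hst)
  set k₀ : ℕ := ⌈s * 2 ^ n⌉₊ with hk₀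
  have h2 : (0 : ℝ≥0) < 2 ^ n := by positivity
  have hk : s * 2 ^ n ≤ k₀ := Nat.le_ceil _
  have hk' : s ≤ (k₀ : ℝ≥0) / 2 ^ n := by rwa [le_div_iff₀ h2]
  have hkN : k₀ ≤ ⌈t⌉₊ * 2 ^ n :=
    Nat.ceil_le.2 ((mul_le_mul_left hst _).trans (mul_le_ceil_mul t n))
  have hlt : (k₀ : ℝ≥0) / 2 ^ n ≤ s + (1 / 2) ^ n := by
    rw [div_le_iff₀ h2, add_mul, ← mul_pow]
    norm_num
    exact (Nat.ceil_lt_add_one zero_le).le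
  set a := sample ζ n t with ha
  have hak : |a k₀ - ζ s| ≤ ω := by
    refine hn _ (min_le_right _ _) _ hst ?_
    have h3 : s ≤ min ((k₀ : ℝ≥0) / 2 ^ n) t := le_min hk' hst
    rw [NNReal.dist_eq, abs_of_nonneg (by exact_mod_cast sub_nonneg.2 (NNReal.coe_le_coe.2 h3)),
      sub_le_iff_le_add']
    exact_mod_cast (min_le_left _ _).trans hlt
  have hmem : ∀ k, k₀ ≤ k → min ((k : ℝ≥0) / 2 ^ n) t ∈ Set.Icc s t := fun k h =>
    ⟨le_min (hk'.trans (by gcongr)) hst, min_le_right _ _⟩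
  have hmin : ∀ k l : ℕ, k ≤ l → min ((k : ℝ≥0) / 2 ^ n) t ≤ min ((l : ℝ≥0) / 2 ^ n) t :=
    fun k l h => min_le_min_right _ (by gcongr)
  have htail : MonotoneOn a (Set.Ici k₀) ∨ AntitoneOn a (Set.Ici k₀) := by
    rcases hζ with hζ | hζ
    · exact Or.inl fun k hk l hl hkl => hζ (hmem k hk) (hmem l hl) (hmin k l hkl)
    · exact Or.inr fun k hk l hl hkl => hζ (hmem k hk) (hmem l hl) (hmin k l hkl)
  have e1 : gridFlow H ζ u n t
      = _root_.flowStep H (ζ t - a k₀) (_root_.discreteFlow H a k₀ u) := by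
    have e0 : a (⌈t⌉₊ * 2 ^ n) = ζ t := sample_of_le ζ (mul_le_ceil_mul t n)
    rw [gridFlow, hu.discreteFlow_of_monotone_tail hH hkN htail, e0]
  set w := _root_.pathFlow H ζ u s with hw
  have hwd : CostDominated H c w := hu.pathFlow hH ζ s
  have e2 : _root_.flowStep H (ζ t - ζ s) w
      = _root_.flowStep H (ζ t - a k₀) (_root_.flowStep H (a k₀ - ζ s) w) := by
    rw [← hwd.flowStep_add hH]
    · congr 1; ring
    · have h1 := hmem k₀ le_rfl
      rcases hζ with hζ | hζ
      · exact Or.inl ⟨sub_nonneg.2 (hζ h1 ⟨hst, le_rfl⟩ h1.2),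
          sub_nonneg.2 (hζ ⟨le_rfl, hst⟩ h1 h1.1)⟩
      · exact Or.inr ⟨sub_nonpos.2 (hζ h1 ⟨hst, le_rfl⟩ h1.2),
          sub_nonpos.2 (hζ ⟨le_rfl, hst⟩ h1 h1.1)⟩
  have b1 : ∀ y, |_root_.discreteFlow H a k₀ u y - gridFlow H ζ u n s y| ≤ C * ω := by
    intro y
    rw [← hu.discreteFlow_sample hH ζ hk]
    refine hu.abs_discreteFlow_sub_le hH (by simp [ha, sample_zero]) (fun i hi => ?_) y
    rcases eq_or_lt_of_le hi with rfl | hi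
    · rwa [sample_of_le ζ hk]
    · have h3 : (i : ℝ≥0) / 2 ^ n ≤ s := by
        rw [div_le_iff₀ h2]; exact (Nat.lt_ceil.1 hi).le
      simp only [ha, sample, min_eq_left h3, min_eq_left (h3.trans hst), sub_self, abs_zero]
      exact hωpos.le
  have b2 : ∀ y, |gridFlow H ζ u n s y - w y| ≤ C * ω :=
    hu.abs_gridFlow_sub_pathFlow_le hH ζ hns
  have b3 : ∀ y, |_root_.flowStep H (a k₀ - ζ s) w y - w y| ≤ C * ω := fun y =>
    (hwd.abs_flowStep_sub_self_le hH _ y).trans (mul_le_mul_of_nonneg_left hak hC)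
  have b4 : ∀ y, |_root_.discreteFlow H a k₀ u y - _root_.flowStep H (a k₀ - ζ s) w y|
      ≤ 3 * (C * ω) := by
    intro y
    have := b1 y; have := b2 y; have := b3 y
    rw [abs_le] at *
    constructor <;> linarith
  have b5 := (hu.discreteFlow hH a k₀).abs_flowStep_sub_le hH (hwd.flowStep hH _) b4
    (ζ t - a k₀) x
  rw [← e1, ← e2] at b5
  have b6 := hu.abs_gridFlow_sub_pathFlow_le hH ζ hn x
  have hfin : 4 * (C * ω) ≤ ε := by
    have : ω * (4 * C + 1) = ε := by rw [hω]; field_simp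
    nlinarith
  rw [abs_le] at *
  constructor <;> linarith

end PathFlow

/-! ### The flow is a viscosity solution -/

section Viscosity

open Filter Topology

variable {d : ℕ} {H : Space d → Space d → ℝ} {νl νu : ℝ → ℝ}

lemma ContDiff.hasDerivAt_time {φ : Space d × ℝ → ℝ} (hφ : ContDiff ℝ 1 φ) (x : Space d) (t : ℝ) :
    HasDerivAt (fun s => φ (x, s)) (fderiv ℝ φ (x, t) (0, 1)) t := by
  have h1 := (hφ.differentiable one_ne_zero (x, t)).hasFDerivAt
  exact h1.comp_hasDerivAt t ((hasDerivAt_const t x).prodMk (hasDerivAt_id t))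

lemma ContDiff.hasGradientAt_space {φ : Space d × ℝ → ℝ} (hφ : ContDiff ℝ 1 φ) (x : Space d)
    (t : ℝ) : HasGradientAt (fun y => φ (y, t)) ((InnerProductSpace.toDual ℝ (Space d)).symm
      ((fderiv ℝ φ (x, t)).comp (ContinuousLinearMap.inl ℝ (Space d) ℝ))) x := by
  have h1 := (hφ.differentiable one_ne_zero (x, t)).hasFDerivAt
  rw [hasGradientAt_iff_hasFDerivAt, LinearIsometryEquiv.apply_symm_apply]
  exact h1.comp x (hasFDerivAt_prodMk_left x t)

lemma ContDiff.continuous_deriv_time {φ : Space d × ℝ → ℝ} (hφ : ContDiff ℝ 1 φ) :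
    Continuous fun q : Space d × ℝ => deriv (fun s => φ (q.1, s)) q.2 := by
  simp_rw [fun q : Space d × ℝ => (hφ.hasDerivAt_time q.1 q.2).deriv]
  exact (hφ.continuous_fderiv one_ne_zero).clm_apply continuous_const

lemma ContDiff.continuous_gradient_space {φ : Space d × ℝ → ℝ} (hφ : ContDiff ℝ 1 φ) :
    Continuous fun q : Space d × ℝ => gradient (fun y => φ (y, q.2)) q.1 := by
  simp_rw [fun q : Space d × ℝ => (hφ.hasGradientAt_space q.1 q.2).gradient]
  exact (InnerProductSpace.toDual ℝ (Space d)).symm.continuous.comp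
    ((hφ.continuous_fderiv one_ne_zero).clm_comp continuous_const)

/-- The derivative of a test function along a curve in space-time. -/
lemma ContDiff.hasDerivAt_along {φ : Space d × ℝ → ℝ} (hφ : ContDiff ℝ 1 φ) {γ : ℝ → Space d}
    {x q : Space d} {t : ℝ} (hγ : HasDerivAt γ q t) (hx : γ t = x) :
    HasDerivAt (fun s => φ (γ s, s))
      (Inner.inner ℝ (gradient (fun y => φ (y, t)) x) q + deriv (fun s => φ (x, s)) t) t := by
  subst hx
  have h1 := (hφ.differentiable one_ne_zero (γ t, t)).hasFDerivAt
  have h2 := HasFDerivAt.comp_hasDerivAt (f := fun s => (γ s, id s)) t h1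
    (hγ.prodMk (hasDerivAt_id t))
  have e : Inner.inner ℝ (gradient (fun y => φ (y, t)) (γ t)) q + deriv (fun s => φ (γ t, s)) t
      = fderiv ℝ φ (γ t, t) (q, 1) := by
    rw [(hφ.hasGradientAt_space (γ t) t).gradient, (hφ.hasDerivAt_time (γ t) t).deriv,
      InnerProductSpace.toDual_symm_apply]
    rw [ContinuousLinearMap.comp_apply, ContinuousLinearMap.inl_apply, ← map_add]
    simp
  rw [e]; exact h2

/-- The flow at time `t` is built from earlier states, so test inequalities are read off from times
before `t` only. -/
lemma HasDerivAt.nonpos_of_eventually_le_left {F : ℝ → ℝ} {F' t : ℝ} (hF : HasDerivAt F F' t)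
    (h : ∀ᶠ s in 𝓝[<] t, F t ≤ F s) : F' ≤ 0 := by
  refine le_of_tendsto (hasDerivAt_iff_tendsto_slope_left_right.1 hF).1 ?_
  filter_upwards [h, self_mem_nhdsWithin] with s hs hst
  rw [slope_def_field]
  exact div_nonpos_of_nonneg_of_nonpos (by linarith) (by linarith [Set.mem_Iio.1 hst])

lemma ContDiffAt.continuousAt_deriv_of_one {f : ℝ → ℝ} {t : ℝ} (hf : ContDiffAt ℝ 1 f t) :
    ContinuousAt (deriv f) t :=
  (hf.derivWithin (m := 0) (by simp)).continuousAt

lemma ContDiffAt.eventually_monotoneOn {f : ℝ → ℝ} {t : ℝ} (hf : ContDiffAt ℝ 1 f t)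
    (h : 0 < deriv f t) : ∀ᶠ s in 𝓝[<] t, MonotoneOn f (Set.Icc s t) := by
  have h1 : ∀ᶠ s in 𝓝 t, DifferentiableAt ℝ f s ∧ 0 ≤ deriv f s := by
    filter_upwards [hf.eventually (by simp), hf.continuousAt_deriv_of_one.eventually_const_lt h]
      with s hs hs' using ⟨hs.differentiableAt one_ne_zero, hs'.le⟩
  obtain ⟨δ, hδ, hb⟩ := Metric.eventually_nhds_iff_ball.1 h1
  have h2 : Set.Ioo (t - δ) t ∈ 𝓝[<] t := Ioo_mem_nhdsLT (by linarith)
  filter_upwards [h2] with s hs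
  have hsub : ∀ r ∈ Set.Icc s t, r ∈ Metric.ball t δ := fun r hr => by
    rw [Metric.mem_ball, Real.dist_eq, abs_lt]
    constructor <;> linarith [hr.1, hr.2, hs.1]
  exact monotoneOn_of_deriv_nonneg (convex_Icc s t)
    (fun r hr => (hb r (hsub r hr)).1.continuousAt.continuousWithinAt)
    (fun r hr => (hb r (hsub r (interior_subset hr))).1.differentiableWithinAt)
    (fun r hr => (hb r (hsub r (interior_subset hr))).2)

lemma ContDiffAt.eventually_antitoneOn {f : ℝ → ℝ} {t : ℝ} (hf : ContDiffAt ℝ 1 f t)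
    (h : deriv f t < 0) : ∀ᶠ s in 𝓝[<] t, AntitoneOn f (Set.Icc s t) := by
  have : ∀ᶠ s in 𝓝[<] t, MonotoneOn (-f) (Set.Icc s t) :=
    hf.neg.eventually_monotoneOn (by rw [deriv.fun_neg]; linarith)
  filter_upwards [this] with s hs
  simpa using hs.neg

lemma pathExt_coe (ζ : C(ℝ≥0, ℝ)) (r : ℝ≥0) : pathExt ζ r = ζ r := by
  simp [pathExt]

lemma monotoneOn_of_pathExt {ζ : C(ℝ≥0, ℝ)} {s t : ℝ} (ht : 0 ≤ t)
    (h : MonotoneOn (pathExt ζ) (Set.Icc s t)) :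
    MonotoneOn ζ (Set.Icc s.toNNReal t.toNNReal) := by
  have hm : ∀ a ∈ Set.Icc s.toNNReal t.toNNReal, (a : ℝ) ∈ Set.Icc s t := fun a ha =>
    ⟨Real.toNNReal_le_iff_le_coe.1 ha.1, (Real.le_toNNReal_iff_coe_le ht).1 ha.2⟩
  intro a ha b hb hab
  rw [← pathExt_coe, ← pathExt_coe]
  exact h (hm a ha) (hm b hb) (by exact_mod_cast hab)

lemma antitoneOn_of_pathExt {ζ : C(ℝ≥0, ℝ)} {s t : ℝ} (ht : 0 ≤ t)
    (h : AntitoneOn (pathExt ζ) (Set.Icc s t)) :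
    AntitoneOn ζ (Set.Icc s.toNNReal t.toNNReal) := by
  have : MonotoneOn (-ζ) (Set.Icc s.toNNReal t.toNNReal) :=
    monotoneOn_of_pathExt (ζ := -ζ) ht h.neg
  simpa using this.neg

variable {u₀ : Space d → ℝ}

/-- Where `ζ' ≠ 0` the path is locally monotone, and the state at `t` is one semigroup step from the
state at an earlier `s`. For `sm`, an infimum, any single chain gives an upper bound; for `sp`, a
supremum, all nearly optimal chains must be kept where the test function is controlled. -/
lemma CostDominated.pathFlow_subsolution (hH : IsConvexCoerciveHamiltonian H νl νu)
    {K : ℝ≥0} (hu : CostDominated H (νl K) u₀)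
    (ζ : C(ℝ≥0, ℝ)) {u : C(Space d × ℝ≥0, ℝ)} (hU : ∀ x t, u (x, t) = _root_.pathFlow H ζ u₀ t x) :
    IsViscositySubsolution H ζ u := by
  intro φ hφ x t ht hζ hmax
  set Z := pathExt ζ with hZ
  set p := deriv (fun s => φ (x, s)) t with hp
  set P := gradient (fun y => φ (y, t)) x with hP
  have hmax' : ∀ᶠ q : Space d × ℝ in 𝓝 (x, t),
      u (q.1, q.2.toNNReal) - φ q ≤ u (x, t.toNNReal) - φ (x, t) := hmax
  have hφt : HasDerivAt (fun s => φ (x, s)) p t :=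
    (hφ.hasDerivAt_time x t).differentiableAt.hasDerivAt
  have hζd : HasDerivAt Z (deriv Z t) t := (hζ.differentiableAt one_ne_zero).hasDerivAt
  have hC := hu.nonneg_bound hH
  have hnn : ∀ {s}, s < t → s.toNNReal ≤ t.toNNReal := fun h => Real.toNNReal_mono h.le
  rcases lt_trichotomy (deriv Z t) 0 with hz | hz | hz
  · -- decreasing path: compare with one straight move
    have key : ∀ ε > 0, p ≤ deriv Z t * (H P x - ε) := by
      intro ε hε
      obtain ⟨q, b, hqb, hadm⟩ := hH.exists_locally_admissible P x hε
      -- From these points the move with velocity `q` and duration `Z s - Z t` ends exactly at `x`.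
      have hγ : HasDerivAt (fun s => x - (Z s - Z t) • q) (-(deriv Z t • q)) t :=
        ((hζd.sub_const (Z t)).smul_const q).const_sub x
      have hF := (hφ.hasDerivAt_along hγ (x := x) (by simp)).add ((hζd.sub_const (Z t)).mul_const b)
      have hγt : Tendsto (fun s => x - (Z s - Z t) • q) (𝓝[<] t) (𝓝 x) := by
        have := hγ.continuousAt.tendsto.mono_left (nhdsWithin_le_nhds (s := Set.Iio t))
        simpa using this
      have hmaxγ := (hγt.prodMk_nhds (tendsto_id.mono_left nhdsWithin_le_nhds :
        Tendsto id (𝓝[<] t) (𝓝 t))).eventually hmax'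
      obtain ⟨δ, hδ, hball⟩ := Metric.eventually_nhds_iff_ball.1 hadm
      have hγb := hγt.eventually (Metric.ball_mem_nhds x hδ)
      have hle := hF.nonpos_of_eventually_le_left (by
        filter_upwards [hmaxγ, hγb, hζ.eventually_antitoneOn hz, self_mem_nhdsWithin]
          with s h1 h2 h4 h5
        have hst : s < t := h5
        have hτ : 0 ≤ Z s - Z t := sub_nonneg.2 (h4 ⟨le_rfl, hst.le⟩ ⟨hst.le, le_rfl⟩ hst.le)
        have e : x - (Z s - Z t) • q + (Z s - Z t) • q = x := by simp
        have ha : Admissible H q b (x - (Z s - Z t) • q)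
            (x - (Z s - Z t) • q + (Z s - Z t) • q) := by
          rw [e]
          intro z hz
          exact hball z ((convex_ball x δ).segment_subset h2 (Metric.mem_ball_self hδ) hz)
        have hr := (Reach.single hτ ha).congr rfl e rfl
        have hd := hu.pathFlow_of_monotone hH (hnn hst)
          (Or.inr (antitoneOn_of_pathExt ht.le h4))
        change _ = _root_.flowStep H (Z t - Z s) _ at hd
        rw [(hu.pathFlow hH ζ _).flowStep_of_nonpos hH (sub_nonpos.2 (h4 ⟨le_rfl, hst.le⟩
          ⟨hst.le, le_rfl⟩ hst.le)), neg_sub] at hd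
        have h6 := (hu.pathFlow hH ζ s.toNNReal).sm_le hr
        rw [← hd] at h6
        simp only [hU, id] at h1
        simp only [Pi.add_apply, sub_self, zero_smul, sub_zero, zero_mul, add_zero]
        linarith)
      rw [inner_neg_right, inner_smul_right, real_inner_comm, ← hp] at hle
      nlinarith [mul_le_mul_of_nonpos_left hqb hz.le]
    have ht : Tendsto (fun ε : ℝ => deriv Z t * (H P x - ε)) (𝓝[>] 0)
        (𝓝 (deriv Z t * (H P x))) := by
      have : Continuous fun ε : ℝ => deriv Z t * (H P x - ε) := by fun_prop
      simpa using (this.tendsto 0).mono_left nhdsWithin_le_nhds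
    rw [mul_comm]
    refine ge_of_tendsto ht ?_
    filter_upwards [self_mem_nhdsWithin] with ε hε using key ε hε
  · -- stationary path: the flow is Lipschitz in the path
    rw [hz, mul_zero]
    set C := νl K + 2 * (νl 0)⁻ with hCdef
    have key : ∀ ε > 0, p ≤ ε * (2 * C) := by
      intro ε hε
      have hlin : ∀ᶠ r in 𝓝 t, |Z r - Z t| ≤ ε * |r - t| := by
        have := (hasDerivAt_iff_isLittleO.1 hζd).def hε
        filter_upwards [this] with r hr
        simpa [hz] using hr
      obtain ⟨δ, hδ, hball⟩ := Metric.eventually_nhds_iff_ball.1 hlin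
      have hF := (hφt.sub_const (φ (x, t))).sub
        (((hasDerivAt_id t).sub_const t).mul_const (C * (2 * ε)))
      have hmaxx := ((tendsto_const_nhds (x := x)).prodMk_nhds
        (tendsto_id.mono_left nhdsWithin_le_nhds : Tendsto id (𝓝[<] t) (𝓝 t))).eventually hmax'
      have hle := hF.nonpos_of_eventually_le_left (by
        filter_upwards [hmaxx, Ioo_mem_nhdsLT (sub_lt_self t hδ)] with s h1 h3
        have hst : s < t := h3.2
        have hb : ∀ r ∈ Set.Icc s t, |Z r - Z t| ≤ ε * (t - s) := by
          intro r hr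
          have : r ∈ Metric.ball t δ := by
            rw [Metric.mem_ball, Real.dist_eq, abs_lt]
            constructor <;> linarith [hr.1, hr.2, h3.1]
          refine (hball r this).trans (mul_le_mul_of_nonneg_left ?_ hε.le)
          rw [abs_sub_comm, abs_of_nonneg (by linarith [hr.2])]
          linarith [hr.1]
        have h4 := hu.abs_pathFlow_sub_le hH (ζ := ζ) (M := 2 * ε * (t - s)) (hnn hst)
          (fun r hr1 hr2 => by
            have hr : (r : ℝ) ∈ Set.Icc s t := ⟨Real.toNNReal_le_iff_le_coe.1 hr1,
              (Real.le_toNNReal_iff_coe_le ht.le).1 hr2⟩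
            have a1 := hb r hr
            have a2 := hb s ⟨le_rfl, hst.le⟩
            rw [hZ, pathExt_coe] at a1
            have e : pathExt ζ s = ζ s.toNNReal := rfl
            rw [hZ, e] at a2
            rw [abs_le] at *
            constructor <;> linarith) x
        have h5 := (abs_sub_le_iff.1 h4).1
        simp only [hU, id] at h1
        simp only [Pi.sub_apply, id, sub_self, zero_mul]
        nlinarith)
      linarith
    have ht : Tendsto (fun ε : ℝ => ε * (2 * C)) (𝓝[>] 0) (𝓝 0) := by
      have : Continuous fun ε : ℝ => ε * (2 * C) := by fun_prop
      simpa using (this.tendsto 0).mono_left nhdsWithin_le_nhds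
    refine ge_of_tendsto ht ?_
    filter_upwards [self_mem_nhdsWithin] with ε hε using key ε hε
  · -- increasing path: nearly optimal chains stay close to `x`
    have key : ∀ h, H P x < h → p ≤ h * deriv Z t := by
      intro h hh
      have hcont : Continuous fun q : Space d × ℝ => H (gradient (fun y => φ (y, q.2)) q.1) q.1 :=
        hH.continuous_uncurry.comp (hφ.continuous_gradient_space.prodMk continuous_fst)
      have hev := (hcont.tendsto (x, t)).eventually_lt_const hh
      obtain ⟨r, hr, hball⟩ := Metric.eventually_nhds_iff_ball.1 (hev.and hmax')
      -- The square absorbs the error of a nearly optimal chain and has zero derivative at `t`.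
      have hF := ((hφt.sub_const (φ (x, t))).sub ((hζd.sub_const (Z t)).const_mul h)).add
        (((hasDerivAt_id t).sub_const t).pow 2)
      have hsmall : ∀ᶠ s in 𝓝[<] t,
          (νu (K + 1) + (νl 0)⁻) * (Z t - Z s) + (t - s) ^ 2 < r := by
        have hc : ContinuousAt
            (fun s => (νu (K + 1) + (νl 0)⁻) * (Z t - Z s) + (t - s) ^ 2) t :=
          (continuousAt_const.mul (continuousAt_const.sub hζd.continuousAt)).add
            (by fun_prop)
        refine nhdsWithin_le_nhds (hc.tendsto.eventually_lt_const ?_)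
        simpa using hr
      have hle := hF.nonpos_of_eventually_le_left (by
        filter_upwards [hζ.eventually_monotoneOn hz, Ioo_mem_nhdsLT (sub_lt_self t hr),
          hsmall] with s h2 h3 h4
        have hst : s < t := h3.2
        have hτ : 0 ≤ Z t - Z s := sub_nonneg.2 (h2 ⟨le_rfl, hst.le⟩ ⟨hst.le, le_rfl⟩ hst.le)
        have hd := hu.pathFlow_of_monotone hH (hnn hst)
          (Or.inl (monotoneOn_of_pathExt ht.le h2))
        change _ = _root_.flowStep H (Z t - Z s) _ at hd
        rw [flowStep_of_nonneg hτ] at hd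
        have hws := hu.pathFlow hH ζ s.toNNReal
        set w := _root_.pathFlow H ζ u₀ s.toNNReal with hw
        have hpow : 0 < (t - s) ^ 2 := pow_pos (by linarith) 2
        obtain ⟨y, κ, hreach, hopt⟩ := hH.exists_lt_of_lt_sp hτ
          (B := _root_.sp H (Z t - Z s) w x - (t - s) ^ 2) (x := x) (u := w) (by linarith)
        have hmem : ∀ z, ‖z - x‖ < r → (z, s) ∈ Metric.ball (x, t) r := fun z hz => by
          rw [Metric.mem_ball, Prod.dist_eq, max_lt_iff, dist_eq_norm, Real.dist_eq]
          refine ⟨hz, ?_⟩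
          rw [abs_lt]; constructor <;> linarith [h3.1]
        have hdiff : Differentiable ℝ fun y => φ (y, s) := fun y =>
          (hφ.hasGradientAt_space y s).hasFDerivAt.differentiableAt
        obtain ⟨-, hor⟩ := hreach.stays_or_expensive hH hdiff hr K.2
          (fun z hz => (hball (z, s) (hmem z hz)).1.le)
        simp only [Pi.add_apply, Pi.sub_apply, Pi.pow_apply, id, sub_self, mul_zero]
        rcases hor with ⟨ha, hb⟩ | hexp
        · have h5 := (hball (y, s) (hmem y hb)).2
          simp only [hU] at h5
          rw [hd] at h5
          nlinarith
        -- An expensive chain loses: the earlier state gains at most `K * ‖y - x‖` along it, while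
        -- waiting at `x` costs only `(νl 0)⁻` times the duration. By `hsmall` this beats the chain.
        · exfalso
          have hlip := (hH.lipschitz_of_costDominated hws).inner_bound x y
          have h6 := hws.le_sp_add hH hτ x
          simp only [NNReal.val_eq_coe] at hexp
          nlinarith)
      simp only [id, sub_self] at hle
      norm_num at hle
      linarith
    have ht : Tendsto (fun h : ℝ => h * deriv Z t) (𝓝[>] (H P x)) (𝓝 (H P x * deriv Z t)) :=
      ((continuous_mul_const _).tendsto _).mono_left nhdsWithin_le_nhds
    refine ge_of_tendsto ht ?_
    filter_upwards [self_mem_nhdsWithin] with h hh using key h hh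

end Viscosity

/-! ### Comparison of viscosity sub- and supersolutions -/

section Comparison

open Filter Topology

variable {d : ℕ} {H : Space d → Space d → ℝ} {νl νu : ℝ → ℝ} {ζ : C(ℝ≥0, ℝ)}
  {u v : C(Space d × ℝ≥0, ℝ)}

lemma gradient_fun_neg (f : Space d → ℝ) (x : Space d) :
    gradient (fun y => -f y) x = -gradient f x := by
  simp only [gradient]
  rw [fderiv_fun_neg, map_neg]

lemma pathExt_neg (ζ : C(ℝ≥0, ℝ)) : pathExt (-ζ) = fun t => -pathExt ζ t := rfl

lemma IsViscositySubsolution.flip (hu : IsViscositySubsolution H ζ u) :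
    IsViscositySupersolution (flipHam H) (-ζ) (-u) := by
  intro φ hφ x t ht hζ hmin
  rw [pathExt_neg] at hζ
  have := hu (fun q => -φ q) hφ.neg x t ht (by simpa using hζ.neg) (by
    have := hmin.neg
    refine this.congr (.of_forall fun q => ?_)
    simp; ring)
  rw [gradient_fun_neg, deriv.fun_neg] at this
  rw [pathExt_neg, deriv.fun_neg, flipHam]
  linarith

lemma IsViscositySupersolution.flip (hu : IsViscositySupersolution H ζ u) :
    IsViscositySubsolution (flipHam H) (-ζ) (-u) := by
  intro φ hφ x t ht hζ hmax
  rw [pathExt_neg] at hζ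
  have := hu (fun q => -φ q) hφ.neg x t ht (by simpa using hζ.neg) (by
    have := hmax.neg
    refine this.congr (.of_forall fun q => ?_)
    simp; ring)
  rw [gradient_fun_neg, deriv.fun_neg] at this
  rw [pathExt_neg, deriv.fun_neg, flipHam]
  linarith

lemma hasGradientAt_quadratic (A B c c' : ℝ) (x y : Space d) :
    HasGradientAt (fun z : Space d => A / 2 * ‖z - y‖ ^ 2 + c + B * (1 + ‖z‖ ^ 2) + c')
      (A • (x - y) + (2 * B) • x) x := by
  rw [hasGradientAt_iff_hasFDerivAt]
  have h1 : HasFDerivAt (fun z : Space d => ‖z - y‖ ^ 2) (2 • innerSL ℝ (x - y)) x := by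
    have := (hasStrictFDerivAt_norm_sq (x - y)).hasFDerivAt.comp x
      ((hasFDerivAt_id x).sub_const y)
    exact this.congr_fderiv (by ext w; simp)
  have h2 : HasFDerivAt (fun z : Space d => ‖z‖ ^ 2) (2 • innerSL ℝ x) x :=
    (hasStrictFDerivAt_norm_sq x).hasFDerivAt
  have h3 := ((((h1.const_mul (A / 2)).add_const c).add
    ((h2.const_add 1).const_mul B))).add_const c'
  refine h3.congr_fderiv ?_
  ext w
  simp
  ring

/-- The penalised difference with doubled variables. -/
noncomputable def doubled (u v : C(Space d × ℝ≥0, ℝ)) (n β l η k a t₀ : ℝ)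
    (x y : Space d) (t s : ℝ) : ℝ :=
  u (x, t.toNNReal) - v (y, s.toNNReal) - n / 2 * ‖x - y‖ ^ 2 - n / 2 * (t - s) ^ 2
    - β * Real.exp (l * (t - a)) * (1 + ‖x‖ ^ 2) - η * Real.exp (k * (t - t₀))

/-- The subsolution is tested in `(x, t)` and the supersolution in `(y, s)`; the common term `n * (t
- s)` cancels. The growth and time penalties sit on `(x, t)` alone, so the gradient seen by `v` is
exactly `n • (x - y)`. -/
lemma doubled_viscosity_inequality (hu : IsViscositySubsolution H ζ u)
    (hv : IsViscositySupersolution H ζ v) {n β l η k a t₀ : ℝ} {x y : Space d} {t s : ℝ}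
    (ht : 0 < t) (hs : 0 < s) (hζt : ContDiffAt ℝ 1 (pathExt ζ) t)
    (hζs : ContDiffAt ℝ 1 (pathExt ζ) s)
    (hmax₁ : ∀ᶠ r in 𝓝 t, ∀ z, doubled u v n β l η k a t₀ z y r s
      ≤ doubled u v n β l η k a t₀ x y t s)
    (hmax₂ : ∀ᶠ r in 𝓝 s, ∀ z, doubled u v n β l η k a t₀ x z t r
      ≤ doubled u v n β l η k a t₀ x y t s) :
    β * l * Real.exp (l * (t - a)) * (1 + ‖x‖ ^ 2) + η * k * Real.exp (k * (t - t₀))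
      ≤ H (n • (x - y) + (2 * (β * Real.exp (l * (t - a)))) • x) x * deriv (pathExt ζ) t
        - H (n • (x - y)) y * deriv (pathExt ζ) s := by
  have hE : ∀ (l a t : ℝ), HasDerivAt (fun r => Real.exp (l * (r - a)))
      (Real.exp (l * (t - a)) * l) t := by
    intro l a t
    have := (((hasDerivAt_id t).sub_const a).const_mul l).exp
    simpa using this
  have hsq : ∀ s t : ℝ, HasDerivAt (fun r => n / 2 * (r - s) ^ 2) (n * (t - s)) t := by
    intro s t
    have := (((hasDerivAt_id t).sub_const s).pow 2).const_mul (n / 2)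
    refine this.congr_deriv ?_
    simp; ring
  have h1 := hu (fun q => n / 2 * ‖q.1 - y‖ ^ 2 + n / 2 * (q.2 - s) ^ 2
      + β * Real.exp (l * (q.2 - a)) * (1 + ‖q.1‖ ^ 2) + η * Real.exp (k * (q.2 - t₀)))
    (by
      have c1 : ContDiff ℝ 1 fun q : Space d × ℝ => ‖q.1 - y‖ ^ 2 :=
        (contDiff_fst.sub contDiff_const).norm_sq ℝ
      have c2 : ContDiff ℝ 1 fun q : Space d × ℝ => ‖q.1‖ ^ 2 := contDiff_fst.norm_sq ℝ
      have c3 : ∀ l a : ℝ, ContDiff ℝ 1 fun q : Space d × ℝ => Real.exp (l * (q.2 - a)) :=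
        fun l a => (contDiff_const.mul (contDiff_snd.sub contDiff_const)).exp
      have c4 : ContDiff ℝ 1 fun q : Space d × ℝ => (q.2 - s) ^ 2 :=
        (contDiff_snd.sub contDiff_const).pow 2
      exact (((contDiff_const.mul c1).add (contDiff_const.mul c4)).add
        ((contDiff_const.mul (c3 l a)).mul (contDiff_const.add c2))).add
        (contDiff_const.mul (c3 k t₀)))
    x t ht hζt (by
      have := (continuous_snd.tendsto (x, t)).eventually hmax₁
      filter_upwards [this] with q hq
      have := hq q.1
      simp only [doubled] at this
      linarith)
  have h2 := hv (fun q => -(n / 2 * ‖q.1 - x‖ ^ 2 + n / 2 * (q.2 - t) ^ 2))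
    (by
      have c1 : ContDiff ℝ 1 fun q : Space d × ℝ => ‖q.1 - x‖ ^ 2 :=
        (contDiff_fst.sub contDiff_const).norm_sq ℝ
      have c4 : ContDiff ℝ 1 fun q : Space d × ℝ => (q.2 - t) ^ 2 :=
        (contDiff_snd.sub contDiff_const).pow 2
      exact ((contDiff_const.mul c1).add (contDiff_const.mul c4)).neg)
    y s hs hζs (by
      have := (continuous_snd.tendsto (y, s)).eventually hmax₂
      filter_upwards [this] with q hq
      have := hq q.1
      simp only [doubled] at this
      have e1 : ‖q.1 - x‖ = ‖x - q.1‖ := norm_sub_rev _ _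
      have e2 : ‖y - x‖ = ‖x - y‖ := norm_sub_rev _ _
      simp only [e1, e2]
      nlinarith)
  have g1 : gradient (fun z : Space d => n / 2 * ‖z - y‖ ^ 2 + n / 2 * (t - s) ^ 2
      + β * Real.exp (l * (t - a)) * (1 + ‖z‖ ^ 2) + η * Real.exp (k * (t - t₀))) x
      = n • (x - y) + (2 * (β * Real.exp (l * (t - a)))) • x :=
    (hasGradientAt_quadratic n _ _ _ x y).gradient
  have g2 : gradient (fun z : Space d => -(n / 2 * ‖z - x‖ ^ 2 + n / 2 * (s - t) ^ 2)) y
      = n • (x - y) := by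
    rw [gradient_fun_neg]
    have := (hasGradientAt_quadratic n 0 (n / 2 * (s - t) ^ 2) 0 y x).gradient
    simp only [zero_mul, add_zero, mul_zero, zero_smul] at this
    rw [this, ← smul_neg, neg_sub]
  have d1 : deriv (fun r => n / 2 * ‖x - y‖ ^ 2 + n / 2 * (r - s) ^ 2
      + β * Real.exp (l * (r - a)) * (1 + ‖x‖ ^ 2) + η * Real.exp (k * (r - t₀))) t
      = n * (t - s) + β * (Real.exp (l * (t - a)) * l) * (1 + ‖x‖ ^ 2)
        + η * (Real.exp (k * (t - t₀)) * k) :=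
    ((((hsq s t).const_add _).add (((hE l a t).const_mul β).mul_const _)).add
      ((hE k t₀ t).const_mul η)).deriv
  have d2 : deriv (fun r => -(n / 2 * ‖y - x‖ ^ 2 + n / 2 * (r - t) ^ 2)) s = -(n * (s - t)) :=
    ((hsq t s).const_add _).neg.deriv
  simp only [g1, d1] at h1
  simp only [g2, d2] at h2
  linarith

/-- A convex function bounded by `M` on the ball of radius `R + 1` is Lipschitz on the ball of
radius `R`. The constant is uniform in `x` because the bounds `νl`, `νu` do not depend on `x`. -/
lemma IsConvexCoerciveHamiltonian.exists_lipschitz (hH : IsConvexCoerciveHamiltonian H νl νu)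
    {R : ℝ} (hR : 0 ≤ R) : ∃ C : ℝ, 0 ≤ C ∧ ∀ x p p', ‖p‖ < R → ‖p'‖ < R →
      |H p x - H p' x| ≤ C * ‖p - p'‖ := by
  set M := (νl 0)⁻ + |νu (R + 1)| with hM
  refine ⟨(2 * M / 1).toNNReal, NNReal.coe_nonneg _, fun x p p' hp hp' => ?_⟩
  have hc : ConvexOn ℝ (Metric.ball (0 : Space d) (R + 1)) fun p => H p x :=
    (hH.convex x).subset (Set.subset_univ _) (convex_ball _ _)
  have := hc.lipschitzOnWith_of_abs_le one_pos (M := M) fun q hq => by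
    rw [dist_zero_right] at hq
    have h1 := hH.neg_negPart_le q x
    have h2 := (hH.le_upper q x).trans (hH.upper_mono (norm_nonneg q) (by simp; linarith) hq.le)
    rw [abs_le]
    constructor
    · linarith [abs_nonneg (νu (R + 1))]
    · linarith [le_abs_self (νu (R + 1)), negPart_nonneg (νl 0)]
  rw [add_sub_cancel_right] at this
  have := this.dist_le_mul p (by simpa using hp) p' (by simpa using hp')
  rwa [Real.dist_eq, dist_eq_norm] at this

lemma ContDiffOn.exists_deriv_bound {f : ℝ → ℝ} {a b : ℝ} (hab : a < b)
    (hf : ContDiffOn ℝ 1 f (Set.Icc a b)) :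
    ∃ C, 0 ≤ C ∧ ∀ t ∈ Set.Ioo a b, ContDiffAt ℝ 1 f t ∧ |deriv f t| ≤ C := by
  obtain ⟨C, hC⟩ := isCompact_Icc.exists_bound_of_continuousOn
    (hf.continuousOn_derivWithin (uniqueDiffOn_Icc hab) le_rfl)
  refine ⟨|C|, abs_nonneg C, fun t ht => ?_⟩
  have hn : Set.Icc a b ∈ 𝓝 t := Icc_mem_nhds ht.1 ht.2
  refine ⟨hf.contDiffAt hn, ?_⟩
  have := hC t ⟨ht.1.le, ht.2.le⟩
  rw [derivWithin_of_mem_nhds hn, Real.norm_eq_abs] at this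
  exact this.trans (le_abs_self C)

end Comparison

/-! ### Doubling of variables on an interval where the path is `C¹`. -/

section Comparison

open Filter Topology

variable {d : ℕ} {H : Space d → Space d → ℝ} {νl νu : ℝ → ℝ} {ζ : C(ℝ≥0, ℝ)}
  {u v : C(Space d × ℝ≥0, ℝ)}

/-- Points where a doubled function with linearly growing part is nonnegative are bounded,
uniformly in the penalisation. -/
lemma norm_le_of_doubled_nonneg {C β n X Y w : ℝ} (hC : 0 ≤ C) (hβ : 0 < β) (hn : 1 ≤ n)
    (hX : 0 ≤ X) (hw : 0 ≤ w) (hY : Y ≤ X + w)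
    (h : 0 ≤ C * (1 + X) + C * (1 + Y) - n / 2 * w ^ 2 - β * (1 + X ^ 2)) :
    X ≤ 1 + (4 * C + C ^ 2) / β ∧ w ≤ 1 + 2 * C + 4 * C * (2 + (4 * C + C ^ 2) / β) := by
  have hCY : C * Y ≤ C * (X + w) := mul_le_mul_of_nonneg_left hY hC
  have hnw : 1 / 2 * w ^ 2 ≤ n / 2 * w ^ 2 := by nlinarith [sq_nonneg w]
  have hX' : X ≤ 1 + (4 * C + C ^ 2) / β := by
    by_contra! hlt
    have hq : 0 ≤ (4 * C + C ^ 2) / β := by positivity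
    have h1 : (4 * C + C ^ 2) < β * X := by
      have := mul_lt_mul_of_pos_left hlt hβ
      have e : β * (1 + (4 * C + C ^ 2) / β) = β + (4 * C + C ^ 2) := by field_simp
      linarith
    have hX1 : 1 ≤ X := by linarith
    have h2 : (4 * C + C ^ 2) * X ≤ β * X * X := by nlinarith
    -- Young's inequality `C * w ≤ (w ^ 2 + C ^ 2) / 2` lets the penalty absorb the excess of `Y`
    -- over `X`.
    nlinarith [sq_nonneg (w - C), mul_nonneg hC (sub_nonneg.2 hX1), sq_nonneg C,
      mul_nonneg (sq_nonneg C) (sub_nonneg.2 hX1)]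
  refine ⟨hX', ?_⟩
  by_contra! hlt
  set R := 1 + (4 * C + C ^ 2) / β with hR
  have hR0 : 0 ≤ R := hX.trans hX'
  have hw1 : 1 ≤ w := by nlinarith
  have h3 : C * X ≤ C * R := mul_le_mul_of_nonneg_left hX' hC
  have h4 : (1 + 2 * C + 4 * C * (1 + R)) * w ≤ w * w := by nlinarith
  have h5 : C * (1 + R) ≤ C * (1 + R) * w := le_mul_of_one_le_right (by positivity) hw1
  nlinarith [mul_nonneg hβ.le (sq_nonneg X)]

set_option maxHeartbeats 1000000 in
-- Since `v` is Lipschitz in space, the slopes `n • (x - y)` at the maxima stay bounded and converge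
-- along a subsequence, so continuity of `H` suffices to pass to the limit. There the factor `exp (l
-- * (t - a))` of the growth penalty pays for the gradient of that penalty inside `H`, and the
-- strictly increasing time penalty leaves a contradiction.
lemma comparison_on_smooth_interval (hH : IsConvexCoerciveHamiltonian H νl νu)
    (hu : IsViscositySubsolution H ζ u) (hv : IsViscositySupersolution H ζ v) {a b : ℝ}
    (ha : 0 ≤ a) (hab : a < b) (hζ : ContDiffOn ℝ 1 (pathExt ζ) (Set.Icc a b)) {C : ℝ}
    (hC : 0 ≤ C) (hub : ∀ x, ∀ t ≤ b, u (x, t.toNNReal) ≤ C * (1 + ‖x‖))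
    (hvb : ∀ x, ∀ t ≤ b, -v (x, t.toNNReal) ≤ C * (1 + ‖x‖)) {K : ℝ≥0}
    (hvK : ∀ t, LipschitzWith K fun x => v (x, t))
    (hle : ∀ x, u (x, a.toNNReal) ≤ v (x, a.toNNReal)) (x₀ : Space d) {t₀ : ℝ} (hat : a ≤ t₀)
    (htb : t₀ < b) : u (x₀, t₀.toNNReal) ≤ v (x₀, t₀.toNNReal) := by
  by_contra! hlt
  set δ := u (x₀, t₀.toNNReal) - v (x₀, t₀.toNNReal) with hδ
  have hδ0 : 0 < δ := sub_pos.2 hlt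
  obtain ⟨Λ, hΛ, hΛb⟩ := hζ.exists_deriv_bound hab
  -- The limiting slope is at most `2 * K`, and the growth penalty adds a gradient of at most `8 *
  -- C` (see `hgb`).
  obtain ⟨Lc, hLc, hLip⟩ := hH.exists_lipschitz (R := 2 * K + 8 * C + 1) (by positivity)
  set l := Λ * Lc with hl
  have hl0 : 0 ≤ l := mul_nonneg hΛ hLc
  set A := Real.exp (l * (t₀ - a)) * (1 + ‖x₀‖ ^ 2) with hA
  have hApos : 0 < A := by positivity
  -- Each of the two penalties takes a quarter of `δ` at `(x₀, t₀)`, so the doubled function is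
  -- still `δ / 2` there.
  set β := δ / (4 * A) with hβ
  have hβ0 : 0 < β := by positivity
  set η := δ / 4 with hη
  have hη0 : 0 < η := by positivity
  -- With this rate the time penalty at `t = b` exceeds `2 * C ^ 2 / β`, an upper bound of `2 * C *
  -- (1 + X) - β * (1 + X ^ 2)`; it keeps the limiting maximum away from `t = b`.
  set k := 2 * C ^ 2 / β / (η * (b - t₀)) + 1 with hk
  have hbt : 0 < b - t₀ := by linarith
  have hk0 : 0 < k := by positivity
  have hkb : 2 * C ^ 2 / β ≤ η * Real.exp (k * (b - t₀)) := by
    have h1 := Real.add_one_le_exp (k * (b - t₀))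
    have h2 : η * (k * (b - t₀)) = 2 * C ^ 2 / β + η * (b - t₀) := by
      rw [hk]; field_simp
    have h3 := mul_le_mul_of_nonneg_left h1 hη0.le
    have : 0 < η * (b - t₀) := by positivity
    linarith
  set Φ : ℕ → Space d × Space d × ℝ × ℝ → ℝ := fun n w =>
    doubled u v (n + 1) β l η k a t₀ w.1 w.2.1 w.2.2.1 w.2.2.2 with hΦ
  set R₁ := 1 + (4 * C + C ^ 2) / β with hR₁
  set R₂ := 1 + 2 * C + 4 * C * (2 + (4 * C + C ^ 2) / β) with hR₂
  set Q : Set (Space d × Space d × ℝ × ℝ) := Metric.closedBall 0 R₁ ×ˢ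
    (Metric.closedBall 0 (R₁ + R₂) ×ˢ (Set.Icc a b ×ˢ Set.Icc a b)) with hQ
  have hQc : IsCompact Q := (isCompact_closedBall _ _).prod
    ((isCompact_closedBall _ _).prod (isCompact_Icc.prod isCompact_Icc))
  have hexpge : ∀ t, a ≤ t → 1 ≤ Real.exp (l * (t - a)) := fun t ht =>
    Real.one_le_exp (mul_nonneg hl0 (by linarith))
  have hdom : ∀ n x y t s, a ≤ t → t ≤ b → s ≤ b → 0 ≤ Φ n (x, y, t, s) →
      0 ≤ C * (1 + ‖x‖) + C * (1 + ‖y‖) - (n + 1 : ℝ) / 2 * ‖x - y‖ ^ 2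
        - (n + 1 : ℝ) / 2 * (t - s) ^ 2 - β * (1 + ‖x‖ ^ 2) := by
    intro n x y t s hat' htb' hsb h
    simp only [hΦ, doubled] at h
    have h1 := hub x t htb'
    have h2 := hvb y s hsb
    have h3 : β * (1 + ‖x‖ ^ 2) ≤ β * Real.exp (l * (t - a)) * (1 + ‖x‖ ^ 2) := by
      have := le_mul_of_one_le_right hβ0.le (hexpge t hat')
      gcongr
    have h4 : 0 ≤ η * Real.exp (k * (t - t₀)) := by positivity
    linarith
  have hmemQ : ∀ n x y t s, t ∈ Set.Icc a b → s ∈ Set.Icc a b → 0 ≤ Φ n (x, y, t, s) →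
      (x, y, t, s) ∈ Q := by
    intro n x y t s ht hs h
    have h1 := hdom n x y t s ht.1 ht.2 hs.2 h
    have h2 : ‖y‖ ≤ ‖x‖ + ‖x - y‖ := by
      have := norm_sub_le x (x - y); rwa [sub_sub_cancel] at this
    have h3 : (0 : ℝ) ≤ (n + 1 : ℝ) / 2 * (t - s) ^ 2 := by positivity
    obtain ⟨h4, h5⟩ := norm_le_of_doubled_nonneg (n := n + 1) hC hβ0
      (by linarith [n.cast_nonneg (α := ℝ)])
      (norm_nonneg x) (norm_nonneg (x - y)) h2 (by linarith)
    refine ⟨by simpa using h4, ?_, ht, hs⟩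
    simp only [Metric.mem_closedBall, dist_zero_right]
    linarith
  have hΦ₀ : ∀ n, Φ n (x₀, x₀, t₀, t₀) = δ / 2 := by
    intro n
    have : β * A = δ / 4 := by rw [hβ]; field_simp
    have e : β * Real.exp (l * (t₀ - a)) * (1 + ‖x₀‖ ^ 2) = β * A := by rw [hA]; ring
    simp only [hΦ, doubled, sub_self, norm_zero, mul_zero, Real.exp_zero, e, this]
    rw [← hδ, hη]; ring
  have hmem₀ : (x₀, x₀, t₀, t₀) ∈ Q := hmemQ 0 x₀ x₀ t₀ t₀ ⟨hat, htb.le⟩ ⟨hat, htb.le⟩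
    (by rw [hΦ₀]; positivity)
  have cu : Continuous fun q : Space d × ℝ => u (q.1, q.2.toNNReal) :=
    u.continuous.comp (continuous_fst.prodMk (continuous_real_toNNReal.comp continuous_snd))
  have cv : Continuous fun q : Space d × ℝ => v (q.1, q.2.toNNReal) :=
    v.continuous.comp (continuous_fst.prodMk (continuous_real_toNNReal.comp continuous_snd))
  have hcΨ : Continuous fun w : Space d × Space d × ℝ × ℝ =>
      u (w.1, w.2.2.1.toNNReal) - v (w.2.1, w.2.2.2.toNNReal)
        - β * Real.exp (l * (w.2.2.1 - a)) * (1 + ‖w.1‖ ^ 2)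
        - η * Real.exp (k * (w.2.2.1 - t₀)) := by
    have c1 := cu.comp (f := fun w : Space d × Space d × ℝ × ℝ => (w.1, w.2.2.1)) (by fun_prop)
    have c2 := cv.comp (f := fun w : Space d × Space d × ℝ × ℝ => (w.2.1, w.2.2.2)) (by fun_prop)
    have c3 : Continuous fun w : Space d × Space d × ℝ × ℝ =>
      β * Real.exp (l * (w.2.2.1 - a)) * (1 + ‖w.1‖ ^ 2) := by fun_prop
    have c4 : Continuous fun w : Space d × Space d × ℝ × ℝ =>
      η * Real.exp (k * (w.2.2.1 - t₀)) := by fun_prop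
    exact ((c1.sub c2).sub c3).sub c4
  set Ψ := fun w : Space d × Space d × ℝ × ℝ =>
      u (w.1, w.2.2.1.toNNReal) - v (w.2.1, w.2.2.2.toNNReal)
        - β * Real.exp (l * (w.2.2.1 - a)) * (1 + ‖w.1‖ ^ 2)
        - η * Real.exp (k * (w.2.2.1 - t₀)) with hΨ
  have hΦΨ : ∀ n w, Φ n w = Ψ w - (n + 1 : ℝ) / 2 * ‖w.1 - w.2.1‖ ^ 2
      - (n + 1 : ℝ) / 2 * (w.2.2.1 - w.2.2.2) ^ 2 := by
    intro n w; simp only [hΦ, hΨ, doubled]; ring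
  have hcΦ : ∀ n, Continuous (Φ n) := by
    intro n
    rw [funext (hΦΨ n)]
    have : Continuous fun w : Space d × Space d × ℝ × ℝ => ‖w.1 - w.2.1‖ ^ 2 := by fun_prop
    exact (hcΨ.sub (continuous_const.mul this)).sub (by fun_prop)
  have hex : ∀ n, ∃ w ∈ Q, IsMaxOn (Φ n) Q w := fun n =>
    hQc.exists_isMaxOn ⟨_, hmem₀⟩ (hcΦ n).continuousOn
  choose W hWQ hWmax using hex
  have hWpos : ∀ n, δ / 2 ≤ Φ n (W n) := fun n => by
    rw [← hΦ₀ n]; exact hWmax n hmem₀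
  have hglob : ∀ n x y t s, t ∈ Set.Icc a b → s ∈ Set.Icc a b →
      Φ n (x, y, t, s) ≤ Φ n (W n) := by
    intro n x y t s ht hs
    rcases le_or_gt 0 (Φ n (x, y, t, s)) with h | h
    · exact hWmax n (hmemQ n x y t s ht hs h)
    · exact h.le.trans ((half_pos hδ0).le.trans (hWpos n))
  -- the slopes are bounded by the Lipschitz constant of `v`
  have hslope : ∀ n : ℕ, ((n : ℝ) + 1) * ‖(W n).1 - (W n).2.1‖ ≤ 2 * K := by
    intro n
    have h1 := hglob n (W n).1 (W n).1 (W n).2.2.1 (W n).2.2.2 (hWQ n).2.2.1 (hWQ n).2.2.2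
    simp only [hΦ, doubled, sub_self, norm_zero] at h1
    have h2 := (hvK (W n).2.2.2.toNNReal).inner_bound (W n).2.1 (W n).1
    rcases eq_or_lt_of_le (norm_nonneg ((W n).1 - (W n).2.1)) with h0 | h0
    · rw [← h0]; simp
    · have h3 : ((n : ℝ) + 1) * ‖(W n).1 - (W n).2.1‖ * ‖(W n).1 - (W n).2.1‖
          ≤ 2 * K * ‖(W n).1 - (W n).2.1‖ := by linarith
      exact le_of_mul_le_mul_right h3 h0
  set p : ℕ → Space d := fun n => ((n : ℝ) + 1) • ((W n).1 - (W n).2.1) with hp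
  have hpK : ∀ n, p n ∈ Metric.closedBall (0 : Space d) (2 * K) := fun n => by
    rw [mem_closedBall_zero_iff, hp, norm_smul, Real.norm_eq_abs, abs_of_pos (by positivity)]
    exact hslope n
  set B := C * (1 + R₁) + C * (1 + (R₁ + R₂)) with hB
  have hpen : ∀ n : ℕ, ‖(W n).1 - (W n).2.1‖ ^ 2 + ((W n).2.2.1 - (W n).2.2.2) ^ 2
      ≤ 2 * B * (1 / ((n : ℝ) + 1)) := by
    intro n
    have h1 := hdom n (W n).1 (W n).2.1 (W n).2.2.1 (W n).2.2.2 (hWQ n).2.2.1.1 (hWQ n).2.2.1.2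
      (hWQ n).2.2.2.2 ((half_pos hδ0).le.trans (hWpos n))
    have h2 : ‖(W n).1‖ ≤ R₁ := by simpa using (hWQ n).1
    have h3 : ‖(W n).2.1‖ ≤ R₁ + R₂ := by simpa using (hWQ n).2.1
    have h4 := mul_le_mul_of_nonneg_left h2 hC
    have h5 := mul_le_mul_of_nonneg_left h3 hC
    have h6 : 0 ≤ β * (1 + ‖(W n).1‖ ^ 2) := by positivity
    have hn : (0 : ℝ) < (n : ℝ) + 1 := by positivity
    rw [mul_one_div, le_div_iff₀ hn, hB]
    linarith
  obtain ⟨⟨ω, q⟩, hωq, ψ, hψ, hlim⟩ :=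
    (hQc.prod (isCompact_closedBall (0 : Space d) (2 * K))).tendsto_subseq
    (x := fun n => (W n, p n)) fun n => ⟨hWQ n, hpK n⟩
  obtain ⟨xh, yh, th, sh⟩ := ω
  have hW : Tendsto (fun n => W (ψ n)) atTop (𝓝 (xh, yh, th, sh)) :=
    (continuous_fst.tendsto _).comp hlim
  have hpl : Tendsto (fun n => p (ψ n)) atTop (𝓝 q) := (continuous_snd.tendsto _).comp hlim
  have hWx : Tendsto (fun n => (W (ψ n)).1) atTop (𝓝 xh) := (continuous_fst.tendsto _).comp hW
  have hWy : Tendsto (fun n => (W (ψ n)).2.1) atTop (𝓝 yh) :=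
    ((continuous_fst.comp continuous_snd).tendsto _).comp hW
  have hWt : Tendsto (fun n => (W (ψ n)).2.2.1) atTop (𝓝 th) :=
    ((continuous_fst.comp (continuous_snd.comp continuous_snd)).tendsto _).comp hW
  have hWs : Tendsto (fun n => (W (ψ n)).2.2.2) atTop (𝓝 sh) :=
    ((continuous_snd.comp (continuous_snd.comp continuous_snd)).tendsto _).comp hW
  have hzero : ‖xh - yh‖ ^ 2 + (th - sh) ^ 2 ≤ 0 := by
    have h1 : Tendsto (fun n => 2 * B * (1 / ((ψ n : ℝ) + 1))) atTop (𝓝 (2 * B * 0)) :=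
      ((tendsto_one_div_add_atTop_nhds_zero_nat (𝕜 := ℝ)).comp hψ.tendsto_atTop).const_mul _
    rw [mul_zero] at h1
    exact le_of_tendsto_of_tendsto' (((hWx.sub hWy).norm.pow 2).add ((hWt.sub hWs).pow 2)) h1
      fun n => hpen (ψ n)
  have hxy : xh = yh := by
    have : ‖xh - yh‖ ^ 2 = 0 := by
      linarith [sq_nonneg ‖xh - yh‖, sq_nonneg (th - sh)]
    rwa [sq_eq_zero_iff, norm_eq_zero, sub_eq_zero] at this
  have hts : th = sh := by
    have : (th - sh) ^ 2 = 0 := by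
      linarith [sq_nonneg ‖xh - yh‖, sq_nonneg (th - sh)]
    rwa [sq_eq_zero_iff, sub_eq_zero] at this
  subst hxy hts
  have hth : th ∈ Set.Icc a b := hωq.1.2.2.1
  have hΨlim : δ / 2 ≤ Ψ (xh, xh, th, th) := by
    refine ge_of_tendsto' ((hcΨ.tendsto _).comp hW) fun n => ?_
    have h1 := hWpos (ψ n)
    rw [hΦΨ] at h1
    have h2 : (0 : ℝ) ≤ ((ψ n : ℝ) + 1) / 2 * ‖(W (ψ n)).1 - (W (ψ n)).2.1‖ ^ 2 := by positivity
    have h3 : (0 : ℝ) ≤ ((ψ n : ℝ) + 1) / 2 * ((W (ψ n)).2.2.1 - (W (ψ n)).2.2.2) ^ 2 := by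
      positivity
    simp only [Function.comp]
    linarith
  set E := Real.exp (l * (th - a)) with hE
  have hE1 : 1 ≤ E := hexpge th hth.1
  have hΨle : Ψ (xh, xh, th, th) = u (xh, th.toNNReal) - v (xh, th.toNNReal)
      - β * E * (1 + ‖xh‖ ^ 2) - η * Real.exp (k * (th - t₀)) := rfl
  have hexpos : 0 < η * Real.exp (k * (th - t₀)) := by positivity
  have hgrow : u (xh, th.toNNReal) - v (xh, th.toNNReal) ≤ 2 * C * (1 + ‖xh‖) := by
    linarith [hub xh th hth.2, hvb xh th hth.2]
  have hsq : (1 + ‖xh‖) ^ 2 ≤ 2 * (1 + ‖xh‖ ^ 2) := by linarith [sq_nonneg (1 - ‖xh‖)]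
  have hxn : 0 ≤ ‖xh‖ := norm_nonneg _
  have hβE : 0 < β * E := by positivity
  have hta : a < th := by
    rcases eq_or_lt_of_le hth.1 with rfl | h
    · have h1 := hle xh
      have h2 : 0 ≤ β * E * (1 + ‖xh‖ ^ 2) := by positivity
      linarith
    · exact h
  have htb' : th < b := by
    rcases eq_or_lt_of_le hth.2 with rfl | h
    · have h2 : β * (1 + ‖xh‖ ^ 2) ≤ β * E * (1 + ‖xh‖ ^ 2) := by
        have := le_mul_of_one_le_right hβ0.le hE1
        gcongr
      have h3 : 2 * C * (1 + ‖xh‖) - β * (1 + ‖xh‖ ^ 2) ≤ 2 * C ^ 2 / β := by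
        rw [le_div_iff₀ hβ0]
        linarith [sq_nonneg (β * (1 + ‖xh‖) - 2 * C), mul_le_mul_of_nonneg_left hsq (sq_nonneg β)]
      linarith
    · exact h
  -- the viscosity inequalities and their limit
  have hev : ∀ᶠ n in atTop, (W (ψ n)).2.2.1 ∈ Set.Ioo a b ∧ (W (ψ n)).2.2.2 ∈ Set.Ioo a b :=
    (hWt.eventually (Ioo_mem_nhds hta htb')).and (hWs.eventually (Ioo_mem_nhds hta htb'))
  have hineq : ∀ᶠ n in atTop,
      β * l * Real.exp (l * ((W (ψ n)).2.2.1 - a)) * (1 + ‖(W (ψ n)).1‖ ^ 2)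
        + η * k * Real.exp (k * ((W (ψ n)).2.2.1 - t₀))
      ≤ H (p (ψ n) + (2 * (β * Real.exp (l * ((W (ψ n)).2.2.1 - a)))) • (W (ψ n)).1) (W (ψ n)).1
          * deriv (pathExt ζ) (W (ψ n)).2.2.1
        - H (p (ψ n)) (W (ψ n)).2.1 * deriv (pathExt ζ) (W (ψ n)).2.2.2 := by
    filter_upwards [hev] with n hn
    refine doubled_viscosity_inequality hu hv (by linarith [hn.1.1]) (by linarith [hn.2.1])
      (hΛb _ hn.1).1 (hΛb _ hn.2).1 ?_ ?_
    · filter_upwards [Icc_mem_nhds hn.1.1 hn.1.2] with r hr z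
      exact hglob (ψ n) z (W (ψ n)).2.1 r (W (ψ n)).2.2.2 hr (hWQ _).2.2.2
    · filter_upwards [Icc_mem_nhds hn.2.1 hn.2.2] with r hr z
      exact hglob (ψ n) (W (ψ n)).1 z (W (ψ n)).2.2.1 r (hWQ _).2.2.1 hr
  obtain ⟨hζt, hΛt⟩ := hΛb th ⟨hta, htb'⟩
  have hcE : Tendsto (fun n => Real.exp (l * ((W (ψ n)).2.2.1 - a))) atTop (𝓝 E) :=
    (Real.continuous_exp.tendsto _).comp ((hWt.sub_const a).const_mul l)
  have hcE' : Tendsto (fun n => Real.exp (k * ((W (ψ n)).2.2.1 - t₀))) atTop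
      (𝓝 (Real.exp (k * (th - t₀)))) :=
    (Real.continuous_exp.tendsto _).comp ((hWt.sub_const t₀).const_mul k)
  have hdt := hζt.continuousAt_deriv_of_one.tendsto.comp hWt
  have hds := hζt.continuousAt_deriv_of_one.tendsto.comp hWs
  have hlimit := le_of_tendsto_of_tendsto
    (((hcE.const_mul (β * l)).mul ((hWx.norm.pow 2).const_add 1)).add (hcE'.const_mul (η * k)))
    ((((hH.continuous_uncurry.tendsto (q + (2 * (β * E)) • xh, xh)).comp
      ((hpl.add (((hcE.const_mul β).const_mul 2).smul hWx)).prodMk_nhds hWx)).mul hdt).sub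
      (((hH.continuous_uncurry.tendsto (q, xh)).comp (hpl.prodMk_nhds hWy)).mul hds)) hineq
  have hgrad : ‖(2 * (β * E)) • xh‖ = 2 * (β * E) * ‖xh‖ := by
    rw [norm_smul, Real.norm_eq_abs, abs_of_pos (by positivity)]
  have hgb : 2 * (β * E) * ‖xh‖ ≤ 8 * C := by
    have h1 : β * E * (1 + ‖xh‖) * (1 + ‖xh‖) ≤ 4 * C * (1 + ‖xh‖) := by
      have := mul_le_mul_of_nonneg_left hsq hβE.le
      linarith
    have h2 := le_of_mul_le_mul_right h1 (by linarith)
    linarith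
  have hqn : ‖q‖ ≤ 2 * K := by simpa using hωq.2
  have hHb := hLip xh (q + (2 * (β * E)) • xh) q
    ((norm_add_le _ _).trans_lt (by rw [hgrad]; linarith))
    (by linarith)
  rw [add_sub_cancel_left, hgrad] at hHb
  have hfin : (H (q + (2 * (β * E)) • xh) xh - H q xh) * deriv (pathExt ζ) th
      ≤ Lc * (2 * (β * E) * ‖xh‖) * Λ := by
    refine (le_abs_self _).trans ?_
    rw [abs_mul]
    exact mul_le_mul hHb hΛt (abs_nonneg _) (by positivity)
  have hfin2 : Lc * (2 * (β * E) * ‖xh‖) * Λ ≤ β * l * E * (1 + ‖xh‖ ^ 2) := by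
    have h1 : 2 * ‖xh‖ ≤ 1 + ‖xh‖ ^ 2 := by linarith [sq_nonneg (1 - ‖xh‖)]
    have h2 : 0 ≤ β * l * E := by positivity
    have h3 := mul_le_mul_of_nonneg_left h1 h2
    have e : Lc * (2 * (β * E) * ‖xh‖) * Λ = β * l * E * (2 * ‖xh‖) := by rw [hl]; ring
    linarith
  have hpos : 0 < η * k * Real.exp (k * (th - t₀)) := by positivity
  linarith

end Comparison

/-! ### Comparison for all times, and stability of subsolutions under uniform limits. -/

section GlobalComparison

open Filter Topology

variable {d : ℕ} {H : Space d → Space d → ℝ} {νl νu : ℝ → ℝ} {ζ : C(ℝ≥0, ℝ)}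
  {u v : C(Space d × ℝ≥0, ℝ)}

/-- At most linear growth in space, locally uniformly in time. -/
def HasLinearGrowth (u : C(Space d × ℝ≥0, ℝ)) : Prop :=
  ∀ T : ℝ≥0, ∃ C : ℝ, ∀ x, ∀ t ≤ T, |u (x, t)| ≤ C * (1 + ‖x‖)

lemma HasLinearGrowth.neg (hu : HasLinearGrowth u) : HasLinearGrowth (-u) := by
  simpa [HasLinearGrowth] using hu

lemma IsPiecewiseC1Path.neg (hζ : IsPiecewiseC1Path ζ) : IsPiecewiseC1Path (-ζ) := by
  intro t ht
  obtain ⟨ε, hε, h1, h2⟩ := hζ t ht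
  exact ⟨ε, hε, h1.neg, fun h => (h2 h).neg⟩

/-- The times at which `u ≤ v` form a closed set, and from each of them the inequality extends over
the `C¹` interval to its right. Break points need no equation: continuity brings the inequality to
them. -/
lemma comparison_of_lipschitz_supersolution (hH : IsConvexCoerciveHamiltonian H νl νu)
    (hζ : IsPiecewiseC1Path ζ) (hu : IsViscositySubsolution H ζ u)
    (hv : IsViscositySupersolution H ζ v) (hug : HasLinearGrowth u) (hvg : HasLinearGrowth v)
    {K : ℝ≥0} (hvK : ∀ t, LipschitzWith K fun x => v (x, t))
    (hle : ∀ x, u (x, 0) ≤ v (x, 0)) (x : Space d) (t : ℝ≥0) : u (x, t) ≤ v (x, t) := by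
  set s : Set ℝ := {r | ∀ x, u (x, r.toNNReal) ≤ v (x, r.toNNReal)} with hs
  have hclosed : IsClosed s := by
    have : s = ⋂ x, {r : ℝ | u (x, r.toNNReal) ≤ v (x, r.toNNReal)} := by
      ext r; simp [hs]
    rw [this]
    exact isClosed_iInter fun x => isClosed_le
      (u.continuous.comp (continuous_const.prodMk continuous_real_toNNReal))
      (v.continuous.comp (continuous_const.prodMk continuous_real_toNNReal))
  have hsub : Set.Icc (0 : ℝ) t ⊆ s := by
    refine (hclosed.inter isClosed_Icc).Icc_subset_of_forall_exists_gt (by simpa [hs] using hle) ?_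
    rintro r ⟨hr, hr0, -⟩ y hy
    obtain ⟨ε, hε, hC1, -⟩ := hζ r hr0
    obtain ⟨C₁, h₁⟩ := hug (r + ε).toNNReal
    obtain ⟨C₂, h₂⟩ := hvg (r + ε).toNNReal
    have hy' : r < y := hy
    have hz : r < min y (r + ε / 2) := lt_min hy' (by linarith)
    refine ⟨min y (r + ε / 2), fun z => ?_, hz, min_le_left _ _⟩
    have hm1 : C₁ ≤ max |C₁| |C₂| := (le_abs_self _).trans (le_max_left _ _)
    have hm2 : C₂ ≤ max |C₁| |C₂| := (le_abs_self _).trans (le_max_right _ _)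
    refine comparison_on_smooth_interval hH hu hv hr0 (by linarith : r < r + ε) hC1
      (C := max |C₁| |C₂|) (le_max_of_le_left (abs_nonneg _))
      (fun x t ht => ?_) (fun x t ht => ?_) hvK hr z hz.le
      ((min_le_right _ _).trans_lt (by linarith))
    · refine (le_abs_self _).trans ((h₁ x _ (Real.toNNReal_mono ht)).trans ?_)
      gcongr
    · refine (neg_le_abs _).trans ((h₂ x _ (Real.toNNReal_mono ht)).trans ?_)
      gcongr
  have := hsub ⟨t.2, le_rfl⟩ x
  simpa using this

lemma comparison_of_lipschitz_subsolution (hH : IsConvexCoerciveHamiltonian H νl νu)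
    (hζ : IsPiecewiseC1Path ζ) (hu : IsViscositySubsolution H ζ u)
    (hv : IsViscositySupersolution H ζ v) (hug : HasLinearGrowth u) (hvg : HasLinearGrowth v)
    {K : ℝ≥0} (huK : ∀ t, LipschitzWith K fun x => u (x, t))
    (hle : ∀ x, u (x, 0) ≤ v (x, 0)) (x : Space d) (t : ℝ≥0) : u (x, t) ≤ v (x, t) := by
  have := comparison_of_lipschitz_supersolution hH.flip hζ.neg hv.flip hu.flip hvg.neg hug.neg
    (K := K) (fun t => (huK t).neg) (fun x => by simpa using hle x) x t
  simpa using this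

/-- Subsolutions are stable under uniform convergence. -/
lemma isViscositySubsolution_of_uniform_approx (hH : IsConvexCoerciveHamiltonian H νl νu)
    (h : ∀ ε > 0, ∃ w : C(Space d × ℝ≥0, ℝ), IsViscositySubsolution H ζ w ∧
      ∀ q, |u q - w q| ≤ ε) : IsViscositySubsolution H ζ u := by
  intro φ hφ x t ht hζ hmax
  -- Adding `N`, whose derivatives vanish at `(x, t)`, makes the maximum strict without changing the
  -- inequality to be proved.
  set N : Space d × ℝ → ℝ := fun q => ‖q.1 - x‖ ^ 2 + (q.2 - t) ^ 2 with hN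
  have hNc : ContDiff ℝ 1 N := ((contDiff_fst.sub contDiff_const).norm_sq ℝ).add
    ((contDiff_snd.sub contDiff_const).pow 2)
  set φ' : Space d × ℝ → ℝ := fun q => φ q + N q with hφ'
  have hφ'c : ContDiff ℝ 1 φ' := hφ.add hNc
  set G : Space d × ℝ → ℝ := fun q =>
    H (gradient (fun y => φ' (y, q.2)) q.1) q.1 * deriv (pathExt ζ) q.2
      - deriv (fun s => φ' (q.1, s)) q.2 with hG
  have hGc : ContinuousAt G (x, t) := by
    refine ContinuousAt.sub (ContinuousAt.mul ?_ ?_) hφ'c.continuous_deriv_time.continuousAt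
    · exact (hH.continuous_uncurry.comp
        (hφ'c.continuous_gradient_space.prodMk continuous_fst)).continuousAt
    · exact ContinuousAt.comp (f := Prod.snd) (x := (x, t)) hζ.continuousAt_deriv_of_one
        continuous_snd.continuousAt
  have hg : gradient (fun y => φ' (y, t)) x = gradient (fun y => φ (y, t)) x := by
    have h1 := (hφ.hasGradientAt_space x t).hasFDerivAt
    have h2 := (hasGradientAt_quadratic 2 0 0 0 x x).hasFDerivAt
    have h3 := h1.add h2
    simp only [sub_self, smul_zero, mul_zero, zero_smul, add_zero, map_zero] at h3
    rw [(hφ.hasGradientAt_space x t).gradient]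
    refine HasGradientAt.gradient (hasGradientAt_iff_hasFDerivAt.2 (h3.congr_of_eventuallyEq ?_))
    exact .of_forall fun y => by simp [hφ', hN]
  have hd : deriv (fun s => φ' (x, s)) t = deriv (fun s => φ (x, s)) t := by
    have h1 := hφ.hasDerivAt_time x t
    have h2 := ((hasDerivAt_id t).sub_const t).pow 2
    have h3 := h1.add h2
    rw [h1.deriv]
    refine (h3.congr_of_eventuallyEq (.of_forall fun s => ?_)).deriv.trans ?_
    · simp [hφ', hN]
    · simp
  suffices hsuff : 0 ≤ G (x, t) by
    simp only [hG, hg, hd] at hsuff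
    linarith
  by_contra! hneg
  have hmax' : ∀ᶠ q : Space d × ℝ in 𝓝 (x, t),
      u (q.1, q.2.toNNReal) - φ q ≤ u (x, t.toNNReal) - φ (x, t) := hmax
  have hpos : ∀ᶠ q : Space d × ℝ in 𝓝 (x, t), 0 < q.2 :=
    (continuous_snd.tendsto (x, t)).eventually (lt_mem_nhds ht)
  have hsm : ∀ᶠ q : Space d × ℝ in 𝓝 (x, t), ContDiffAt ℝ 1 (pathExt ζ) q.2 :=
    (continuous_snd.tendsto (x, t)).eventually (hζ.eventually (by simp))
  obtain ⟨r, hr, hball⟩ := Metric.eventually_nhds_iff_ball.1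
    ((hmax'.and (hpos.and hsm)).and (hGc.tendsto.eventually_lt_const hneg))
  set δ := r / 2 with hδ
  have hδ0 : 0 < δ := by positivity
  -- With this tolerance the perturbed maximum has `N q ≤ δ ^ 2 / 2 < δ ^ 2`, so it lies inside the
  -- ball and is a local maximum.
  obtain ⟨w, hw, hwu⟩ := h (δ ^ 2 / 4) (by positivity)
  have hcw : Continuous fun q : Space d × ℝ => w (q.1, q.2.toNNReal) - φ' q :=
    (w.continuous.comp (continuous_fst.prodMk (continuous_real_toNNReal.comp continuous_snd))).sub
      hφ'c.continuous
  obtain ⟨q, hq, hqmax⟩ := (isCompact_closedBall (x, t) δ).exists_isMaxOn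
    ⟨_, Metric.mem_closedBall_self hδ0.le⟩ hcw.continuousOn
  have hqr : q ∈ Metric.ball (x, t) r :=
    Metric.closedBall_subset_ball (by rw [hδ]; linarith) hq
  obtain ⟨⟨hq1, hq2, hq3⟩, hq4⟩ := hball q hqr
  have hNq : N q ≤ δ ^ 2 / 2 := by
    have h1 : w (x, t.toNNReal) - φ' (x, t) ≤ w (q.1, q.2.toNNReal) - φ' q :=
      hqmax (Metric.mem_closedBall_self hδ0.le)
    have h2 := (abs_sub_le_iff.1 (hwu (x, t.toNNReal))).1
    have h3 := (abs_sub_le_iff.1 (hwu (q.1, q.2.toNNReal))).2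
    have h4 : φ' (x, t) = φ (x, t) := by simp [hφ', hN]
    have h5 : φ' q = φ q + N q := rfl
    linarith
  have hqb : q ∈ Metric.ball (x, t) δ := by
    have h1 : ‖q.1 - x‖ ^ 2 < δ ^ 2 := by
      simp only [hN] at hNq; nlinarith [sq_nonneg (q.2 - t)]
    have h2 : |q.2 - t| ^ 2 < δ ^ 2 := by
      rw [sq_abs]; simp only [hN] at hNq; nlinarith [sq_nonneg ‖q.1 - x‖]
    rw [Metric.mem_ball, Prod.dist_eq, max_lt_iff, dist_eq_norm, Real.dist_eq]
    exact ⟨lt_of_pow_lt_pow_left₀ 2 hδ0.le h1, lt_of_pow_lt_pow_left₀ 2 hδ0.le h2⟩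
  have hloc : IsLocalMax (fun q : Space d × ℝ => w (q.1, q.2.toNNReal) - φ' q) (q.1, q.2) :=
    hqmax.isLocalMax (Filter.mem_of_superset (Metric.isOpen_ball.mem_nhds hqb)
      Metric.ball_subset_closedBall)
  have := hw φ' hφ'c q.1 q.2 hq2 hq3 hloc
  simp only [hG] at hq4
  linarith

end GlobalComparison

/-! ### Solutions for uniformly continuous data -/

section Solutions

open Filter Topology

variable {d : ℕ} {H : Space d → Space d → ℝ} {νl νu : ℝ → ℝ}

/-- Chaining the modulus of continuity along segments gives `u x - u y ≤ ε + L * ‖x - y‖`, so the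
inf-convolution of `u` with `L * ‖·‖` stays within `ε` of `u`. -/
lemma UniformContinuous.exists_lipschitz_approx {u : Space d → ℝ} (hu : UniformContinuous u)
    {ε : ℝ} (hε : 0 < ε) : ∃ (L : ℝ≥0) (v : Space d → ℝ), LipschitzWith L v ∧
      ∀ x, |u x - v x| ≤ ε := by
  obtain ⟨δ, hδ, h⟩ := Metric.uniformContinuous_iff.1 hu ε hε
  set ρ := δ / 2 with hρ
  have hρ0 : 0 < ρ := by positivity
  have hstep : ∀ n : ℕ, ∀ x y, ‖x - y‖ ≤ n * ρ → u x - u y ≤ n * ε := by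
    intro n
    induction n with
    | zero =>
      intro x y hxy
      have : x = y := by
        rw [← sub_eq_zero, ← norm_le_zero_iff]; simpa using hxy
      simp [this]
    | succ n ih =>
      intro x y hxy
      have hn : (0 : ℝ) < n + 1 := by positivity
      set z := y + ((n : ℝ) / (n + 1)) • (x - y) with hz
      have h1 : ‖z - y‖ ≤ n * ρ := by
        rw [hz, add_sub_cancel_left, norm_smul, Real.norm_eq_abs, abs_of_nonneg (by positivity),
          div_mul_eq_mul_div, div_le_iff₀ hn]
        push_cast at hxy
        nlinarith [mul_le_mul_of_nonneg_left hxy (n.cast_nonneg (α := ℝ))]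
      have h2 : ‖x - z‖ ≤ ρ := by
        have e : x - z = ((1 : ℝ) / (n + 1)) • (x - y) := by
          have e' : (1 : ℝ) / (n + 1) = 1 - (n : ℝ) / (n + 1) := by field_simp; ring
          rw [hz, e', sub_smul, one_smul]; abel
        rw [e, norm_smul, Real.norm_eq_abs, abs_of_nonneg (by positivity), div_mul_eq_mul_div,
          div_le_iff₀ hn]
        push_cast at hxy
        linarith
      have h3 := h (a := x) (b := z) (by rw [dist_eq_norm]; linarith)
      rw [Real.dist_eq] at h3
      have h4 := ih z y h1
      push_cast
      linarith [(abs_lt.1 h3).2]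
  set L : ℝ := ε / ρ with hL
  have hL0 : 0 < L := by positivity
  have hmod : ∀ x y, u x - u y ≤ ε + L * ‖x - y‖ := by
    intro x y
    have h1 := hstep ⌈‖x - y‖ / ρ⌉₊ x y (by
      rw [← div_le_iff₀ hρ0]; exact Nat.le_ceil _)
    have h2 := (Nat.ceil_lt_add_one (by positivity : 0 ≤ ‖x - y‖ / ρ)).le
    have h3 := mul_le_mul_of_nonneg_right h2 hε.le
    have e : (‖x - y‖ / ρ + 1) * ε = ε + L * ‖x - y‖ := by rw [hL]; field_simp; ring
    linarith
  set v : Space d → ℝ := fun x => ⨅ y, (u y + L * ‖x - y‖) with hv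
  have hbdd : ∀ x, BddBelow (Set.range fun y => u y + L * ‖x - y‖) := fun x =>
    ⟨u x - ε, by rintro _ ⟨y, rfl⟩; simp only; linarith [hmod x y]⟩
  have hvle : ∀ x y, v x ≤ u y + L * ‖x - y‖ := fun x y => ciInf_le (hbdd x) y
  refine ⟨L.toNNReal, v, LipschitzWith.of_le_add_mul _ fun x y => ?_, fun x => ?_⟩
  · rw [← sub_le_iff_le_add]
    refine le_ciInf fun z => ?_
    have h1 := hvle x z
    have h2 : ‖x - z‖ ≤ ‖x - y‖ + ‖y - z‖ := norm_sub_le_norm_sub_add_norm_sub x y z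
    have h3 := mul_le_mul_of_nonneg_left h2 hL0.le
    rw [dist_eq_norm, Real.coe_toNNReal _ hL0.le]
    linarith
  · have h1 := hvle x x
    have h2 : u x - ε ≤ v x := le_ciInf fun y => by linarith [hmod x y]
    simp only [sub_self, norm_zero, mul_zero, add_zero] at h1
    rw [abs_le]; constructor <;> linarith

variable {c : ℝ} {u₀ v : Space d → ℝ}
  {ζ : C(ℝ≥0, ℝ)}

lemma CostDominated.continuous_pathFlow_time (hH : IsConvexCoerciveHamiltonian H νl νu)
    (hv : CostDominated H c v) (ζ : C(ℝ≥0, ℝ))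
    (x : Space d) : Continuous fun t => _root_.pathFlow H ζ v t x := by
  have hC := hv.nonneg_bound hH
  set C := c + 2 * (νl 0)⁻ with hCd
  rw [continuous_iff_continuousAt]
  intro t₀
  rw [Metric.continuousAt_iff]
  intro ε hε
  set ω := ε / (2 * C + 1) / 2 with hω
  have hω0 : 0 < ω := by positivity
  obtain ⟨δ, hδ, h⟩ := Metric.continuousAt_iff.1 (ζ.continuous.continuousAt (x := t₀)) ω hω0
  refine ⟨δ, hδ, fun {t} ht => ?_⟩
  have hball : ∀ r ∈ Set.uIcc t₀ t, |ζ r - ζ t₀| < ω := fun r hr => by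
    refine h (lt_of_le_of_lt ?_ ht)
    rw [NNReal.dist_eq, NNReal.dist_eq]
    refine Set.abs_sub_left_of_mem_uIcc ?_
    rw [Set.mem_uIcc] at hr ⊢
    exact_mod_cast hr
  have hfin : C * (2 * ω) < ε := by
    have : ω * 2 * (2 * C + 1) = ε := by rw [hω]; field_simp
    nlinarith
  have h0 := hball t₀ Set.left_mem_uIcc
  have h1 := hball t Set.right_mem_uIcc
  rw [Real.dist_eq]
  refine lt_of_le_of_lt ?_ hfin
  rcases le_total t t₀ with hle | hle
  · rw [abs_sub_comm]
    refine hv.abs_pathFlow_sub_le hH hle (fun r hr1 hr2 => ?_) x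
    have h2 := hball r (by rw [Set.uIcc_of_ge hle]; exact ⟨hr1, hr2⟩)
    rw [abs_lt] at *
    rw [abs_le]; constructor <;> linarith
  · refine hv.abs_pathFlow_sub_le hH hle (fun r hr1 hr2 => ?_) x
    have h2 := hball r (by rw [Set.uIcc_of_le hle]; exact ⟨hr1, hr2⟩)
    linarith

lemma CostDominated.continuous_pathFlow (hH : IsConvexCoerciveHamiltonian H νl νu)
    {K : ℝ≥0} (hv : CostDominated H (νl K) v)
    (ζ : C(ℝ≥0, ℝ)) : Continuous fun q : Space d × ℝ≥0 => _root_.pathFlow H ζ v q.2 q.1 :=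
  continuous_prod_of_continuous_lipschitzWith _ K (fun x => hv.continuous_pathFlow_time hH ζ x)
    fun t => hH.lipschitz_of_costDominated (hv.pathFlow hH ζ t)

lemma CostDominated.abs_pathFlow_sub_le_of_abs_sub_le (hH : IsConvexCoerciveHamiltonian H νl νu)
    {c' : ℝ} {w : Space d → ℝ}
    (hv : CostDominated H c v) (hw : CostDominated H c' w) {D : ℝ} (h : ∀ x, |v x - w x| ≤ D)
    (ζ : C(ℝ≥0, ℝ)) (t : ℝ≥0) (x : Space d) :
    |_root_.pathFlow H ζ v t x - _root_.pathFlow H ζ w t x| ≤ D := by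
  have hv' := hv.weaken (le_max_left c c')
  have hw' := hw.weaken (le_max_right c c')
  rw [abs_sub_le_iff, sub_le_iff_le_add', sub_le_iff_le_add']
  exact ⟨hv'.pathFlow_le_add hH hw' (fun x => by linarith [(abs_sub_le_iff.1 (h x)).1]) ζ t x,
    hw'.pathFlow_le_add hH hv' (fun x => by linarith [(abs_sub_le_iff.1 (h x)).2]) ζ t x⟩

/-- `w` is the flow along `ζ` started from `u₀`, defined through approximation of `u₀`. -/
def IsFlow (H : Space d → Space d → ℝ) (ζ : C(ℝ≥0, ℝ)) (u₀ : Space d → ℝ)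
    (w : C(Space d × ℝ≥0, ℝ)) : Prop :=
  ∀ ⦃ε c v⦄, CostDominated H c v → (∀ x, |u₀ x - v x| ≤ ε) →
    ∀ x t, |w (x, t) - pathFlow H ζ v t x| ≤ ε

lemma IsFlow.eq_pathFlow {w : C(Space d × ℝ≥0, ℝ)} (hw : IsFlow H ζ u₀ w)
    (hu : CostDominated H c u₀) (x : Space d) (t : ℝ≥0) : w (x, t) = pathFlow H ζ u₀ t x := by
  have := hw hu (ε := 0) (by simp) x t
  rwa [abs_nonpos_iff, sub_eq_zero] at this

lemma IsConvexCoerciveHamiltonian.exists_approx (hH : IsConvexCoerciveHamiltonian H νl νu)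
    (hu : UniformContinuous u₀) {ε : ℝ} (hε : 0 < ε) :
    ∃ (K L : ℝ≥0) (v : Space d → ℝ), CostDominated H (νl K) v ∧ LipschitzWith L v ∧
      ∀ x, |u₀ x - v x| ≤ ε := by
  obtain ⟨L, v, hv, h⟩ := hu.exists_lipschitz_approx hε
  obtain ⟨K, hK⟩ := hH.exists_lower_eq L
  exact ⟨K, L, v, hK ▸ hH.costDominated_of_lipschitz hv, hv, h⟩

/-- The flow does not expand uniform distances of data, at any time. Flows of approximants therefore
converge uniformly on the whole space-time, and the limit is continuous. -/
lemma exists_isFlow (hH : IsConvexCoerciveHamiltonian H νl νu)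
    (hu : UniformContinuous u₀) (ζ : C(ℝ≥0, ℝ)) :
    ∃ w : C(Space d × ℝ≥0, ℝ), IsFlow H ζ u₀ w := by
  have hex := fun n : ℕ => hH.exists_approx hu (Nat.one_div_pos_of_nat (α := ℝ) (n := n))
  choose K L v hv _ hvu using hex
  have htend : Tendsto (fun n : ℕ => 1 / ((n : ℝ) + 1)) atTop (𝓝 0) :=
    tendsto_one_div_add_atTop_nhds_zero_nat
  have hdiff : ∀ n c (w : Space d → ℝ) (ε : ℝ), CostDominated H c w → (∀ x, |u₀ x - w x| ≤ ε) →
      ∀ x t, |pathFlow H ζ (v n) t x - pathFlow H ζ w t x| ≤ 1 / ((n : ℝ) + 1) + ε := by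
    intro n c w ε hw h x t
    refine (hv n).abs_pathFlow_sub_le_of_abs_sub_le hH hw (fun x => ?_) ζ t x
    have h1 := hvu n x
    have h2 := h x
    rw [abs_le] at *
    constructor <;> linarith
  have hcauchy : ∀ x t, CauchySeq fun n => pathFlow H ζ (v n) t x := by
    intro x t
    refine cauchySeq_of_le_tendsto_0 (fun n : ℕ => 2 * (1 / ((n : ℝ) + 1))) (fun n m N hn hm => ?_)
      (by simpa using htend.const_mul 2)
    rw [Real.dist_eq]
    have h1 := hdiff n _ (v m) _ (hv m) (hvu m) x t
    have h2 := Nat.one_div_le_one_div (α := ℝ) hn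
    have h3 := Nat.one_div_le_one_div (α := ℝ) hm
    linarith
  choose w hw using fun x t => cauchySeq_tendsto_of_complete (hcauchy x t)
  have hbound : ∀ c (v' : Space d → ℝ) (ε : ℝ), CostDominated H c v' →
      (∀ x, |u₀ x - v' x| ≤ ε) → ∀ x t, |w x t - pathFlow H ζ v' t x| ≤ ε := by
    intro c v' ε hv' h x t
    have h1 := ((hw x t).sub_const (pathFlow H ζ v' t x)).abs
    have h2 : Tendsto (fun n : ℕ => 1 / ((n : ℝ) + 1) + ε) atTop (𝓝 (0 + ε)) :=
      htend.add_const ε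
    rw [zero_add] at h2
    exact le_of_tendsto_of_tendsto' h1 h2 fun n => hdiff n c v' ε hv' h x t
  have hunif : TendstoUniformly (fun n (q : Space d × ℝ≥0) => pathFlow H ζ (v n) q.2 q.1)
      (fun q => w q.1 q.2) atTop := by
    rw [Metric.tendstoUniformly_iff]
    intro ε hε
    filter_upwards [htend.eventually_lt_const hε] with n hn q
    rw [Real.dist_eq]
    exact (hbound _ (v n) _ (hv n) (hvu n) q.1 q.2).trans_lt hn
  refine ⟨⟨fun q => w q.1 q.2, hunif.continuous
    (Filter.Frequently.of_forall fun n => (hv n).continuous_pathFlow hH ζ)⟩, ?_⟩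
  intro ε c v' hv' h x t
  exact hbound c v' ε hv' h x t

lemma IsFlow.flip (hH : IsConvexCoerciveHamiltonian H νl νu)
    {w : C(Space d × ℝ≥0, ℝ)} (hw : IsFlow H ζ u₀ w) :
    IsFlow (flipHam H) (-ζ) (-u₀) (-w) := by
  intro ε c v hv h x t
  have hv' : CostDominated H c (-v) := by simpa using hv.flip
  have h1 := hw hv' (ε := ε) (fun x => by
    rw [← abs_neg]; convert h x using 2; simp; ring) x t
  have h2 := hv'.pathFlow_flip hH ζ t x
  rw [neg_neg] at h2
  rw [h2, ← abs_neg]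
  convert h1 using 2
  simp only [ContinuousMap.neg_apply]; ring

lemma IsFlow.subsolution (hH : IsConvexCoerciveHamiltonian H νl νu)
    {w : C(Space d × ℝ≥0, ℝ)} (hw : IsFlow H ζ u₀ w)
    (hu : UniformContinuous u₀) : IsViscositySubsolution H ζ w := by
  refine isViscositySubsolution_of_uniform_approx hH fun ε hε => ?_
  obtain ⟨K, L, v, hv, -, h⟩ := hH.exists_approx hu hε
  exact ⟨⟨_, hv.continuous_pathFlow hH ζ⟩, hv.pathFlow_subsolution hH ζ fun x t => rfl,
    fun q => hw hv h q.1 q.2⟩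

lemma IsFlow.isViscositySolution (hH : IsConvexCoerciveHamiltonian H νl νu)
    {w : C(Space d × ℝ≥0, ℝ)} (hw : IsFlow H ζ u₀ w)
    (hu : UniformContinuous u₀) : IsViscositySolution H ζ u₀ w where
  subsolution := hw.subsolution hH hu
  supersolution := by
    have := ((hw.flip hH).subsolution hH.flip hu.neg).flip
    simpa using this
  initial x := by
    refine eq_of_abs_sub_le_all fun ε hε => ?_
    obtain ⟨K, L, v, hv, -, h⟩ := hH.exists_approx hu (half_pos hε)
    have h1 := hw hv h x 0
    rw [hv.pathFlow_zero hH] at h1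
    have h2 := h x
    rw [abs_le] at *
    constructor <;> linarith
  linear_growth T := by
    obtain ⟨K, L, v, hv, hL, h⟩ := hH.exists_approx hu one_pos
    obtain ⟨M, hM⟩ := (isCompact_Icc (a := (0 : ℝ≥0)) (b := T)).exists_bound_of_continuousOn
      ζ.continuous.continuousOn
    have hC := hv.nonneg_bound hH
    set C := νl K + 2 * (νl 0)⁻
    refine ⟨1 + C * (2 * M) + |v 0| + L, fun x t ht => ?_⟩
    have h1 := hw hv h x t
    have h2 := hv.abs_pathFlow_sub_le hH (ζ := ζ) (s := 0) (t := t) (M := 2 * M) zero_le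
      (fun r _ hr => by
        have a1 := hM r ⟨zero_le, hr.trans ht⟩
        have a2 := hM 0 ⟨le_rfl, zero_le⟩
        rw [Real.norm_eq_abs] at a1 a2
        rw [abs_le] at *
        constructor <;> linarith) x
    rw [hv.pathFlow_zero hH] at h2
    have h3 := hL.dist_le_mul x 0
    rw [Real.dist_eq, dist_zero_right] at h3
    have h4 : |w (x, t)| ≤ 1 + C * (2 * M) + |v 0| + L * ‖x‖ := by
      have h5 := abs_le.1 h1
      have h6 := abs_le.1 h2
      have h7 := abs_le.1 h3
      rw [abs_le]
      constructor <;> linarith [le_abs_self (v 0), neg_abs_le (v 0), h5.1, h5.2]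
    have hM0 : 0 ≤ M := (norm_nonneg _).trans (hM 0 ⟨le_rfl, zero_le⟩)
    have h8 : 0 ≤ (1 + C * (2 * M) + |v 0|) * ‖x‖ := by positivity
    have h9 : (0 : ℝ) ≤ L := L.2
    nlinarith

/-- Uniqueness of the solution for piecewise `C¹` paths. -/
lemma IsFlow.eq_of_isViscositySolution (hH : IsConvexCoerciveHamiltonian H νl νu)
    {w u : C(Space d × ℝ≥0, ℝ)} (hw : IsFlow H ζ u₀ w)
    (hu₀ : UniformContinuous u₀) (hζ : IsPiecewiseC1Path ζ) (hu : IsViscositySolution H ζ u₀ u) :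
    u = w := by
  ext ⟨x, t⟩
  refine eq_of_abs_sub_le_all fun ε hε => ?_
  obtain ⟨K, L, v, hv, hL, h⟩ := hH.exists_approx hu₀ (by positivity : 0 < ε / 2)
  -- The data `v + ε / 2` and `v - ε / 2` enclose `u₀`, and their flows are Lipschitz in space, as
  -- comparison requires of one of the two functions.
  have hsol : ∀ D : ℝ, ∃ f : C(Space d × ℝ≥0, ℝ),
      IsViscositySolution H ζ (fun x => v x + D) f ∧
        (∀ t, LipschitzWith K fun x => f (x, t)) ∧
        ∀ x t, f (x, t) = pathFlow H ζ (fun x => v x + D) t x := by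
    intro D
    have hLD : LipschitzWith L (fun x => v x + D) := by
      simpa using hL.add (LipschitzWith.const D)
    have huc := hLD.uniformContinuous
    obtain ⟨f, hf⟩ := exists_isFlow hH huc ζ
    have e := hf.eq_pathFlow (hv.add_const D)
    exact ⟨f, hf.isViscositySolution hH huc, fun t => by
      simp_rw [fun x => e x t]
      exact hH.lipschitz_of_costDominated ((hv.add_const D).pathFlow hH ζ t), e⟩
  obtain ⟨f, hf, hfK, hfe⟩ := hsol (ε / 2)
  obtain ⟨g, hg, hgK, hge⟩ := hsol (-(ε / 2))
  have h1 := comparison_of_lipschitz_supersolution hH hζ hu.subsolution hf.supersolution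
    hu.linear_growth hf.linear_growth hfK (fun x => by
      rw [hu.initial, hf.initial]; linarith [(abs_le.1 (h x)).2]) x t
  have h2 := comparison_of_lipschitz_subsolution hH hζ hg.subsolution hu.supersolution
    hg.linear_growth hu.linear_growth hgK (fun x => by
      rw [hu.initial, hg.initial]; linarith [(abs_le.1 (h x)).1]) x t
  rw [hfe] at h1
  rw [hge] at h2
  have h3 := (hv.add_const (ε / 2)).pathFlow_le_add hH hv (D := ε / 2) (fun x => le_rfl) ζ t x
  have h4 := hv.pathFlow_le_add hH (hv.add_const (-(ε / 2))) (D := ε / 2)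
    (fun x => by linarith) ζ t x
  have h5 := abs_le.1 (hw hv h x t)
  rw [abs_le]
  constructor <;> linarith [h5.1, h5.2]

end Solutions

/-! ### The solution operator -/

section SolutionOperator

open Filter Topology

variable {d : ℕ} {H : Space d → Space d → ℝ} {νl νu : ℝ → ℝ} {u₀ : Space d → ℝ}

lemma IsC1Path.isPiecewiseC1Path {ζ : C(ℝ≥0, ℝ)} (hζ : IsC1Path ζ) : IsPiecewiseC1Path ζ := by
  intro t ht
  -- For `t > 0` the left interval is all of `[0, t]`; at `t = 0` there is none and any length
  -- serves.
  refine ⟨if 0 < t then t else 1, by split_ifs <;> simp_all, ?_, fun h => ?_⟩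
  · exact hζ.mono fun r hr => ht.trans hr.1
  · rw [if_pos h, sub_self]
    exact hζ.mono fun r hr => hr.1

/-- By Weierstrass, polynomials within `1 / (n + 1)` of `ζ` on `[0, n]` converge locally uniformly.
-/
lemma dense_isC1Path : Dense {ζ : C(ℝ≥0, ℝ) | IsC1Path ζ} := by
  intro ζ
  have hex : ∀ n : ℕ, ∃ p : Polynomial ℝ, ∀ t ∈ Set.Icc (0 : ℝ) n,
      |p.eval t - pathExt ζ t| < 1 / ((n : ℝ) + 1) := fun n =>
    exists_polynomial_near_of_continuousOn 0 n (pathExt ζ)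
      (ζ.continuous.comp continuous_real_toNNReal).continuousOn _ Nat.one_div_pos_of_nat
  choose p hp using hex
  set η : ℕ → C(ℝ≥0, ℝ) := fun n => ⟨fun t => (p n).eval (t : ℝ), by fun_prop⟩ with hη
  refine mem_closure_of_tendsto (f := η) (b := atTop) ?_ (.of_forall fun n => ?_)
  · rw [ContinuousMap.tendsto_iff_forall_isCompact_tendstoUniformlyOn]
    intro K hK
    rw [Metric.tendstoUniformlyOn_iff]
    intro ε hε
    obtain ⟨R, hR⟩ := hK.bddAbove
    obtain ⟨N, hN⟩ := exists_nat_ge (R : ℝ)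
    have ht : Tendsto (fun n : ℕ => 1 / ((n : ℝ) + 1)) atTop (𝓝 0) :=
      tendsto_one_div_add_atTop_nhds_zero_nat
    filter_upwards [ht.eventually_lt_const hε, eventually_ge_atTop N] with n hn hnN t htK
    have htn : (t : ℝ) ≤ n :=
      (NNReal.coe_le_coe.2 (hR htK)).trans (hN.trans (by exact_mod_cast hnN))
    have := hp n t ⟨t.2, htn⟩
    rw [pathExt_coe] at this
    rw [dist_comm, Real.dist_eq]
    exact this.trans hn
  · have hsm : ContDiffOn ℝ 1 (fun t : ℝ => (p n).eval t) (Set.Ici 0) :=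
      by simpa using ((p n).contDiff_aeval (𝕜 := ℝ) 1).contDiffOn
    refine hsm.congr fun t ht => ?_
    simp only [pathExt, hη, ContinuousMap.coe_mk]
    rw [Real.coe_toNNReal t ht]

lemma abs_sub_le_pathDist {ζ₁ ζ₂ : C(ℝ≥0, ℝ)} {T s : ℝ≥0} (hs : s ≤ T) :
    |ζ₁ s - ζ₂ s| ≤ pathDist T ζ₁ ζ₂ := by
  refine le_csSup ?_ ⟨s, ⟨zero_le, hs⟩, rfl⟩
  exact (isCompact_Icc.image_of_continuousOn
    (ζ₁.continuous.sub ζ₂.continuous).abs.continuousOn).bddAbove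

lemma discreteFlow_add_const (a : ℕ → ℝ) (D : ℝ) (n : ℕ) (u : Space d → ℝ) :
    discreteFlow H (fun k => a k + D) n u = discreteFlow H a n u := by
  induction n with
  | zero => rfl
  | succ n ih => simp only [discreteFlow, ih, add_sub_add_right_eq_sub]

lemma pathFlow_add_const (ζ : C(ℝ≥0, ℝ)) (D : ℝ) (u : Space d → ℝ) :
    pathFlow H (ζ + ContinuousMap.const _ D) u = pathFlow H ζ u := by
  funext t x
  simp only [pathFlow, gridFlow]
  congr 1
  funext n
  exact congrFun (discreteFlow_add_const (sample ζ n t) D _ u) x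

/-- Dependence of the flow on paths with possibly different initial values. -/
lemma CostDominated.abs_pathFlow_sub_le_path (hH : IsConvexCoerciveHamiltonian H νl νu)
    {c : ℝ} (hu : CostDominated H c u₀)
    {ζ₁ ζ₂ : C(ℝ≥0, ℝ)} {t : ℝ≥0} {M : ℝ} (hM : ∀ s ≤ t, |ζ₁ s - ζ₂ s| ≤ M) (x : Space d) :
    |_root_.pathFlow H ζ₁ u₀ t x - _root_.pathFlow H ζ₂ u₀ t x|
      ≤ 2 * (c + 2 * (νl 0)⁻) * M := by
  -- Only increments of the path matter, so the initial values can be matched. The distance at most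
  -- doubles, hence the factor `2`.
  set η := ζ₂ + ContinuousMap.const _ (ζ₁ 0 - ζ₂ 0) with hη
  have hval : ∀ s, η s = ζ₂ s + (ζ₁ 0 - ζ₂ 0) := fun s => rfl
  have h0 : ζ₁ 0 = η 0 := by rw [hval]; ring
  have hb : ∀ s ≤ t, |ζ₁ s - η s| ≤ 2 * M := fun s hs => by
    have h1 := hM s hs
    have h2 := hM 0 zero_le
    rw [hval]
    rw [abs_le] at *
    constructor <;> linarith
  have e : _root_.pathFlow H ζ₂ u₀ t x = _root_.pathFlow H η u₀ t x := by
    rw [hη, pathFlow_add_const]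
  have h1 := hu.pathFlow_le hH h0 (fun s hs => (abs_sub_le_iff.1 (hb s hs)).1) x
  have h2 := hu.pathFlow_le hH h0.symm (fun s hs => (abs_sub_le_iff.1 (hb s hs)).2) x
  obtain ⟨h3, h4⟩ := abs_sub_le_iff.1 (hb t le_rfl)
  have hm : 0 ≤ (νl 0)⁻ := negPart_nonneg _
  have h5 := mul_le_mul_of_nonneg_left h3 hm
  have h6 := mul_le_mul_of_nonneg_left h4 hm
  rw [e, abs_sub_le_iff]
  constructor <;> nlinarith

lemma continuous_of_forall_isFlow (hH : IsConvexCoerciveHamiltonian H νl νu)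
    (hu : UniformContinuous u₀)
    {S : C(ℝ≥0, ℝ) → C(Space d × ℝ≥0, ℝ)} (hS : ∀ ζ, IsFlow H ζ u₀ (S ζ)) : Continuous S := by
  rw [continuous_iff_continuousAt]
  intro ζ
  rw [ContinuousAt, ContinuousMap.tendsto_iff_forall_isCompact_tendstoUniformlyOn]
  intro Q hQ
  rw [Metric.tendstoUniformlyOn_iff]
  intro ε hε
  obtain ⟨K, L, v, hv, -, h⟩ := hH.exists_approx hu (by positivity : 0 < ε / 4)
  have hC := hv.nonneg_bound hH
  set C := νl K + 2 * (νl 0)⁻ with hCd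
  obtain ⟨T, hT⟩ := (hQ.image continuous_snd).bddAbove
  set ω := ε / 4 / (2 * C + 1) with hω
  have hω0 : 0 < ω := by positivity
  have hnear : ∀ᶠ η : C(ℝ≥0, ℝ) in 𝓝 ζ, ∀ s ∈ Set.Icc (0 : ℝ≥0) T, dist (ζ s) (η s) < ω := by
    have := (ContinuousMap.tendsto_iff_forall_isCompact_tendstoUniformlyOn.1
      (tendsto_id (α := C(ℝ≥0, ℝ)) (x := 𝓝 ζ))) _ (isCompact_Icc (a := (0 : ℝ≥0)) (b := T))
    exact Metric.tendstoUniformlyOn_iff.1 this ω hω0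
  filter_upwards [hnear] with η hη q hq
  have hqT : q.2 ≤ T := hT ⟨q, hq, rfl⟩
  have h1 := hS ζ hv h q.1 q.2
  have h2 := hS η hv h q.1 q.2
  have h3 := hv.abs_pathFlow_sub_le_path hH (ζ₁ := ζ) (ζ₂ := η) (t := q.2) (M := ω)
    (fun s hs => by
      have := hη s ⟨zero_le, hs.trans hqT⟩
      rw [Real.dist_eq] at this; exact this.le) q.1
  have h4 : 2 * C * ω ≤ ε / 4 := by
    have : ω * (2 * C + 1) = ε / 4 := by rw [hω]; field_simp
    nlinarith
  rw [Real.dist_eq, abs_lt]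
  rw [abs_le] at *
  constructor <;> linarith

lemma exists_solutionOperator (hH : IsConvexCoerciveHamiltonian H νl νu)
    (hu : UniformContinuous u₀) :
    ∃ S : C(ℝ≥0, ℝ) → C(Space d × ℝ≥0, ℝ), IsSolutionOperator H u₀ S ∧
      ∀ ζ, IsFlow H ζ u₀ (S ζ) := by
  choose S hS using exists_isFlow hH hu
  exact ⟨S, ⟨continuous_of_forall_isFlow hH hu hS,
    fun ζ _ => (hS ζ).isViscositySolution hH hu⟩, hS⟩

/-- Uniqueness fixes any solution operator on the dense set of `C¹` paths and continuity fixes it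
everywhere, so it inherits every property of the flow. -/
lemma IsSolutionOperator.isFlow (hH : IsConvexCoerciveHamiltonian H νl νu)
    (hu : UniformContinuous u₀)
    {S : C(ℝ≥0, ℝ) → C(Space d × ℝ≥0, ℝ)} (hS : IsSolutionOperator H u₀ S) (ζ : C(ℝ≥0, ℝ)) :
    IsFlow H ζ u₀ (S ζ) := by
  obtain ⟨S', hS', hflow⟩ := exists_solutionOperator hH hu
  have : S = S' := Continuous.ext_on dense_isC1Path hS.1 hS'.1 fun η hη =>
    (hflow η).eq_of_isViscositySolution hH hu (IsC1Path.isPiecewiseC1Path hη) (hS.2 η hη)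
  rw [this]
  exact hflow ζ

end SolutionOperator

theorem theoremT {d : ℕ} (H : Space d → Space d → ℝ) (νl νu : ℝ → ℝ)
    (hH : IsConvexCoerciveHamiltonian H νl νu) :
    -- estimates for the viscosity solutions driven by piecewise `C¹` paths;
    -- `K` is the value at `νu L` of the inverse function of `νl`
    (∀ (L : ℝ≥0), ∃ K : ℝ≥0, νl K = νu L ∧
      ∀ (u₀₁ u₀₂ : Space d → ℝ), LipschitzWith L u₀₁ → LipschitzWith L u₀₂ →
      ∀ (ζ₁ ζ₂ : C(ℝ≥0, ℝ)), IsPiecewiseC1Path ζ₁ → IsPiecewiseC1Path ζ₂ →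
      ∀ (u₁ u₂ : C(Space d × ℝ≥0, ℝ)),
        IsViscositySolution H ζ₁ u₀₁ u₁ → IsViscositySolution H ζ₂ u₀₂ u₂ →
        (∀ t : ℝ≥0, LipschitzWith K (fun x => u₁ (x, t)) ∧ LipschitzWith K (fun x => u₂ (x, t))) ∧
        (ζ₁ 0 = ζ₂ 0 → ∀ D : ℝ, (∀ x, |u₀₁ x - u₀₂ x| ≤ D) →
          ∀ (T t : ℝ≥0), t ≤ T → ∀ x : Space d,
            u₁ (x, t) - u₂ (x, t) ≤ D + νu L * pathDist T ζ₁ ζ₂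
              + (νl 0)⁻ * (pathDist T ζ₁ ζ₂ - (ζ₁ t - ζ₂ t)) ∧
            |u₁ (x, t) - u₂ (x, t)| ≤ D + νu L * pathDist T ζ₁ ζ₂
              + (νl 0)⁻ * (pathDist T ζ₁ ζ₂ + |ζ₁ t - ζ₂ t|))) ∧
    -- well-posedness and unique continuous extension to continuous paths
    (∀ u₀ : Space d → ℝ, UniformContinuous u₀ →
      (∃! S : C(ℝ≥0, ℝ) → C(Space d × ℝ≥0, ℝ), IsSolutionOperator H u₀ S) ∧
      ∀ S : C(ℝ≥0, ℝ) → C(Space d × ℝ≥0, ℝ), IsSolutionOperator H u₀ S →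
        ∀ ζ, IsPiecewiseC1Path ζ → ∀ u, IsViscositySolution H ζ u₀ u ↔ u = S ζ) ∧
    -- estimates for the extended solution operator, for arbitrary continuous paths
    (∀ (L : ℝ≥0), ∃ K : ℝ≥0, νl K = νu L ∧
      ∀ u₀ : Space d → ℝ, LipschitzWith L u₀ →
      ∀ S : C(ℝ≥0, ℝ) → C(Space d × ℝ≥0, ℝ), IsSolutionOperator H u₀ S →
        (∀ ζ, ∀ t : ℝ≥0, LipschitzWith K (fun x => S ζ (x, t))) ∧
        (∀ (ζ₁ ζ₂ : C(ℝ≥0, ℝ)) (T t : ℝ≥0), t ≤ T → ∀ x : Space d,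
          |S ζ₁ (x, t) - S ζ₂ (x, t)| ≤
            2 * (νu L + 2 * (νl 0)⁻) * pathDist T ζ₁ ζ₂)) := by
  refine ⟨fun L => ?_, fun u₀ hu₀ => ⟨?_, fun S hS ζ hζ u => ⟨fun hu => ?_, ?_⟩⟩, fun L => ?_⟩
  · obtain ⟨K, hK⟩ := hH.exists_lower_eq L
    refine ⟨K, hK, fun u₀₁ u₀₂ h₁ h₂ ζ₁ ζ₂ hζ₁ hζ₂ u₁ u₂ hu₁ hu₂ => ?_⟩
    have flow : ∀ {u₀ : Space d → ℝ} {ζ : C(ℝ≥0, ℝ)} {u : C(Space d × ℝ≥0, ℝ)},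
        LipschitzWith L u₀ → IsPiecewiseC1Path ζ → IsViscositySolution H ζ u₀ u →
          ∀ x t, u (x, t) = pathFlow H ζ u₀ t x := by
      intro u₀ ζ u hL hζ hu
      obtain ⟨w, hw⟩ := exists_isFlow hH hL.uniformContinuous ζ
      rw [hw.eq_of_isViscositySolution hH hL.uniformContinuous hζ hu]
      exact hw.eq_pathFlow (hH.costDominated_of_lipschitz hL)
    have e₁ := flow h₁ hζ₁ hu₁
    have e₂ := flow h₂ hζ₂ hu₂
    have c₁ := hH.costDominated_of_lipschitz h₁
    have c₂ := hH.costDominated_of_lipschitz h₂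
    refine ⟨fun t => ⟨?_, ?_⟩, fun h0 D hD T t htT x => ?_⟩
    · simp_rw [fun x => e₁ x t]
      exact hH.lipschitz_of_costDominated (hK ▸ c₁.pathFlow hH ζ₁ t)
    · simp_rw [fun x => e₂ x t]
      exact hH.lipschitz_of_costDominated (hK ▸ c₂.pathFlow hH ζ₂ t)
    · rw [e₁, e₂]
      have hM : ∀ s ≤ t, |ζ₁ s - ζ₂ s| ≤ pathDist T ζ₁ ζ₂ := fun s hs =>
        abs_sub_le_pathDist (hs.trans htT)
      -- The data are exchanged along a fixed path (`a₁`, `a₂`), then the path with fixed data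
      -- (`b₁`, `b₂`).
      have a₁ := c₁.pathFlow_le_add hH c₂ (D := D)
        (fun x => by linarith [(abs_le.1 (hD x)).2]) ζ₁ t x
      have a₂ := c₂.pathFlow_le_add hH c₁ (D := D)
        (fun x => by linarith [(abs_le.1 (hD x)).1]) ζ₂ t x
      have b₁ := c₂.pathFlow_le hH h0 (fun s hs => (abs_sub_le_iff.1 (hM s hs)).1) x
      have b₂ := c₁.pathFlow_le hH h0.symm (fun s hs => (abs_sub_le_iff.1 (hM s hs)).2) x
      have hm : 0 ≤ (νl 0)⁻ := negPart_nonneg _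
      have m₁ := mul_le_mul_of_nonneg_left (neg_le_abs (ζ₁ t - ζ₂ t)) hm
      have m₂ := mul_le_mul_of_nonneg_left (le_abs_self (ζ₁ t - ζ₂ t)) hm
      refine ⟨by linarith, ?_⟩
      rw [abs_sub_le_iff]
      constructor <;> linarith
  · obtain ⟨S, hS, hflow⟩ := exists_solutionOperator hH hu₀
    refine ⟨S, hS, fun S' hS' => ?_⟩
    exact Continuous.ext_on dense_isC1Path hS'.1 hS.1 fun η hη =>
      (hflow η).eq_of_isViscositySolution hH hu₀ (IsC1Path.isPiecewiseC1Path hη) (hS'.2 η hη)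
  · exact (hS.isFlow hH hu₀ ζ).eq_of_isViscositySolution hH hu₀ hζ hu
  · rintro rfl
    exact (hS.isFlow hH hu₀ ζ).isViscositySolution hH hu₀
  · obtain ⟨K, hK⟩ := hH.exists_lower_eq L
    refine ⟨K, hK, fun u₀ hu₀ S hS => ?_⟩
    have c := hH.costDominated_of_lipschitz hu₀
    have e := fun ζ => (hS.isFlow hH hu₀.uniformContinuous ζ).eq_pathFlow c
    refine ⟨fun ζ t => ?_, fun ζ₁ ζ₂ T t htT x => ?_⟩
    · simp_rw [fun x => e ζ x t]
      exact hH.lipschitz_of_costDominated (hK ▸ c.pathFlow hH ζ t)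
    · rw [e, e]
      exact c.abs_pathFlow_sub_le_path hH (fun s hs => abs_sub_le_pathDist (hs.trans htT)) x
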